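/- Let $n\ge 1$ and $\alpha\in(\tfrac12,1)$. Consider the generalized Navier–Stokes equations on $\mathbb R^n$ $$u_t+(u\cdot\nabla)u+(-\Delta)^\alpha u+\nabla p=0,\qquad \nabla\cdot u=0,\qquad u(0)=u_0 ,$$ and write $S(t)=e^{-t(-\Delta)^\alpha}$ for the fractional heat semigroup and $\Pi$ for the Leray projection, the Fourier multiplier with symbol $\delta_{ij}-\xi_i\xi_j/|\xi|^2$. Let $\mathcal B=\dot B^{1-2\alpha,\infty}_\infty(\mathbb R^n)$ be the homogeneous Besov space of tempered distributions $v\in\mathcal S'_h$ (that is, $\|\theta(\lambda D)v\|_{L^\infty}\to0$ as $\lambda\to\infty$ for every $\theta\in C_c^\infty(\mathbb R^n)$) with $\|v\|_{\mathcal B}=\sup_{j\in\mathbb Z}2^{j(1-2\alpha)}\|P_jv\|_{L^\infty}<\infty$, where $P_j$ are the dyadic Littlewood–Paley blocks; for a vector field take the largest of the norms of the components. For $k\ge 0$ put $$\|u\|_{GX^k}=\sup_{|\beta|=k}\ \sup_{t>0}\ t^{(1-\frac1{2\alpha})+\frac{k}{2\alpha}}\,\|\partial_x^\beta u(\cdot,t)\|_{L^\infty(\mathbb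 R^n)},\qquad GX=GX^0 .$$ A mild solution in $GX$ is a measurable real vector field $u$ on $\mathbb R^n\times(0,\infty)$ with $\|u\|_{GX}<\infty$ and $$u(x,t)=S(t)u_0(x)-\int_0^t S(t-s)\,\Pi\nabla\cdot\big(u(s)\otimes u(s)\big)(x)\,ds\qquad\text{for all }t>0,\ x\in\mathbb R^n .$$ **Theorem.** There are constants $\varepsilon,r,C>0$ depending only on $n$ and $\alpha$ such that for every real vector-valued $u_0\in\mathcal B$ with $\nabla\cdot u_0=0$ in the sense of distributions and $\|u_0\|_{\mathcal B}\le\varepsilon$, there is a mild solution $u$ in $GX$ with $\|u\|_{GX}\le r$, it is the only mild solution with $\|u\|_{GX}\le r$, and: 1. for every $t>0$ the function $x\mapsto u(x,t)$ is real-analytic on $\mathbb R^n$; 2. $\|u\|_{GX^k}\le C^{k-1}k^{k-1}$ for every integer $k\ge1$. -/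

import Mathlib

open MeasureTheory Set Filter Topology
open scoped SchwartzMap FourierTransform LineDeriv ENNReal ContDiff

noncomputable section

namespace FracNS

/-- The space `ℝⁿ` with its Euclidean norm. -/
abbrev Vec (n : ℕ) : Type := EuclideanSpace ℝ (Fin n)

/-- The `i`-th standard basis vector of `ℝⁿ`. -/
def basisVec {n : ℕ} (i : Fin n) : Vec n := EuclideanSpace.single i (1 : ℝ)

/-! ### Fourier multipliers on tempered distributions -/

theorem hasCompactSupport_wave_mul {n : ℕ} {m : Vec n → ℂ} (hm : HasCompactSupport m) (x : Vec n) :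
    HasCompactSupport (fun ξ : Vec n => Complex.exp (2 * Real.pi * inner ℝ x ξ * Complex.I) * m ξ) :=
  hm.mul_left

theorem contDiff_wave_mul {n : ℕ} {m : Vec n → ℂ} (hm : ContDiff ℝ ∞ m) (x : Vec n) :
    ContDiff ℝ ∞ (fun ξ : Vec n => Complex.exp (2 * Real.pi * inner ℝ x ξ * Complex.I) * m ξ) := by
  have h : ContDiff ℝ ∞ (fun ξ : Vec n => ((inner ℝ x ξ : ℝ) : ℂ)) :=
    Complex.ofRealCLM.contDiff.comp (contDiff_const.inner ℝ contDiff_id)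
  exact ((contDiff_const.mul h).mul contDiff_const).cexp.mul hm

/-- For a smooth compactly supported symbol `m`, the smooth function
`m(D) v = 𝓕⁻¹ (m v̂)`, given at `x` by `⟨v̂, e^{2πi ⟪x, ·⟫} m⟩`.
(Only used for smooth compactly supported `m`.) -/
def multiplierFun {n : ℕ} (m : Vec n → ℂ) (v : 𝓢'(Vec n, ℂ)) (x : Vec n) : ℂ :=
  open Classical in
  if h : HasCompactSupport m ∧ ContDiff ℝ ∞ m then
    (𝓕 v) ((hasCompactSupport_wave_mul h.1 x).toSchwartzMap (contDiff_wave_mul h.2 x))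
  else 0

/-- A smooth function equal to `1` on `‖η‖ ≤ 1` and to `0` on `‖η‖² ≥ 2`. -/
def ballCutoff {n : ℕ} (η : Vec n) : ℝ := Real.smoothTransition (2 - ‖η‖ ^ 2)

/-- The Littlewood–Paley annulus function `φ(η) = χ(η/2) - χ(η)`; it satisfies
`∑_{j ∈ ℤ} φ(2^{-j} η) = 1` for `η ≠ 0`. -/
def annulus {n : ℕ} (η : Vec n) : ℝ := ballCutoff ((1 / 2 : ℝ) • η) - ballCutoff η

/-- The symbol of the dyadic block `P_j`. Mathlib's Fourier transform uses `e^{-2πi⟪x,ξ⟫}`, so the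
angular frequency is `2πξ`. -/
def blockSymbol {n : ℕ} (j : ℤ) (ξ : Vec n) : ℂ :=
  ((annulus (((2 : ℝ) ^ (-j) * (2 * Real.pi)) • ξ) : ℝ) : ℂ)

/-- The symbol `e^{-t|2πξ|^{2α}}` of the fractional heat semigroup `S(t) = e^{-t(-Δ)^α}`. -/
def heatSymbol {n : ℕ} (α t : ℝ) (ξ : Vec n) : ℂ :=
  ((Real.exp (-(t * (2 * Real.pi * ‖ξ‖) ^ (2 * α))) : ℝ) : ℂ)

theorem contDiff_annulus {n : ℕ} : ContDiff ℝ ∞ (annulus : Vec n → ℝ) := by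
  have h : ContDiff ℝ ∞ (ballCutoff : Vec n → ℝ) :=
    Real.smoothTransition.contDiff.comp (contDiff_const.sub (contDiff_norm_sq ℝ))
  exact (h.comp (contDiff_const_smul (1 / 2 : ℝ))).sub h

theorem annulus_eq_zero_of_le {n : ℕ} {η : Vec n} (h : ‖η‖ ≤ 1) : annulus η = 0 := by
  have h0 := norm_nonneg η
  unfold annulus ballCutoff
  rw [Real.smoothTransition.one_of_one_le, Real.smoothTransition.one_of_one_le, sub_self]
  · nlinarith
  · rw [norm_smul, Real.norm_eq_abs, abs_of_pos (by norm_num : (0 : ℝ) < 1 / 2)]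
    nlinarith

theorem annulus_eq_zero_of_ge {n : ℕ} {η : Vec n} (h : 3 ≤ ‖η‖) : annulus η = 0 := by
  unfold annulus ballCutoff
  rw [Real.smoothTransition.zero_of_nonpos, Real.smoothTransition.zero_of_nonpos, sub_self]
  · nlinarith
  · rw [norm_smul, Real.norm_eq_abs, abs_of_pos (by norm_num : (0 : ℝ) < 1 / 2)]
    nlinarith

theorem hasCompactSupport_blockSymbol {n : ℕ} (j : ℤ) :
    HasCompactSupport (blockSymbol j : Vec n → ℂ) := by
  have hc : (0 : ℝ) < (2 : ℝ) ^ (-j) * (2 * Real.pi) := by positivity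
  refine HasCompactSupport.of_support_subset_isCompact
    (isCompact_closedBall (0 : Vec n) (3 / ((2 : ℝ) ^ (-j) * (2 * Real.pi)))) ?_
  intro ξ hξ
  by_contra hx
  refine hξ ?_
  rw [mem_closedBall_zero_iff, not_le, div_lt_iff₀ hc] at hx
  have : annulus (((2 : ℝ) ^ (-j) * (2 * Real.pi)) • ξ) = 0 := by
    apply annulus_eq_zero_of_ge
    rw [norm_smul, Real.norm_eq_abs, abs_of_pos hc]
    linarith
  simp only [blockSymbol, this, Complex.ofReal_zero]

theorem contDiff_blockSymbol {n : ℕ} (j : ℤ) : ContDiff ℝ ∞ (blockSymbol j : Vec n → ℂ) :=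
  Complex.ofRealCLM.contDiff.comp (contDiff_annulus.comp (contDiff_const_smul _))

theorem contDiff_block_heat {n : ℕ} (α t : ℝ) (j : ℤ) :
    ContDiff ℝ ∞ (fun ξ : Vec n => blockSymbol j ξ * heatSymbol α t ξ) := by
  have hc : (0 : ℝ) < (2 : ℝ) ^ (-j) * (2 * Real.pi) := by positivity
  rw [contDiff_iff_contDiffAt]
  intro ξ
  by_cases hξ : ξ = 0
  · have h0 : (fun ξ : Vec n => blockSymbol j ξ * heatSymbol α t ξ) =ᶠ[𝓝 ξ] fun _ => 0 := by
      filter_upwards [Metric.ball_mem_nhds ξ (inv_pos.2 hc)] with y hy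
      have : annulus (((2 : ℝ) ^ (-j) * (2 * Real.pi)) • y) = 0 := by
        apply annulus_eq_zero_of_le
        rw [hξ, mem_ball_zero_iff] at hy
        rw [norm_smul, Real.norm_eq_abs, abs_of_pos hc]
        have := mul_le_mul_of_nonneg_left hy.le hc.le
        rwa [mul_inv_cancel₀ hc.ne'] at this
      simp only [blockSymbol, this, Complex.ofReal_zero, zero_mul]
    exact contDiffAt_const.congr_of_eventuallyEq h0
  · refine (contDiff_blockSymbol j).contDiffAt.mul ?_
    have hn : (2 * Real.pi * ‖ξ‖) ≠ 0 := by
      have := norm_pos_iff.2 hξ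
      positivity
    have h1 : ContDiffAt ℝ ∞ (fun ξ : Vec n => 2 * Real.pi * ‖ξ‖) ξ :=
      contDiffAt_const.mul (contDiffAt_norm ℝ hξ)
    have h2 := ((contDiffAt_const (c := t)).mul (h1.rpow_const_of_ne (p := 2 * α) hn)).neg.exp
    exact Complex.ofRealCLM.contDiff.contDiffAt.comp ξ h2

/-- The dyadic block `P_j v`, a smooth function. -/
def block {n : ℕ} (j : ℤ) (v : 𝓢'(Vec n, ℂ)) : Vec n → ℂ :=
  multiplierFun (blockSymbol j) v

/-- The supremum norm of a (continuous) function. -/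
def supNorm {n : ℕ} (f : Vec n → ℂ) : ℝ≥0∞ := ⨆ x, ‖f x‖ₑ

/-- The class `𝓢'_h`: for every smooth compactly supported `θ`,
`‖θ(λD)v‖_{L^∞} → 0` as `λ → ∞`. -/
def InSh {n : ℕ} (v : 𝓢'(Vec n, ℂ)) : Prop :=
  ∀ θ : Vec n → ℂ, HasCompactSupport θ → ContDiff ℝ ∞ θ →
    Tendsto (fun l : ℝ => supNorm (multiplierFun (fun ξ => θ (l • ξ)) v)) atTop (𝓝 0)

/-- The norm of the homogeneous Besov space of regularity `1 - 2α` with both other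
indices `∞`: `sup_j 2^{j(1-2α)} ‖P_j v‖_{L^∞}`. -/
def besovNorm {n : ℕ} (α : ℝ) (v : 𝓢'(Vec n, ℂ)) : ℝ≥0∞ :=
  ⨆ j : ℤ, ENNReal.ofReal ((2 : ℝ) ^ ((j : ℝ) * (1 - 2 * α))) * supNorm (block j v)

/-- The function `S(t)v = ∑_j 𝓕⁻¹ (e^{-t|·|^{2α}} φ(2^{-j}·) v̂)`, for `v ∈ 𝓢'_h` with finite
Besov norm and `t > 0`. -/
def heatFlow {n : ℕ} (α t : ℝ) (v : 𝓢'(Vec n, ℂ)) (x : Vec n) : ℂ :=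
  ∑' j : ℤ, multiplierFun (fun ξ => blockSymbol j ξ * heatSymbol α t ξ) v x

/-- A complex tempered distribution is real if it is real on real test functions. -/
def IsRealDistribution {n : ℕ} (v : 𝓢'(Vec n, ℂ)) : Prop :=
  ∀ φ : 𝓢(Vec n, ℂ), (∀ x, (φ x).im = 0) → (v φ).im = 0

/-- Admissible initial velocities: real vector fields `u₀ = (u₀ᵢ)` of tempered distributions
with components in `𝓢'_h`, and `∇ · u₀ = 0` in the sense of distributions. -/
structure IsInitialVelocity {n : ℕ} (u₀ : Fin n → 𝓢'(Vec n, ℂ)) : Prop where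
  real : ∀ i, IsRealDistribution (u₀ i)
  inSh : ∀ i, InSh (u₀ i)
  div_free : ∑ i, ∂_{(basisVec i : Vec n)} (u₀ i) = 0

/-- The norm of a vector field in `ℬ`: the largest Besov norm of the components. -/
def bNorm {n : ℕ} (α : ℝ) (u₀ : Fin n → 𝓢'(Vec n, ℂ)) : ℝ≥0∞ := ⨆ i, besovNorm α (u₀ i)

/-! ### Mild solutions -/

/-- The kernel of `∂_k Π_{ij} S(t)`, where `Π` is the Leray projection, i.e. the inverse Fourier
transform of `2πi ξ_k (δ_{ij} - ξ_i ξ_j / |ξ|²) e^{-t|2πξ|^{2α}}`. -/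
def oseenKernel {n : ℕ} (α t : ℝ) (i j k : Fin n) : Vec n → ℂ :=
  𝓕⁻ (fun ξ : Vec n =>
    2 * Real.pi * Complex.I * (ξ k : ℂ) *
      (((if i = j then (1 : ℝ) else 0) - ξ i * ξ j / ‖ξ‖ ^ 2 : ℝ) : ℂ) * heatSymbol α t ξ)

/-- The `i`-th component of `∫₀ᵗ S(t-s) Π ∇·(u ⊗ u)(s) ds` at the point `x`. -/
def duhamel {n : ℕ} (α : ℝ) (u : ℝ → Vec n → Vec n) (t : ℝ) (x : Vec n) (i : Fin n) : ℂ :=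
  ∫ s in (0 : ℝ)..t, ∫ y : Vec n, ∑ j, ∑ k,
    oseenKernel α (t - s) i j k (x - y) * ((u s y j * u s y k : ℝ) : ℂ)

/-- `‖u‖_{GX} = sup_{t>0} t^{1-1/(2α)} ‖u(t)‖_{L^∞}`. -/
def gxNorm {n : ℕ} (α : ℝ) (u : ℝ → Vec n → Vec n) : ℝ≥0∞ :=
  ⨆ t : ℝ, ⨆ _ : 0 < t,
    ENNReal.ofReal (t ^ (1 - 1 / (2 * α))) * eLpNorm (u t) ⊤ volume

/-- `‖u‖_{GX^k} = sup_{|β|=k} sup_{t>0} t^{1-1/(2α)+k/(2α)} ‖∂_x^β u(t)‖_{L^∞}` for fields `u` that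
are `C^k` in `x`; the partial derivatives of order `k` are
written `∂_{d 0} ⋯ ∂_{d (k-1)}` with `d : Fin k → Fin n`. -/
def gxNormDeriv {n : ℕ} (α : ℝ) (k : ℕ) (u : ℝ → Vec n → Vec n) : ℝ≥0∞ :=
  ⨆ d : Fin k → Fin n, ⨆ t : ℝ, ⨆ _ : 0 < t,
    ENNReal.ofReal (t ^ (1 - 1 / (2 * α) + k / (2 * α))) *
      eLpNorm (fun x => iteratedFDeriv ℝ k (u t) x (fun l => basisVec (d l))) ⊤ volume

/-- `u` (on `t > 0`) is a mild solution in `GX` of the generalized Navier–Stokes equations with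
initial velocity `u₀`: `u(t) = S(t)u₀ - ∫₀ᵗ S(t-s) Π ∇·(u ⊗ u)(s) ds`. -/
structure IsMildSolution {n : ℕ} (α : ℝ) (u₀ : Fin n → 𝓢'(Vec n, ℂ))
    (u : ℝ → Vec n → Vec n) : Prop where
  measurable : AEStronglyMeasurable (fun p : ℝ × Vec n => u p.1 p.2)
    (volume.restrict (Ioi (0 : ℝ) ×ˢ (univ : Set (Vec n))))
  mem_gx : gxNorm α u < ⊤
  eqn : ∀ t : ℝ, 0 < t → ∀ (x : Vec n) (i : Fin n),
    ((u t x i : ℝ) : ℂ) = heatFlow α t (u₀ i) x - duhamel α u t x i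

end FracNS

end

/-! Put p = 1/(2α), so that 1/2 < p < 1. The equation is solved by Picard iteration directly in a
space of fields that are analytic in x, with a radius of analyticity growing like the natural length
t^p. The norm is encoded by `AnaBound r M f`: all derivatives satisfy |D^k f| ≤ M k! / (r^k
(k+1)^2). Three facts let the iteration close without any loss of radius.

Products: the factor (k+1)^{-2} makes Leibniz sums reproduce the weight up to the constant 16
(`AnaBound.mul`).

Convolutions: if the derivatives of a kernel have L¹ norms of radius r and f has radius s, the
convolution has radius r + s (`AnaBound.conv`). Indeed a derivative of order k may be shared between
kernel and function in each of k+1 ways, and the average of the resulting bounds with binomial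
weights is the bound for radius r + s.

Time: since p ≤ 1, t^p ≤ (t-s)^p + s^p. The kernel of S(t-s)Π∇· has radius proportional to (t-s)^p
and u ⊗ u(s) has radius proportional to s^p, so the whole Duhamel integral has radius proportional
to t^p with the same constant (`AnaBound.duhamelOp`). The amplitudes are governed by the integral of
(t-s)^{-p} s^{-2(1-p)}, which converges because p < 1 and 2(1-p) < 1, and which is of order
t^{-(1-p)}, the weight of GX. The bilinear term is thus bounded in a scale-invariant norm and small
data give a contraction (`anaField_picard`, `exists_fixedPoint`).

The linear inputs are kernel estimates. The symbol exp(-t|2πξ|^{2α}) need not be smooth at the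
origin, so it is written as a superposition of dilated truncated powers (1-|ξ|²/τ)_+^N, whose
kernels are integrable (`stretched_exp_eq_integral`, `l1Le_heatDeriv`). Splitting the time into
equal pieces, with at most one derivative on each, gives analytic bounds (`exists_heatDeriv_bound`).
The Leray factor ξ_iξ_j/|ξ|² is a Gamma integral of heat symbols (`oseenSymbol_eq`), which yields
the Oseen kernel (`exists_oseen_bound`). For Besov data each dyadic piece of S(t)u₀ is the
convolution of an explicit kernel with P_j u₀ (`heatFlow_term_eq`), and the sum over j gives
t^{-(1-p)} (`exists_heatFlow_bound`).

Uniqueness uses only the weighted sup norm (`fixedPoint_unique`). Analyticity and the GX^k bounds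
are read off from `AnaBound`; the ball is chosen so small that its amplitude is at most the radius
constant δ, and then k! ≤ k^{k-1} gives the bound with C = 1/δ. -/

namespace FracNS

/-! ### Families of iterated directional derivatives -/

section NormProd

variable {E : Type*} [NormedAddCommGroup E]

/-- The product of the norms of the vectors of a list. -/
noncomputable def normProd (l : List E) : ℝ := (l.map norm).prod

@[simp] theorem normProd_nil : normProd ([] : List E) = 1 := rfl

@[simp] theorem normProd_cons (v : E) (l : List E) : normProd (v :: l) = ‖v‖ * normProd l := by
  simp [normProd]

@[simp] theorem normProd_append (l l' : List E) : normProd (l ++ l') = normProd l * normProd l' := by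
  simp [normProd]

theorem normProd_nonneg (l : List E) : 0 ≤ normProd l := by
  induction l with
  | nil => simp
  | cons v l ih => rw [normProd_cons]; positivity

theorem normProd_ofFn {k : ℕ} (v : Fin k → E) : normProd (List.ofFn v) = ∏ i, ‖v i‖ := by
  simp [normProd, List.prod_ofFn, List.map_ofFn]

end NormProd

section Jets

variable {E F G : Type*} [NormedAddCommGroup E] [NormedSpace ℝ E]
  [NormedAddCommGroup F] [NormedSpace ℝ F] [NormedAddCommGroup G] [NormedSpace ℝ G]

/-- The iterated directional derivative along the vectors of a list. -/
noncomputable def dirDeriv (f : E → F) : List E → E → F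
  | [] => f
  | v :: l => fun x => fderiv ℝ (dirDeriv f l) x v

/-- `J` is a family of functions in which `J (v :: l)` is the derivative of `J l` along `v`. -/
def IsJet (J : List E → E → F) : Prop :=
  ∀ l x, ∃ A : E →L[ℝ] F, HasFDerivAt (J l) A x ∧ ∀ v, A v = J (v :: l) x

theorem IsJet.differentiable {J : List E → E → F} (hJ : IsJet J) (l : List E) :
    Differentiable ℝ (J l) := fun x => by
  obtain ⟨A, hA, -⟩ := hJ l x
  exact hA.differentiableAt

theorem IsJet.fderiv_apply {J : List E → E → F} (hJ : IsJet J) (l : List E) (x v : E) :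
    fderiv ℝ (J l) x v = J (v :: l) x := by
  obtain ⟨A, hA, h⟩ := hJ l x
  rw [hA.fderiv, h]

/-- Every member of a jet is differentiable, hence continuous, and its directional derivatives are
again members. In finite dimension smoothness of the derivative can be tested one direction at a
time, so an induction over the order applies to all lists at once. -/
theorem IsJet.contDiff [FiniteDimensional ℝ E] {J : List E → E → F} (hJ : IsJet J) (l : List E) :
    ContDiff ℝ ∞ (J l) := by
  rw [contDiff_infty]
  intro m
  induction m generalizing l with
  | zero => exact contDiff_zero.2 (hJ.differentiable l).continuous
  | succ m ih =>
    push_cast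
    rw [contDiff_succ_iff_fderiv]
    refine ⟨hJ.differentiable l, by simp, ?_⟩
    rw [contDiff_clm_apply_iff]
    intro v
    have : (fun x => fderiv ℝ (J l) x v) = J (v :: l) := funext fun x => hJ.fderiv_apply l x v
    rw [this]
    exact ih _

theorem IsJet.iteratedFDeriv_apply [FiniteDimensional ℝ E] {J : List E → E → F} (hJ : IsJet J)
    {k : ℕ} (v : Fin k → E) (x : E) :
    iteratedFDeriv ℝ k (J []) x v = J (List.ofFn v) x := by
  induction k generalizing x with
  | zero => simp
  | succ k ih =>
    have hd : DifferentiableAt ℝ (iteratedFDeriv ℝ k (J [])) x :=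
      ((hJ.contDiff []).differentiable_iteratedFDeriv (m := k)
        (by exact_mod_cast WithTop.coe_lt_top _)).differentiableAt
    rw [hd.iteratedFDeriv_succ_apply_left', List.ofFn_succ, ← hJ.fderiv_apply]
    congr 2
    funext y
    exact ih (Fin.tail v) y

theorem contDiff_dirDeriv {f : E → F} (hf : ContDiff ℝ ∞ f) (l : List E) :
    ContDiff ℝ ∞ (dirDeriv f l) := by
  induction l with
  | nil => exact hf
  | cons v l ih =>
    exact (ih.fderiv_right (m := ∞) (by simp)).clm_apply contDiff_const

theorem isJet_dirDeriv {f : E → F} (hf : ContDiff ℝ ∞ f) : IsJet (dirDeriv f) := fun l x =>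
  ⟨_, ((contDiff_dirDeriv hf l).differentiable (by simp)).differentiableAt.hasFDerivAt,
    fun _ => rfl⟩

theorem dirDeriv_ofFn [FiniteDimensional ℝ E] {f : E → F} (hf : ContDiff ℝ ∞ f) {k : ℕ}
    (v : Fin k → E) (x : E) : dirDeriv f (List.ofFn v) x = iteratedFDeriv ℝ k f x v :=
  ((isJet_dirDeriv hf).iteratedFDeriv_apply v x).symm

theorem norm_dirDeriv_le [FiniteDimensional ℝ E] {f : E → F} (hf : ContDiff ℝ ∞ f) (l : List E)
    (x : E) : ‖dirDeriv f l x‖ ≤ ‖iteratedFDeriv ℝ l.length f x‖ * normProd l := by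
  have h := dirDeriv_ofFn hf l.get x
  rw [List.ofFn_get] at h
  rw [h]
  refine (ContinuousMultilinearMap.le_opNorm _ _).trans_eq ?_
  rw [← normProd_ofFn, List.ofFn_get]

end Jets

/-! ### Analytic bounds -/

section AnaBound

variable {E F G : Type*} [NormedAddCommGroup E] [NormedSpace ℝ E]
  [NormedAddCommGroup F] [NormedSpace ℝ F] [NormedAddCommGroup G] [NormedSpace ℝ G]

/-- The weight `k! / (r^k (k+1)^2)`. -/
noncomputable def anaWeight (r : ℝ) (k : ℕ) : ℝ := (k.factorial : ℝ) / (r ^ k * ((k : ℝ) + 1) ^ 2)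

theorem anaWeight_pos {r : ℝ} (hr : 0 < r) (k : ℕ) : 0 < anaWeight r k := by
  unfold anaWeight
  have := k.factorial_pos
  positivity

theorem anaWeight_zero (r : ℝ) : anaWeight r 0 = 1 := by simp [anaWeight]

theorem anaWeight_anti {r s : ℝ} (hr : 0 < r) (hrs : r ≤ s) (k : ℕ) :
    anaWeight s k ≤ anaWeight r k := by
  unfold anaWeight
  gcongr

theorem anaWeight_le {r : ℝ} (hr : 0 < r) (k : ℕ) : anaWeight r k ≤ k.factorial / r ^ k := by
  unfold anaWeight
  have : (1 : ℝ) ≤ ((k : ℝ) + 1) ^ 2 := by nlinarith [(Nat.cast_nonneg k : (0 : ℝ) ≤ k)]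
  gcongr
  exact le_mul_of_one_le_right (by positivity) this

/-! ### Convolution sums of the weights -/

theorem sum_inv_sq_le (k : ℕ) : ∑ j ∈ Finset.range (k + 1), (((j : ℝ) + 1) ^ 2)⁻¹ ≤ 2 := by
  have h : ∀ k : ℕ, ∑ j ∈ Finset.range (k + 1), (((j : ℝ) + 1) ^ 2)⁻¹ ≤ 2 - 1 / ((k : ℝ) + 1) := by
    intro k
    induction k with
    | zero => norm_num
    | succ k ih =>
      rw [Finset.sum_range_succ]
      push_cast
      have hk : (0 : ℝ) ≤ k := Nat.cast_nonneg k
      have : (((k : ℝ) + 1 + 1) ^ 2)⁻¹ ≤ 1 / ((k : ℝ) + 1) - 1 / ((k : ℝ) + 1 + 1) := by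
        rw [div_sub_div _ _ (by positivity) (by positivity), inv_eq_one_div,
          div_le_div_iff₀ (by positivity) (by positivity)]
        nlinarith
      linarith
  refine (h k).trans ?_
  have : (0 : ℝ) ≤ 1 / ((k : ℝ) + 1) := by positivity
  linarith

/-- With a = j+1 and b = k-j+1 one has (k+1)² ≤ 2(a²+b²), hence 1/(a²b²) ≤ 2(k+1)^{-2}(1/a²+1/b²).
The two remaining sums are at most 2 each, so even 8 would do in place of 16. -/
theorem sum_inv_sq_mul_inv_sq_le (k : ℕ) :
    ∑ j ∈ Finset.range (k + 1), (((j : ℝ) + 1) ^ 2)⁻¹ * ((((k - j : ℕ) : ℝ) + 1) ^ 2)⁻¹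
      ≤ 16 * (((k : ℝ) + 1) ^ 2)⁻¹ := by
  have hk : (0 : ℝ) ≤ k := Nat.cast_nonneg k
  have h1 : ∀ j ∈ Finset.range (k + 1),
      (((j : ℝ) + 1) ^ 2)⁻¹ * ((((k - j : ℕ) : ℝ) + 1) ^ 2)⁻¹ ≤
        2 * (((k : ℝ) + 1) ^ 2)⁻¹ * ((((j : ℝ) + 1) ^ 2)⁻¹ + ((((k - j : ℕ) : ℝ) + 1) ^ 2)⁻¹) := by
    intro j hj
    have hj' : j ≤ k := by simpa [Nat.lt_succ_iff] using hj
    obtain ⟨i, rfl⟩ := Nat.exists_eq_add_of_le hj'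
    have hi : (j + i - j) = i := by omega
    rw [hi]
    push_cast
    have hj0 : (0 : ℝ) ≤ j := Nat.cast_nonneg j
    have hi0 : (0 : ℝ) ≤ i := Nat.cast_nonneg i
    have e : 2 * ((((j : ℝ) + i) + 1) ^ 2)⁻¹ * ((((j : ℝ) + 1) ^ 2)⁻¹ + (((i : ℝ) + 1) ^ 2)⁻¹)
        = (2 * (((j : ℝ) + 1) ^ 2 + ((i : ℝ) + 1) ^ 2) / (((j : ℝ) + i) + 1) ^ 2) *
          ((((j : ℝ) + 1) ^ 2)⁻¹ * (((i : ℝ) + 1) ^ 2)⁻¹) := by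
      field_simp
      ring
    rw [e]
    refine le_mul_of_one_le_left (by positivity) ?_
    rw [one_le_div (by positivity)]
    nlinarith [sq_nonneg ((j : ℝ) - i)]
  refine (Finset.sum_le_sum h1).trans ?_
  rw [← Finset.mul_sum, Finset.sum_add_distrib]
  have h2 : ∑ j ∈ Finset.range (k + 1), ((((k - j : ℕ) : ℝ) + 1) ^ 2)⁻¹ =
      ∑ j ∈ Finset.range (k + 1), (((j : ℝ) + 1) ^ 2)⁻¹ := by
    rw [← Finset.sum_range_reflect (fun j => (((j : ℝ) + 1) ^ 2)⁻¹)]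
    rfl
  rw [h2]
  have h3 := sum_inv_sq_le k
  have h4 : (0 : ℝ) ≤ (((k : ℝ) + 1) ^ 2)⁻¹ := by positivity
  nlinarith

theorem choose_mul_anaWeight_mul {r s : ℝ} (hr : 0 < r) (hs : 0 < s) {k j : ℕ} (hj : j ≤ k) :
    (k.choose j : ℝ) * (anaWeight r j * anaWeight s (k - j)) =
      k.factorial / (r ^ j * s ^ (k - j)) *
        ((((j : ℝ) + 1) ^ 2)⁻¹ * ((((k - j : ℕ) : ℝ) + 1) ^ 2)⁻¹) := by
  have h := Nat.choose_mul_factorial_mul_factorial hj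
  have h' : (k.choose j : ℝ) * j.factorial * (k - j).factorial = k.factorial := by exact_mod_cast h
  unfold anaWeight
  rw [← h']
  field_simp

/-- The binomial coefficient cancels the factorials, leaving the discrete convolution of (j+1)^{-2}
with itself. With the plain weight k!/r^k the same Leibniz sum would lose a factor k+1. -/
theorem sum_choose_anaWeight_le {r : ℝ} (hr : 0 < r) (k : ℕ) :
    ∑ j ∈ Finset.range (k + 1), (k.choose j : ℝ) * (anaWeight r j * anaWeight r (k - j)) ≤
      16 * anaWeight r k := by
  have h1 : ∀ j ∈ Finset.range (k + 1),
      (k.choose j : ℝ) * (anaWeight r j * anaWeight r (k - j)) =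
        k.factorial / r ^ k * ((((j : ℝ) + 1) ^ 2)⁻¹ * ((((k - j : ℕ) : ℝ) + 1) ^ 2)⁻¹) := by
    intro j hj
    have hj' : j ≤ k := by simpa [Nat.lt_succ_iff] using hj
    rw [choose_mul_anaWeight_mul hr hr hj', ← pow_add, Nat.add_sub_cancel' hj']
  rw [Finset.sum_congr rfl h1, ← Finset.mul_sum]
  refine (mul_le_mul_of_nonneg_left (sum_inv_sq_mul_inv_sq_le k) (by positivity)).trans_eq ?_
  unfold anaWeight
  field_simp

/-- Binomially weighted mixed weights. -/
theorem sum_choose_anaWeight_add_le {r s : ℝ} (hr : 0 < r) (hs : 0 < s) (k : ℕ) :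
    ∑ j ∈ Finset.range (k + 1),
      ((k.choose j : ℝ) * (r ^ j * s ^ (k - j)) / (r + s) ^ k) *
        (anaWeight r j * anaWeight s (k - j)) ≤ 16 * anaWeight (r + s) k := by
  have h1 : ∀ j ∈ Finset.range (k + 1),
      ((k.choose j : ℝ) * (r ^ j * s ^ (k - j)) / (r + s) ^ k) *
        (anaWeight r j * anaWeight s (k - j)) =
        k.factorial / (r + s) ^ k *
          ((((j : ℝ) + 1) ^ 2)⁻¹ * ((((k - j : ℕ) : ℝ) + 1) ^ 2)⁻¹) := by
    intro j hj
    have hj' : j ≤ k := by simpa [Nat.lt_succ_iff] using hj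
    have e : ((k.choose j : ℝ) * (r ^ j * s ^ (k - j)) / (r + s) ^ k) *
        (anaWeight r j * anaWeight s (k - j)) = (r ^ j * s ^ (k - j)) / (r + s) ^ k *
          ((k.choose j : ℝ) * (anaWeight r j * anaWeight s (k - j))) := by ring
    rw [e, choose_mul_anaWeight_mul hr hs hj']
    field_simp
  rw [Finset.sum_congr rfl h1, ← Finset.mul_sum]
  refine (mul_le_mul_of_nonneg_left (sum_inv_sq_mul_inv_sq_le k) (by positivity)).trans_eq ?_
  unfold anaWeight
  field_simp

/-- If a quantity is bounded by every mixed product of weights, it is bounded by the weight of the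
sum of the radii. -/
theorem le_anaWeight_add {r s a M : ℝ} (hr : 0 < r) (hs : 0 < s) (hM : 0 ≤ M) (k : ℕ)
    (h : ∀ j ≤ k, a ≤ M * (anaWeight r j * anaWeight s (k - j))) :
    a ≤ 16 * M * anaWeight (r + s) k := by
  -- These coefficients are the binomial probabilities with parameter r/(r+s). Averaging the k+1
  -- available bounds with them turns every denominator r^j s^(k-j) into (r+s)^k.
  have hsum : ∑ j ∈ Finset.range (k + 1),
      ((k.choose j : ℝ) * (r ^ j * s ^ (k - j)) / (r + s) ^ k) = 1 := by
    rw [← Finset.sum_div, div_eq_one_iff_eq (by positivity), add_pow]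
    refine Finset.sum_congr rfl fun j _ => by ring
  calc a = ∑ j ∈ Finset.range (k + 1),
        ((k.choose j : ℝ) * (r ^ j * s ^ (k - j)) / (r + s) ^ k) * a := by
        rw [← Finset.sum_mul, hsum, one_mul]
    _ ≤ ∑ j ∈ Finset.range (k + 1), ((k.choose j : ℝ) * (r ^ j * s ^ (k - j)) / (r + s) ^ k) *
          (M * (anaWeight r j * anaWeight s (k - j))) := by
        refine Finset.sum_le_sum fun j hj => mul_le_mul_of_nonneg_left (h j ?_) (by positivity)
        simpa [Nat.lt_succ_iff] using hj
    _ = M * ∑ j ∈ Finset.range (k + 1), ((k.choose j : ℝ) * (r ^ j * s ^ (k - j)) / (r + s) ^ k) *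
          (anaWeight r j * anaWeight s (k - j)) := by
        rw [Finset.mul_sum]
        refine Finset.sum_congr rfl fun j _ => by ring
    _ ≤ M * (16 * anaWeight (r + s) k) :=
        mul_le_mul_of_nonneg_left (sum_choose_anaWeight_add_le hr hs k) hM
    _ = _ := by ring

/-- Smooth functions whose derivatives are bounded like those of a function that is analytic in a
strip of width `r`. -/
structure AnaBound (r M : ℝ) (f : E → F) : Prop where
  contDiff : ContDiff ℝ ∞ f
  bound : ∀ k x, ‖iteratedFDeriv ℝ k f x‖ ≤ M * anaWeight r k

theorem AnaBound.norm_le {r M : ℝ} {f : E → F} (hf : AnaBound r M f) (x : E) : ‖f x‖ ≤ M := by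
  simpa [anaWeight_zero] using hf.bound 0 x

theorem AnaBound.nonneg {r M : ℝ} {f : E → F} (hf : AnaBound r M f) : 0 ≤ M :=
  (norm_nonneg _).trans (hf.norm_le 0)

theorem AnaBound.mono {r M N : ℝ} {f : E → F} (hr : 0 < r) (hf : AnaBound r M f) (h : M ≤ N) :
    AnaBound r N f :=
  ⟨hf.contDiff, fun k x => (hf.bound k x).trans
    (mul_le_mul_of_nonneg_right h (anaWeight_pos hr k).le)⟩

theorem AnaBound.anti {r s M : ℝ} {f : E → F} (hr : 0 < r) (hrs : r ≤ s) (hf : AnaBound s M f) :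
    AnaBound r M f :=
  ⟨hf.contDiff, fun k x => (hf.bound k x).trans
    (mul_le_mul_of_nonneg_left (anaWeight_anti hr hrs k) hf.nonneg)⟩

/-- Used to prove analytic bounds for integrals: there one controls each iterated directional
derivative by a formula, and the operator norm of the full derivative follows because the bound is
multilinear in the directions. -/
theorem AnaBound.of_jet [FiniteDimensional ℝ E] {r M : ℝ} (hr : 0 < r) (hM : 0 ≤ M)
    {J : List E → E → F} (hJ : IsJet J)
    (h : ∀ l x, ‖J l x‖ ≤ M * anaWeight r l.length * normProd l) : AnaBound r M (J []) := by
  refine ⟨hJ.contDiff [], fun k x => ?_⟩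
  refine ContinuousMultilinearMap.opNorm_le_bound (mul_nonneg hM (anaWeight_pos hr k).le)
    fun v => ?_
  rw [hJ.iteratedFDeriv_apply, ← normProd_ofFn]
  simpa using h (List.ofFn v) x

theorem AnaBound.norm_dirDeriv_le [FiniteDimensional ℝ E] {r M : ℝ} {f : E → F}
    (hf : AnaBound r M f) (l : List E) (x : E) :
    ‖dirDeriv f l x‖ ≤ M * anaWeight r l.length * normProd l :=
  (FracNS.norm_dirDeriv_le hf.contDiff l x).trans
    (mul_le_mul_of_nonneg_right (hf.bound _ x) (normProd_nonneg l))

/-! ### Algebraic operations, series and analyticity -/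

theorem AnaBound.mul {r M N : ℝ} {f g : E → ℂ} (hr : 0 < r) (hf : AnaBound r M f)
    (hg : AnaBound r N g) : AnaBound r (16 * M * N) (fun x => f x * g x) := by
  refine ⟨hf.contDiff.mul hg.contDiff, fun k x => ?_⟩
  refine (norm_iteratedFDeriv_mul_le hf.contDiff hg.contDiff x (n := k)
    (by exact_mod_cast le_top)).trans ?_
  have h1 : ∀ j ∈ Finset.range (k + 1),
      (k.choose j : ℝ) * ‖iteratedFDeriv ℝ j f x‖ * ‖iteratedFDeriv ℝ (k - j) g x‖ ≤
        M * N * ((k.choose j : ℝ) * (anaWeight r j * anaWeight r (k - j))) := by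
    intro j _
    have := mul_le_mul (hf.bound j x) (hg.bound (k - j) x) (norm_nonneg _)
      (mul_nonneg hf.nonneg (anaWeight_pos hr j).le)
    calc _ = (k.choose j : ℝ) * (‖iteratedFDeriv ℝ j f x‖ * ‖iteratedFDeriv ℝ (k - j) g x‖) := by ring
      _ ≤ (k.choose j : ℝ) * (M * anaWeight r j * (N * anaWeight r (k - j))) := by gcongr
      _ = _ := by ring
  refine (Finset.sum_le_sum h1).trans ?_
  rw [← Finset.mul_sum]
  refine (mul_le_mul_of_nonneg_left (sum_choose_anaWeight_le hr k)
    (mul_nonneg hf.nonneg hg.nonneg)).trans_eq (by ring)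

theorem AnaBound.add {r M N : ℝ} {f g : E → F} (hf : AnaBound r M f) (hg : AnaBound r N g) :
    AnaBound r (M + N) (fun x => f x + g x) := by
  refine ⟨hf.contDiff.add hg.contDiff, fun k x => ?_⟩
  have h : iteratedFDeriv ℝ k (fun x => f x + g x) x =
      iteratedFDeriv ℝ k f x + iteratedFDeriv ℝ k g x :=
    iteratedFDeriv_add_apply (hf.contDiff.contDiffAt.of_le (by exact_mod_cast le_top))
      (hg.contDiff.contDiffAt.of_le (by exact_mod_cast le_top))
  rw [h, add_mul]
  exact (norm_add_le _ _).trans (add_le_add (hf.bound k x) (hg.bound k x))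

theorem AnaBound.neg {r M : ℝ} {f : E → F} (hf : AnaBound r M f) :
    AnaBound r M (fun x => - f x) := by
  refine ⟨hf.contDiff.neg, fun k x => ?_⟩
  have h : iteratedFDeriv ℝ k (fun x => - f x) x = - iteratedFDeriv ℝ k f x :=
    iteratedFDeriv_neg_apply
  rw [h, norm_neg]
  exact hf.bound k x

theorem AnaBound.sub {r M N : ℝ} {f g : E → F} (hf : AnaBound r M f) (hg : AnaBound r N g) :
    AnaBound r (M + N) (fun x => f x - g x) := by
  simpa [sub_eq_add_neg] using hf.add hg.neg

theorem anaBound_zero {r : ℝ} : AnaBound r 0 (fun _ : E => (0 : F)) :=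
  ⟨contDiff_const, fun k x => by simp⟩

theorem AnaBound.sum {ι : Type*} {r : ℝ} {s : Finset ι} {M : ι → ℝ} {f : ι → E → F}
    (hf : ∀ i ∈ s, AnaBound r (M i) (f i)) :
    AnaBound r (∑ i ∈ s, M i) (fun x => ∑ i ∈ s, f i x) := by
  classical
  induction s using Finset.induction_on with
  | empty => simpa using anaBound_zero
  | insert i s hi ih =>
    simp only [Finset.sum_insert hi]
    exact (hf i (by simp)).add (ih fun j hj => hf j (by simp [hj]))

theorem AnaBound.clm_comp {r M : ℝ} {f : E → F} (hf : AnaBound r M f)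
    (L : F →L[ℝ] G) : AnaBound r (‖L‖ * M) (fun x => L (f x)) := by
  refine ⟨L.contDiff.comp hf.contDiff, fun k x => ?_⟩
  refine (L.norm_iteratedFDeriv_comp_left hf.contDiff.contDiffAt
    (n := k) (by exact_mod_cast le_top)).trans ?_
  rw [mul_assoc]
  exact mul_le_mul_of_nonneg_left (hf.bound k x) (norm_nonneg _)

theorem AnaBound.tsum [CompleteSpace F] {ι : Type*} {r : ℝ} {M : ι → ℝ} {f : ι → E → F}
    (hf : ∀ i, AnaBound r (M i) (f i)) (hM : Summable M) :
    AnaBound r (∑' i, M i) (fun x => ∑' i, f i x) := by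
  have hs : ∀ k : ℕ, (k : ℕ∞) ≤ (⊤ : ℕ∞) → Summable fun i => M i * anaWeight r k :=
    fun k _ => hM.mul_right _
  have hb : ∀ (k : ℕ) (i : ι) (x : E), (k : ℕ∞) ≤ (⊤ : ℕ∞) →
    ‖iteratedFDeriv ℝ k (f i) x‖ ≤ M i * anaWeight r k := fun k i x _ => (hf i).bound k x
  refine ⟨contDiff_tsum (fun i => (hf i).contDiff) hs hb, fun k x => ?_⟩
  rw [iteratedFDeriv_tsum_apply (fun i => (hf i).contDiff) hs hb le_top x, ← tsum_mul_right]
  exact tsum_of_norm_bounded (hs k le_top).hasSum (fun i => hb k i x le_top)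

/-- Taylor's formula with integral remainder: for ‖y‖ < r the remainder after order m is at most
(m+1) M (‖y‖/r)^(m+1), where the factor m+1 comes from bounding (1-t)^m by 1. This tends to zero,
and the Taylor series has radius at least r. -/
theorem AnaBound.analyticOnNhd [CompleteSpace F] {r M : ℝ} (hr : 0 < r) {f : E → F}
    (hf : AnaBound r M f) : AnalyticOnNhd ℝ f univ := by
  intro x _
  let p : FormalMultilinearSeries ℝ E F := fun k => (k.factorial : ℝ)⁻¹ • iteratedFDeriv ℝ k f x
  have hpb : ∀ k, ‖p k‖ ≤ M * (r⁻¹) ^ k := by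
    intro k
    have h1 := (hf.bound k x).trans
      (mul_le_mul_of_nonneg_left (anaWeight_le hr k) hf.nonneg)
    have hk : (0 : ℝ) < k.factorial := by exact_mod_cast k.factorial_pos
    simp only [p, norm_smul, norm_inv, Real.norm_natCast]
    rw [inv_mul_le_iff₀ hk]
    refine h1.trans_eq ?_
    rw [inv_pow]
    field_simp
  have hrad : ENNReal.ofReal r ≤ p.radius := by
    rw [ENNReal.ofReal]
    refine p.le_radius_of_bound M fun k => ?_
    rw [Real.coe_toNNReal r hr.le]
    calc ‖p k‖ * r ^ k ≤ M * (r⁻¹) ^ k * r ^ k := by gcongr; exact hpb k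
      _ = M := by rw [mul_assoc, ← mul_pow, inv_mul_cancel₀ hr.ne', one_pow, mul_one]
  refine ⟨p, ENNReal.ofReal r, hrad, by simpa using hr, fun {y} hy => ?_⟩
  have hy' : ‖y‖ < r := by
    rw [Metric.eball_ofReal, mem_ball_zero_iff] at hy
    exact hy
  have hsum : Summable fun k => p k fun _ => y := by
    refine Summable.of_norm_bounded (g := fun k => M * (r⁻¹ * ‖y‖) ^ k) ?_ fun k => ?_
    · refine (summable_geometric_of_lt_one (by positivity) ?_).mul_left M
      rw [inv_mul_lt_iff₀ hr]; simpa using hy'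
    · refine ((p k).le_opNorm _).trans ?_
      rw [mul_pow, ← mul_assoc]
      simp only [Finset.prod_const, Finset.card_univ, Fintype.card_fin]
      gcongr
      exact hpb k
  refine (hsum.hasSum_iff_tendsto_nat).2 ?_
  rw [← tendsto_add_atTop_iff_nat 1, tendsto_iff_norm_sub_tendsto_zero]
  have hb : ∀ m : ℕ, ‖∑ k ∈ Finset.range (m + 1), (p k fun _ => y) - f (x + y)‖ ≤
      (m + 1) * (M * (r⁻¹ * ‖y‖) ^ (m + 1)) := by
    intro m
    rw [map_add_eq_sum_add_integral_iteratedFDeriv (n := m) (x := x) (y := y)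
      (fun t _ => hf.contDiff.contDiffAt.of_le (by exact_mod_cast le_top))]
    have e : ∀ a b : F, ‖a - (a + b)‖ = ‖b‖ := fun a b => by simp
    simp only [p, smul_apply]
    rw [e, norm_smul, norm_inv, Real.norm_natCast]
    have hm : (0 : ℝ) < m.factorial := by exact_mod_cast m.factorial_pos
    rw [inv_mul_le_iff₀ hm]
    refine (intervalIntegral.norm_integral_le_of_norm_le_const
      (C := M * ((m + 1).factorial / r ^ (m + 1)) * ‖y‖ ^ (m + 1)) ?_).trans_eq ?_
    · intro t ht
      rw [uIoc_of_le zero_le_one] at ht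
      rw [norm_smul]
      have h1 : ‖(1 - t) ^ m‖ ≤ 1 := by
        rw [norm_pow]
        refine pow_le_one₀ (norm_nonneg _) ?_
        rw [Real.norm_eq_abs, abs_le]
        constructor <;> linarith [ht.1, ht.2]
      refine (mul_le_of_le_one_left (norm_nonneg _) h1).trans ?_
      refine (ContinuousMultilinearMap.le_opNorm _ _).trans ?_
      simp only [Finset.prod_const, Finset.card_univ, Fintype.card_fin]
      gcongr
      exact (hf.bound _ _).trans (mul_le_mul_of_nonneg_left (anaWeight_le hr _) hf.nonneg)
    · rw [Nat.factorial_succ, mul_pow, inv_pow]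
      push_cast
      simp only [sub_zero, abs_one, mul_one]
      field_simp
  refine squeeze_zero (fun _ => norm_nonneg _) hb ?_
  have hq : ‖r⁻¹ * ‖y‖‖ < 1 := by
    rw [norm_mul, norm_norm, norm_inv, Real.norm_eq_abs, abs_of_pos hr, inv_mul_lt_iff₀ hr]
    simpa using hy'
  have := (tendsto_self_mul_const_pow_of_abs_lt_one hq).const_mul M
  rw [mul_zero, ← tendsto_add_atTop_iff_nat 1] at this
  refine this.congr fun m => ?_
  push_cast
  ring

end AnaBound

end FracNS

namespace FracNS

theorem normProd_reverse {E : Type*} [NormedAddCommGroup E] (l : List E) :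
    normProd l.reverse = normProd l := by
  simp [normProd, List.prod_reverse]

/-! ### Integrals of families of jets -/

section JetIntegral

set_option linter.unusedSectionVars false

variable {E F Ω : Type*} [NormedAddCommGroup E] [NormedSpace ℝ E] [FiniteDimensional ℝ E]
  [NormedAddCommGroup F] [NormedSpace ℝ F] [MeasurableSpace Ω] {μ : Measure Ω}

/-- Measurability passes from the function to all its derivatives, since these are limits of
difference quotients along the sequence of steps 1/m. -/
theorem aestronglyMeasurable_jet {J : Ω → List E → E → F} (hJ : ∀ᵐ a ∂μ, IsJet (J a))
    (hm : ∀ x, AEStronglyMeasurable (fun a => J a [] x) μ) (l : List E) (x : E) :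
    AEStronglyMeasurable (fun a => J a l x) μ := by
  induction l generalizing x with
  | nil => exact hm x
  | cons v l ih =>
    refine aestronglyMeasurable_of_tendsto_ae atTop
      (f := fun (m : ℕ) a => (m : ℝ) • (J a l (x + (m : ℝ)⁻¹ • v) - J a l x))
      (fun m => ((ih _).sub (ih _)).const_smul (m : ℝ)) ?_
    filter_upwards [hJ] with a ha
    obtain ⟨A, hA, h⟩ := ha l x
    rw [← h v]
    refine hA.lim v (c := fun m : ℕ => (m : ℝ)) ?_
    simpa using tendsto_natCast_atTop_atTop (R := ℝ)

theorem aestronglyMeasurable_clm {A : Ω → E →L[ℝ] F}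
    (h : ∀ v, AEStronglyMeasurable (fun a => A a v) μ) : AEStronglyMeasurable A μ := by
  classical
  let b := Module.finBasis ℝ E
  let c : ∀ i, F →L[ℝ] (E →L[ℝ] F) := fun i =>
    ContinuousLinearMap.smulRightL ℝ E F (LinearMap.toContinuousLinearMap (b.coord i))
  have e : A = fun a => ∑ i, c i (A a (b i)) := by
    funext a
    ext v
    have h1 : A a v = A a (∑ i, b.repr v i • b i) := by rw [b.sum_repr]
    rw [h1, map_sum]
    simp [c]
  rw [e]
  refine Finset.aestronglyMeasurable_fun_sum _ fun i _ => ?_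
  exact (c i).continuous.comp_aestronglyMeasurable (h _)

/-- Differentiation under the integral sign, one order at a time: the derivative of a member of
order k is dominated, uniformly in x, by the integrable bound for order k+1. -/
theorem isJet_integral [CompleteSpace F] {J : Ω → List E → E → F} (hJ : ∀ᵐ a ∂μ, IsJet (J a))
    (hm : ∀ x, AEStronglyMeasurable (fun a => J a [] x) μ) {B : ℕ → Ω → ℝ}
    (hB : ∀ k, Integrable (B k) μ)
    (h : ∀ᵐ a ∂μ, ∀ l x, ‖J a l x‖ ≤ B l.length a * normProd l) :
    IsJet (fun l x => ∫ a, J a l x ∂μ) := by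
  intro l x
  have hm' := aestronglyMeasurable_jet hJ hm
  have hi : ∀ l x, Integrable (fun a => J a l x) μ := fun l x =>
    Integrable.mono' ((hB l.length).mul_const (normProd l)) (hm' l x)
      (h.mono fun a ha => ha l x)
  have hA : ∀ᵐ a ∂μ, ∀ x v, fderiv ℝ (J a l) x v = J a (v :: l) x :=
    hJ.mono fun a ha x v => ha.fderiv_apply l x v
  have hAm : AEStronglyMeasurable (fun a => fderiv ℝ (J a l) x) μ := by
    refine aestronglyMeasurable_clm fun v => (hm' (v :: l) x).congr ?_
    exact hA.mono fun a ha => (ha x v).symm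
  have hbd : ∀ᵐ a ∂μ, ∀ x, ‖fderiv ℝ (J a l) x‖ ≤ |B (l.length + 1) a| * normProd l := by
    filter_upwards [h, hA] with a ha ha' x
    refine ContinuousLinearMap.opNorm_le_bound _
      (mul_nonneg (abs_nonneg _) (normProd_nonneg l)) fun v => ?_
    rw [ha' x v]
    refine (ha (v :: l) x).trans ?_
    rw [List.length_cons, normProd_cons, mul_comm ‖v‖, ← mul_assoc]
    have := normProd_nonneg l
    gcongr
    exact le_abs_self _
  refine ⟨∫ a, fderiv ℝ (J a l) x ∂μ, ?_, fun v => ?_⟩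
  · refine hasFDerivAt_integral_of_dominated_of_fderiv_le (s := univ) univ_mem
      (Eventually.of_forall fun y => hm' l y) (hi l x) hAm (hbd.mono fun a ha y _ => ha y)
      ((hB (l.length + 1)).abs.mul_const (normProd l)) ?_
    filter_upwards [hJ] with a ha y _
    exact (ha.differentiable l).differentiableAt.hasFDerivAt
  · have hAi : Integrable (fun a => fderiv ℝ (J a l) x) μ :=
      Integrable.mono' ((hB (l.length + 1)).abs.mul_const (normProd l)) hAm
        (hbd.mono fun a ha => ha x)
    rw [ContinuousLinearMap.integral_apply hAi]
    exact integral_congr_ae (hA.mono fun a ha => ha x v)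

theorem AnaBound.integral [CompleteSpace F] {r : ℝ} (hr : 0 < r) {b : Ω → ℝ} {g : Ω → E → F}
    (hg : ∀ᵐ a ∂μ, AnaBound r (b a) (g a)) (hb : Integrable b μ)
    (hm : ∀ x, AEStronglyMeasurable (fun a => g a x) μ) :
    AnaBound r (∫ a, b a ∂μ) (fun x => ∫ a, g a x ∂μ) := by
  have hJ : ∀ᵐ a ∂μ, IsJet (dirDeriv (g a)) := hg.mono fun a ha => isJet_dirDeriv ha.contDiff
  have hbd : ∀ᵐ a ∂μ, ∀ l x, ‖dirDeriv (g a) l x‖ ≤ b a * anaWeight r l.length * normProd l :=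
    hg.mono fun a ha l x => ha.norm_dirDeriv_le l x
  have hJ' := isJet_integral hJ hm (fun k => hb.mul_const (anaWeight r k)) hbd
  refine AnaBound.of_jet hr (integral_nonneg_of_ae (hg.mono fun a ha => ha.nonneg)) hJ'
    fun l x => ?_
  rw [← integral_mul_const, ← integral_mul_const]
  refine norm_integral_le_of_norm_le ((hb.mul_const _).mul_const _) (hbd.mono fun a ha => ha l x)

end JetIntegral

/-! ### Convolution with families of kernels -/

section KernelJet

set_option linter.unusedSectionVars false

variable {E : Type*} [NormedAddCommGroup E] [NormedSpace ℝ E] [FiniteDimensional ℝ E]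
  [MeasurableSpace E] [BorelSpace E] {μ : Measure E} [μ.IsAddHaarMeasure]

/-- An integrable kernel with the family of its derivatives, whose `L¹` norms are bounded like
those of a kernel analytic in a strip of width `r`. -/
structure KernelBound (μ : Measure E) (r C : ℝ) (K : List E → E → ℂ) : Prop where
  isJet : IsJet K
  integrable : ∀ l, Integrable (K l) μ
  bound : ∀ l, ∫ y, ‖K l y‖ ∂μ ≤ C * anaWeight r l.length * normProd l

theorem KernelBound.nonneg {r C : ℝ} {K : List E → E → ℂ} (hK : KernelBound μ r C K) : 0 ≤ C := by
  have := hK.bound []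
  simp only [List.length_nil, anaWeight_zero, mul_one, normProd_nil] at this
  exact (integral_nonneg fun _ => norm_nonneg _).trans this

theorem integrable_kernel_mul {K f : E → ℂ} (hK : Integrable K μ) {M : ℝ}
    (hf : AEStronglyMeasurable f μ) (hM : ∀ y, ‖f y‖ ≤ M) (x : E) :
    Integrable (fun y => K y * f (x - y)) μ :=
  hK.mul_bdd (c := M) (hf.comp_quasiMeasurePreserving
    (quasiMeasurePreserving_sub_left_of_right_invariant μ x)) (Eventually.of_forall fun _ => hM _)

theorem norm_integral_kernel_mul_le {K f : E → ℂ} (hK : Integrable K μ) {M : ℝ}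
    (hM : ∀ y, ‖f y‖ ≤ M) (x : E) : ‖∫ y, K y * f (x - y) ∂μ‖ ≤ (∫ y, ‖K y‖ ∂μ) * M := by
  rw [← integral_mul_const]
  refine norm_integral_le_of_norm_le (hK.norm.mul_const M) (Eventually.of_forall fun y => ?_)
  rw [norm_mul]
  exact mul_le_mul_of_nonneg_left (hM _) (norm_nonneg _)

/-- Integration by parts: derivatives can be moved from the function to the kernel. -/
theorem integral_kernel_mul_dirDeriv_cons {K : List E → E → ℂ} (hK : IsJet K)
    (hi : ∀ l, Integrable (K l) μ) {f : E → ℂ} (hf : ContDiff ℝ ∞ f)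
    (hM : ∀ l, ∃ M, ∀ y, ‖dirDeriv f l y‖ ≤ M) (k l : List E) (v x : E) :
    ∫ y, K k y * dirDeriv f (v :: l) (x - y) ∂μ = ∫ y, K (v :: k) y * dirDeriv f l (x - y) ∂μ := by
  have hint : ∀ k l, Integrable (fun y => K k y * dirDeriv f l (x - y)) μ := fun k l => by
    obtain ⟨M, hM⟩ := hM l
    exact integrable_kernel_mul (hi k) (contDiff_dirDeriv hf l).continuous.aestronglyMeasurable hM x
  have hd : ∀ y, HasFDerivAt (fun y => dirDeriv f l (x - y)) (-fderiv ℝ (dirDeriv f l) (x - y)) y := by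
    intro y
    have h1 : HasFDerivAt (dirDeriv f l) (fderiv ℝ (dirDeriv f l) (x - y)) (x - y) :=
      ((contDiff_dirDeriv hf l).differentiable (by simp)).differentiableAt.hasFDerivAt
    have h2 : HasFDerivAt (fun y => x - y) (-ContinuousLinearMap.id ℝ E) y :=
      (hasFDerivAt_id y).const_sub x
    refine (h1.comp y h2).congr_fderiv ?_
    ext w; simp
  have e1 : ∀ y, fderiv ℝ (fun y => dirDeriv f l (x - y)) y v = -dirDeriv f (v :: l) (x - y) := by
    intro y
    rw [(hd y).fderiv]
    rfl
  have e2 : ∀ y, fderiv ℝ (K k) y v = K (v :: k) y := fun y => hK.fderiv_apply k y v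
  have := integral_mul_fderiv_eq_neg_fderiv_mul_of_integrable (μ := μ) (f := K k)
    (g := fun y => dirDeriv f l (x - y)) (v := v) ?_ ?_ (hint k l)
    (fun y _ => (hK.differentiable k).differentiableAt) (fun y _ => (hd y).differentiableAt)
  · simp only [e1, e2, mul_neg, integral_neg] at this
    exact neg_injective this
  · simpa only [e2] using hint (v :: k) l
  · simp only [e1, mul_neg]
    exact (hint k (v :: l)).neg

/-- Each integration by parts removes the head of the list on the function and pushes it onto the
list on the kernel, which is why the transferred block appears reversed. -/
theorem integral_kernel_mul_dirDeriv_append {K : List E → E → ℂ} (hK : IsJet K)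
    (hi : ∀ l, Integrable (K l) μ) {f : E → ℂ} (hf : ContDiff ℝ ∞ f)
    (hM : ∀ l, ∃ M, ∀ y, ‖dirDeriv f l y‖ ≤ M) (l k l' : List E) (x : E) :
    ∫ y, K k y * dirDeriv f (l ++ l') (x - y) ∂μ =
      ∫ y, K (l.reverse ++ k) y * dirDeriv f l' (x - y) ∂μ := by
  induction l generalizing k with
  | nil => rfl
  | cons v l ih =>
    rw [List.cons_append, integral_kernel_mul_dirDeriv_cons hK hi hf hM, ih]
    simp

theorem isJet_dirDeriv_sub {f : E → ℂ} (hf : ContDiff ℝ ∞ f) (c : ℂ) (y : E) :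
    IsJet (fun l x => c * dirDeriv f l (x - y)) := fun l x => by
  obtain ⟨A, hA, h⟩ := isJet_dirDeriv hf l (x - y)
  refine ⟨c • A, ?_, fun v => by simp [h]⟩
  exact (hA.comp x ((hasFDerivAt_id x).sub_const y)).const_mul c

/-- Convolution adds up widths of analyticity strips. -/
theorem AnaBound.conv {r s C M : ℝ} (hr : 0 < r) (hs : 0 < s) {K : List E → E → ℂ}
    (hK : KernelBound μ r C K) {f : E → ℂ} (hf : AnaBound s M f) :
    AnaBound (r + s) (16 * (C * M)) (fun x => ∫ y, K [] y * f (x - y) ∂μ) := by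
  have hJ := isJet_integral (μ := μ) (Ω := E) (J := fun y l x => K [] y * dirDeriv f l (x - y))
    (Eventually.of_forall fun y => isJet_dirDeriv_sub hf.contDiff _ y)
    (fun x => (integrable_kernel_mul (hK.integrable [])
      hf.contDiff.continuous.aestronglyMeasurable hf.norm_le x).aestronglyMeasurable)
    (B := fun k y => ‖K [] y‖ * (M * anaWeight s k))
    (fun k => (hK.integrable []).norm.mul_const _)
    (Eventually.of_forall fun y l x => by
      rw [norm_mul, mul_assoc]
      exact mul_le_mul_of_nonneg_left (hf.norm_dirDeriv_le l _) (norm_nonneg _))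
  have hCM := mul_nonneg hK.nonneg hf.nonneg
  refine AnaBound.of_jet (add_pos hr hs) (mul_nonneg (by norm_num) hCM) hJ fun l x => ?_
  have hM : ∀ l, ∃ M, ∀ y, ‖dirDeriv f l y‖ ≤ M := fun l => ⟨_, hf.norm_dirDeriv_le l⟩
  -- The first j directions of the list are moved to the kernel and the others stay on f. Every j is
  -- admissible, so `le_anaWeight_add` can average over the splittings.
  have key : ∀ j ≤ l.length, ‖∫ y, K [] y * dirDeriv f l (x - y) ∂μ‖ ≤
      (C * M * normProd l) * (anaWeight r j * anaWeight s (l.length - j)) := by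
    intro j hj
    have h1 := integral_kernel_mul_dirDeriv_append (μ := μ) hK.isJet hK.integrable hf.contDiff hM
      (l.take j) [] (l.drop j) x
    rw [List.take_append_drop, List.append_nil] at h1
    rw [h1]
    refine (norm_integral_kernel_mul_le (hK.integrable _) (hf.norm_dirDeriv_le (l.drop j)) x).trans ?_
    have h2 := hK.bound (l.take j).reverse
    rw [List.length_reverse, List.length_take, min_eq_left hj, normProd_reverse] at h2
    have h3 : normProd l = normProd (l.take j) * normProd (l.drop j) := by
      rw [← normProd_append, List.take_append_drop]
    refine (mul_le_mul_of_nonneg_right h2 (mul_nonneg (mul_nonneg hf.nonneg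
      (anaWeight_pos hs _).le) (normProd_nonneg _))).trans_eq ?_
    rw [h3, List.length_drop]
    ring
  refine (le_anaWeight_add hr hs (mul_nonneg hCM (normProd_nonneg l)) l.length key).trans_eq ?_
  ring

/-- Convolutions of kernels with bounded functions are smooth. -/
theorem isJet_conv_of_bounded {K : List E → E → ℂ} (hK : IsJet K) (hi : ∀ l, Integrable (K l) μ)
    {D : ℕ → ℝ} (hD : ∀ l, ∫ y, ‖K l y‖ ∂μ ≤ D l.length * normProd l) {f : E → ℂ}
    (hf : AEStronglyMeasurable f μ) {M : ℝ} (hM : ∀ y, ‖f y‖ ≤ M) :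
    IsJet (fun l x => ∫ y, K l (x - y) * f y ∂μ) := by
  set h : List E → E → ℂ := fun l x => ∫ y, K l (x - y) * f y ∂μ with hh
  have hM0 : 0 ≤ M := (norm_nonneg _).trans (hM 0)
  have hi' : ∀ l x, Integrable (fun y => K l (x - y) * f y) μ := fun l x =>
    ((hi l).comp_sub_left x).mul_bdd (c := M) hf (Eventually.of_forall hM)
  have hb : ∀ l x, ‖h l x‖ ≤ D l.length * normProd l * M := fun l x => by
    refine (norm_integral_le_of_norm_le (((hi l).comp_sub_left x).norm.mul_const M)
      (Eventually.of_forall fun y => ?_)).trans ?_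
    · rw [norm_mul]
      exact mul_le_mul_of_nonneg_left (hM _) (norm_nonneg _)
    · rw [integral_mul_const, integral_sub_left_eq_self (fun y => ‖K l y‖) μ x]
      exact mul_le_mul_of_nonneg_right (hD l) hM0
  -- Since f is only measurable, derivatives must fall on K. The hypotheses give L¹ bounds for each
  -- derivative of K but no integrable majorant for its translates, so dominated differentiation is
  -- replaced by the fundamental theorem of calculus along the segment from x to x + w, combined
  -- with Fubini.
  have hftc : ∀ l x w, h l (x + w) - h l x = ∫ s in (0 : ℝ)..1, h (w :: l) (x + s • w) := by
    intro l x w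
    have hcont : Continuous (K (w :: l)) := (hK.differentiable _).continuous
    have hint : Integrable (Function.uncurry fun (s : ℝ) y => K (w :: l) (x + s • w - y) * f y)
        ((volume.restrict (Ioc 0 1)).prod μ) := by
      have hm : AEStronglyMeasurable
          (Function.uncurry fun (s : ℝ) y => K (w :: l) (x + s • w - y) * f y)
          ((volume.restrict (Ioc 0 1)).prod μ) := by
        refine AEStronglyMeasurable.mul ?_ hf.comp_snd
        exact (hcont.comp (by fun_prop :
          Continuous fun p : ℝ × E => x + p.1 • w - p.2)).aestronglyMeasurable
      rw [integrable_prod_iff hm]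
      refine ⟨Eventually.of_forall fun s => hi' (w :: l) (x + s • w), ?_⟩
      refine Integrable.mono' (integrable_const (D (w :: l).length * normProd (w :: l) * M))
        hm.norm.integral_prod_right' (Eventually.of_forall fun s => ?_)
      rw [Real.norm_of_nonneg (integral_nonneg fun _ => norm_nonneg _)]
      refine (integral_mono (hi' (w :: l) (x + s • w)).norm
        (((hi (w :: l)).comp_sub_left (x + s • w)).norm.mul_const M) fun y => ?_).trans ?_
      · simp only [norm_mul]
        exact mul_le_mul_of_nonneg_left (hM _) (norm_nonneg _)
      · rw [integral_mul_const, integral_sub_left_eq_self (fun y => ‖K (w :: l) y‖) μ]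
        exact mul_le_mul_of_nonneg_right (hD _) hM0
    rw [intervalIntegral.integral_of_le zero_le_one]
    simp only [hh]
    rw [integral_integral_swap hint, ← integral_sub (hi' _ _) (hi' _ _)]
    refine integral_congr_ae (Eventually.of_forall fun y => ?_)
    simp only
    rw [← sub_mul, integral_mul_const]
    congr 1
    rw [← intervalIntegral.integral_of_le zero_le_one]
    have hder : ∀ s ∈ uIcc (0 : ℝ) 1,
        HasDerivAt (fun s : ℝ => K l (x + s • w - y)) (K (w :: l) (x + s • w - y)) s := by
      intro s _
      obtain ⟨A, hA, hA'⟩ := hK l (x + s • w - y)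
      rw [← hA' w]
      have h1 : HasDerivAt (fun s : ℝ => x + s • w - y) w s := by
        simpa using (((hasDerivAt_id s).smul_const w).const_add x).sub_const y
      exact hA.comp_hasDerivAt s h1
    rw [intervalIntegral.integral_eq_sub_of_hasDerivAt hder]
    · simp
    · exact (hcont.comp (by fun_prop)).intervalIntegrable _ _
  -- The L¹ bound of the next order is a Lipschitz constant.
  have hlip : ∀ l x w, ‖h l (x + w) - h l x‖ ≤ D (l.length + 1) * normProd l * M * ‖w‖ := by
    intro l x w
    rw [hftc]
    refine (intervalIntegral.norm_integral_le_of_norm_le_const fun s _ => hb _ _).trans_eq ?_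
    simp; ring
  have hcont : ∀ l, Continuous (h l) := by
    intro l
    refine continuous_iff_continuousAt.2 fun x => ?_
    rw [ContinuousAt, tendsto_iff_norm_sub_tendsto_zero]
    refine squeeze_zero (fun _ => norm_nonneg _)
      (g := fun y => D (l.length + 1) * normProd l * M * ‖y - x‖) (fun y => ?_) ?_
    · simpa using hlip l x (y - x)
    · have : Continuous fun y => D (l.length + 1) * normProd l * M * ‖y - x‖ := by fun_prop
      simpa using this.tendsto x
  intro l x
  have hadd : ∀ v w y, K ((v + w) :: l) y = K (v :: l) y + K (w :: l) y := fun v w y => by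
    rw [← hK.fderiv_apply, ← hK.fderiv_apply, ← hK.fderiv_apply, map_add]
  have hsmul : ∀ (c : ℝ) v y, K ((c • v) :: l) y = c • K (v :: l) y := fun c v y => by
    rw [← hK.fderiv_apply, ← hK.fderiv_apply, map_smul]
  let A₀ : E →ₗ[ℝ] ℂ :=
    { toFun := fun v => h (v :: l) x
      map_add' := fun v w => by
        simp only [hh, hadd, add_mul]
        exact integral_add (hi' _ _) (hi' _ _)
      map_smul' := fun c v => by
        simp only [hh, hsmul, smul_mul_assoc, RingHom.id_apply]
        exact integral_smul _ _ }
  refine ⟨LinearMap.toContinuousLinearMap A₀, ?_, fun v => rfl⟩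
  rw [hasFDerivAt_iff_isLittleO_nhds_zero]
  -- The increment minus its linear part is the average over the segment of differences of the next
  -- member of the family; the Lipschitz bound, two orders above l, makes it quadratic in w.
  have hO : (fun w => h l (x + w) - h l x - LinearMap.toContinuousLinearMap A₀ w) =O[𝓝 0]
      fun w => ‖w‖ ^ 2 := by
    refine Asymptotics.IsBigO.of_bound (D (l.length + 2) * normProd l * M)
      (Eventually.of_forall fun w => ?_)
    have e : h l (x + w) - h l x - LinearMap.toContinuousLinearMap A₀ w =
        ∫ s in (0 : ℝ)..1, (h (w :: l) (x + s • w) - h (w :: l) x) := by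
      have hc : Continuous fun s : ℝ => h (w :: l) (x + s • w) :=
        (hcont (w :: l)).comp (by fun_prop)
      rw [intervalIntegral.integral_sub (hc.intervalIntegrable _ _)
        intervalIntegrable_const, ← hftc]
      simp [A₀]
    rw [e]
    refine (intervalIntegral.norm_integral_le_of_norm_le_const
      (C := D (l.length + 2) * normProd l * M * ‖w‖ ^ 2) fun s hs => ?_).trans_eq ?_
    · rw [uIoc_of_le zero_le_one] at hs
      refine (hlip _ _ _).trans ?_
      -- No sign of D is assumed: for w ≠ 0 it is forced by the L¹ bound for the list `w :: w :: l`,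
      -- and for w = 0 the product vanishes.
      have h0 : 0 ≤ D ((w :: l).length + 1) * normProd (w :: l) * M := by
        refine mul_nonneg ?_ hM0
        rcases eq_or_ne w 0 with rfl | hw
        · simp
        · have := (integral_nonneg fun _ => norm_nonneg _).trans (hD (w :: w :: l))
          rw [normProd_cons w (w :: l)] at this
          refine nonneg_of_mul_nonneg_right (a := ‖w‖) ?_ (norm_pos_iff.2 hw)
          simp only [List.length_cons] at this ⊢
          linarith
      rw [norm_smul, Real.norm_of_nonneg hs.1.le]
      calc _ ≤ D ((w :: l).length + 1) * normProd (w :: l) * M * (1 * ‖w‖) := by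
            gcongr; exact hs.2
        _ = _ := by rw [List.length_cons, normProd_cons]; ring
    · simp
  refine hO.trans_isLittleO ?_
  simpa using Asymptotics.isLittleO_norm_pow_id (E' := E) one_lt_two

end KernelJet

end FracNS

namespace FracNS

/-! ### Inverse Fourier transforms and their `L¹` norms -/

section FourierTools

variable {n : ℕ}

/-- The plane wave `e^{2πi⟪x, ξ⟫}`. -/
noncomputable def wave (x ξ : Vec n) : ℂ := Complex.exp (2 * Real.pi * inner ℝ x ξ * Complex.I)

theorem wave_eq (x ξ : Vec n) :
    wave x ξ = Complex.exp (((2 * Real.pi * inner ℝ x ξ : ℝ) : ℂ) * Complex.I) := by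
  simp [wave]

theorem norm_wave (x ξ : Vec n) : ‖wave x ξ‖ = 1 := by
  rw [wave_eq, Complex.norm_exp_ofReal_mul_I]

theorem wave_add (x y ξ : Vec n) : wave (x + y) ξ = wave x ξ * wave y ξ := by
  unfold wave
  rw [← Complex.exp_add, inner_add_left]
  congr 1
  push_cast
  ring

theorem wave_sub (x y ξ : Vec n) : wave (x - y) ξ = wave x ξ * wave (-y) ξ := by
  rw [sub_eq_add_neg, wave_add]

theorem wave_smul (c : ℝ) (x ξ : Vec n) : wave (c • x) ξ = wave x (c • ξ) := by
  unfold wave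
  rw [inner_smul_left, inner_smul_right]
  simp

theorem wave_comm (x ξ : Vec n) : wave x ξ = wave ξ x := by
  unfold wave
  rw [real_inner_comm]

theorem conj_wave (x ξ : Vec n) : (starRingEnd ℂ) (wave x ξ) = wave x (-ξ) := by
  rw [wave_eq, wave_eq, ← Complex.exp_conj, map_mul, Complex.conj_ofReal, Complex.conj_I]
  congr 1
  rw [inner_neg_right]
  push_cast
  ring

theorem _root_.Continuous.wave {X : Type*} [TopologicalSpace X] {f g : X → Vec n}
    (hf : Continuous f) (hg : Continuous g) : Continuous fun x => wave (f x) (g x) := by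
  unfold FracNS.wave
  fun_prop

theorem _root_.Measurable.wave {X : Type*} [MeasurableSpace X] {f g : X → Vec n}
    (hf : Measurable f) (hg : Measurable g) : Measurable fun x => wave (f x) (g x) := by
  unfold FracNS.wave
  fun_prop

theorem fourierInv_eq_wave (f : Vec n → ℂ) (x : Vec n) : 𝓕⁻ f x = ∫ ξ, wave x ξ * f ξ := by
  rw [Real.fourierInv_eq']
  refine integral_congr_ae (Eventually.of_forall fun ξ => ?_)
  simp only [smul_eq_mul]
  rw [wave_eq, real_inner_comm]

theorem fourier_eq_wave (f : Vec n → ℂ) (ξ : Vec n) : 𝓕 f ξ = ∫ x, f x * wave (-x) ξ := by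
  rw [Real.fourier_eq']
  refine integral_congr_ae (Eventually.of_forall fun x => ?_)
  simp only [smul_eq_mul]
  rw [wave_eq, mul_comm, inner_neg_left]
  congr 4
  ring

theorem integrable_wave_mul {f : Vec n → ℂ} (hf : Integrable f) (x : Vec n) :
    Integrable fun ξ => wave x ξ * f ξ :=
  hf.bdd_mul (c := 1) (continuous_const.wave continuous_id).aestronglyMeasurable (Eventually.of_forall fun ξ => (norm_wave x ξ).le)

theorem norm_fourierInv_le {f : Vec n → ℂ} (hf : Integrable f) (x : Vec n) :
    ‖𝓕⁻ f x‖ ≤ ∫ ξ, ‖f ξ‖ := by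
  rw [fourierInv_eq_wave]
  refine norm_integral_le_of_norm_le hf.norm (Eventually.of_forall fun ξ => ?_)
  rw [norm_mul, norm_wave, one_mul]

theorem continuous_fourierInv_of_integrable {f : Vec n → ℂ} (hf : Integrable f) :
    Continuous (𝓕⁻ f) := by
  have : 𝓕⁻ f = fun x => ∫ ξ, wave x ξ * f ξ := funext fun x => fourierInv_eq_wave f x
  rw [this]
  refine continuous_of_dominated (fun x => (integrable_wave_mul hf x).aestronglyMeasurable)
    (bound := fun ξ => ‖f ξ‖) (fun x => Eventually.of_forall fun ξ => ?_) hf.norm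
    (Eventually.of_forall fun ξ => ?_)
  · rw [norm_mul, norm_wave, one_mul]
  · exact (continuous_id.wave continuous_const).mul continuous_const

/-- `f` is integrable with `L¹` norm at most `C`. -/
def L1Le (f : Vec n → ℂ) (C : ℝ) : Prop := Integrable f ∧ ∫ x, ‖f x‖ ≤ C

theorem L1Le.nonneg {f : Vec n → ℂ} {C : ℝ} (h : L1Le f C) : 0 ≤ C :=
  (integral_nonneg fun _ => norm_nonneg _).trans h.2

theorem L1Le.mono {f : Vec n → ℂ} {C D : ℝ} (h : L1Le f C) (hCD : C ≤ D) : L1Le f D :=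
  ⟨h.1, h.2.trans hCD⟩

theorem L1Le.add {f g : Vec n → ℂ} {C D : ℝ} (hf : L1Le f C) (hg : L1Le g D) :
    L1Le (fun x => f x + g x) (C + D) := by
  refine ⟨hf.1.add hg.1, ?_⟩
  calc ∫ x, ‖f x + g x‖ ≤ ∫ x, (‖f x‖ + ‖g x‖) :=
        integral_mono (hf.1.add hg.1).norm (hf.1.norm.add hg.1.norm) fun x => norm_add_le _ _
    _ = (∫ x, ‖f x‖) + ∫ x, ‖g x‖ := integral_add hf.1.norm hg.1.norm
    _ ≤ C + D := add_le_add hf.2 hg.2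

theorem L1Le.const_mul {f : Vec n → ℂ} {C : ℝ} (hf : L1Le f C) (c : ℂ) :
    L1Le (fun x => c * f x) (‖c‖ * C) := by
  refine ⟨hf.1.const_mul c, ?_⟩
  simp only [norm_mul]
  rw [integral_const_mul]
  exact mul_le_mul_of_nonneg_left hf.2 (norm_nonneg c)

theorem L1Le.sum {ι : Type*} {s : Finset ι} {f : ι → Vec n → ℂ} {C : ι → ℝ}
    (hf : ∀ i ∈ s, L1Le (f i) (C i)) : L1Le (fun x => ∑ i ∈ s, f i x) (∑ i ∈ s, C i) := by
  classical
  induction s using Finset.induction_on with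
  | empty => simp [L1Le]
  | insert i s hi ih =>
    simp only [Finset.sum_insert hi]
    exact (hf i (by simp)).add (ih fun j hj => hf j (by simp [hj]))

/-- Young's inequality for `L¹` functions. -/
theorem L1Le.conv {f g : Vec n → ℂ} {C D : ℝ} (hf : L1Le f C) (hg : L1Le g D) :
    L1Le (fun x => ∫ y, f y * g (x - y)) (C * D) := by
  have h1 : Integrable (fun x => ∫ y, f y * g (x - y)) :=
    hf.1.integrable_convolution (ContinuousLinearMap.mul ℝ ℂ) hg.1
  have h2 : Integrable (fun x => ∫ y, ‖f y‖ * ‖g (x - y)‖) :=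
    hf.1.norm.integrable_convolution (ContinuousLinearMap.mul ℝ ℝ) hg.1.norm
  have h3 : ∫ x, ∫ y, ‖f y‖ * ‖g (x - y)‖ = (∫ y, ‖f y‖) * ∫ y, ‖g y‖ :=
    integral_convolution (ContinuousLinearMap.mul ℝ ℝ) hf.1.norm hg.1.norm
  refine ⟨h1, ?_⟩
  calc ∫ x, ‖∫ y, f y * g (x - y)‖ ≤ ∫ x, ∫ y, ‖f y‖ * ‖g (x - y)‖ := by
        refine integral_mono h1.norm h2 fun x => ?_
        refine (norm_integral_le_integral_norm _).trans_eq ?_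
        simp only [norm_mul]
    _ = (∫ y, ‖f y‖) * ∫ y, ‖g y‖ := h3
    _ ≤ C * D := mul_le_mul hf.2 hg.2 (integral_nonneg fun _ => norm_nonneg _) hf.nonneg

/-- The inverse Fourier transform turns products into convolutions. -/
theorem fourierInv_mul_eq_conv {f g : Vec n → ℂ} (hfc : Continuous f) (hf : Integrable f)
    (hf' : Integrable (𝓕⁻ f)) (hg : Integrable g) (x : Vec n) :
    𝓕⁻ (fun ξ => f ξ * g ξ) x = ∫ y, 𝓕⁻ f y * 𝓕⁻ g (x - y) := by
  have hff : Integrable (𝓕 f) := by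
    have := hf'.comp_neg
    refine this.congr (Eventually.of_forall fun y => ?_)
    simp [Real.fourierInv_eq_fourier_neg]
  -- Only f is recovered from its kernel by Fourier inversion. The symbol g need only be integrable,
  -- which suits the Oseen symbol.
  have hinv := hfc.fourier_fourierInv_eq hf hff
  have hint : Integrable (Function.uncurry fun y ξ => 𝓕⁻ f y * (wave (x - y) ξ * g ξ))
      (volume.prod volume) := by
    have h1 : Integrable (fun p : Vec n × Vec n => 𝓕⁻ f p.1 * g p.2) (volume.prod volume) :=
      hf'.mul_prod hg
    have hw : Continuous fun p : Vec n × Vec n => wave (x - p.1) p.2 :=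
      (continuous_const.sub continuous_fst).wave continuous_snd
    refine (h1.bdd_mul (c := 1) hw.aestronglyMeasurable
      (Eventually.of_forall fun p => (norm_wave _ _).le)).congr (Eventually.of_forall fun p => ?_)
    simp only [Function.uncurry]
    ring
  calc 𝓕⁻ (fun ξ => f ξ * g ξ) x = ∫ ξ, wave x ξ * g ξ * 𝓕 (𝓕⁻ f) ξ := by
        rw [fourierInv_eq_wave, hinv]
        refine integral_congr_ae (Eventually.of_forall fun ξ => ?_)
        simp only
        ring
    _ = ∫ ξ, ∫ y, 𝓕⁻ f y * (wave (x - y) ξ * g ξ) := by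
        refine integral_congr_ae (Eventually.of_forall fun ξ => ?_)
        simp only
        rw [fourier_eq_wave, ← integral_const_mul]
        refine integral_congr_ae (Eventually.of_forall fun y => ?_)
        simp only
        rw [wave_sub]
        ring
    _ = ∫ y, ∫ ξ, 𝓕⁻ f y * (wave (x - y) ξ * g ξ) := (integral_integral_swap hint).symm
    _ = ∫ y, 𝓕⁻ f y * 𝓕⁻ g (x - y) := by
        refine integral_congr_ae (Eventually.of_forall fun y => ?_)
        simp only
        rw [integral_const_mul, fourierInv_eq_wave g]

theorem L1Le.fourierInv_mul {f g : Vec n → ℂ} {C D : ℝ} (hfc : Continuous f) (hf : Integrable f)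
    (hf' : L1Le (𝓕⁻ f) C) (hg : Integrable g) (hg' : L1Le (𝓕⁻ g) D) :
    L1Le (𝓕⁻ (fun ξ => f ξ * g ξ)) (C * D) := by
  have : 𝓕⁻ (fun ξ => f ξ * g ξ) = fun x => ∫ y, 𝓕⁻ f y * 𝓕⁻ g (x - y) :=
    funext fun x => fourierInv_mul_eq_conv hfc hf hf'.1 hg x
  rw [this]
  exact hf'.conv hg'

/-- Dilations of the symbol do not change the `L¹` norm of the kernel. -/
theorem fourierInv_comp_smul (m : Vec n → ℂ) {c : ℝ} (hc : 0 < c) (x : Vec n) :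
    𝓕⁻ (fun ξ => m (c • ξ)) x = ((c ^ n)⁻¹ : ℝ) * 𝓕⁻ m (c⁻¹ • x) := by
  rw [fourierInv_eq_wave, fourierInv_eq_wave]
  have h := Measure.integral_comp_smul (volume : Measure (Vec n))
    (fun ξ => wave (c⁻¹ • x) ξ * m ξ) c
  rw [finrank_euclideanSpace_fin, abs_of_pos (by positivity : 0 < (c ^ n)⁻¹)] at h
  rw [← Complex.real_smul, ← h]
  refine integral_congr_ae (Eventually.of_forall fun ξ => ?_)
  simp only
  rw [wave_smul, smul_smul, inv_mul_cancel₀ hc.ne', one_smul]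

theorem L1Le.fourierInv_comp_smul {m : Vec n → ℂ} {C : ℝ} (h : L1Le (𝓕⁻ m) C) {c : ℝ}
    (hc : 0 < c) : L1Le (𝓕⁻ (fun ξ => m (c • ξ))) C := by
  have e : 𝓕⁻ (fun ξ => m (c • ξ)) = fun x => ((c ^ n)⁻¹ : ℝ) * 𝓕⁻ m (c⁻¹ • x) :=
    funext fun x => FracNS.fourierInv_comp_smul m hc x
  rw [e]
  refine ⟨(h.1.comp_smul (inv_ne_zero hc.ne')).const_mul _, ?_⟩
  simp only [norm_mul]
  rw [integral_const_mul, Measure.integral_comp_smul volume (fun x => ‖𝓕⁻ m x‖)]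
  rw [finrank_euclideanSpace_fin, abs_of_pos (by positivity), Complex.norm_real,
    Real.norm_of_nonneg (by positivity), smul_eq_mul, ← mul_assoc, inv_pow, inv_inv,
    inv_mul_cancel₀ (by positivity), one_mul]
  exact h.2

theorem fourierInv_congr_ae {f g : Vec n → ℂ} (h : f =ᵐ[volume] g) : 𝓕⁻ f = 𝓕⁻ g := by
  funext x
  rw [fourierInv_eq_wave, fourierInv_eq_wave]
  exact integral_congr_ae (h.mono fun ξ hξ => by simp only [hξ])

theorem fourierInv_add {f g : Vec n → ℂ} (hf : Integrable f) (hg : Integrable g) (x : Vec n) :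
    𝓕⁻ (fun ξ => f ξ + g ξ) x = 𝓕⁻ f x + 𝓕⁻ g x := by
  simp only [fourierInv_eq_wave, mul_add]
  exact integral_add (integrable_wave_mul hf x) (integrable_wave_mul hg x)

theorem fourierInv_const_mul (c : ℂ) (f : Vec n → ℂ) (x : Vec n) :
    𝓕⁻ (fun ξ => c * f ξ) x = c * 𝓕⁻ f x := by
  simp only [fourierInv_eq_wave]
  rw [← integral_const_mul]
  refine integral_congr_ae (Eventually.of_forall fun ξ => ?_)
  simp only
  ring

theorem fourierInv_finset_sum {ι : Type*} {s : Finset ι} {f : ι → Vec n → ℂ}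
    (hf : ∀ i ∈ s, Integrable (f i)) (x : Vec n) :
    𝓕⁻ (fun ξ => ∑ i ∈ s, f i ξ) x = ∑ i ∈ s, 𝓕⁻ (f i) x := by
  simp only [fourierInv_eq_wave, Finset.mul_sum]
  exact integral_finsetSum s fun i hi => integrable_wave_mul (hf i hi) x

/-! ### Superpositions of symbols -/

section Superposition

variable {Ω : Type*} [MeasurableSpace Ω] {μ : Measure Ω} [SFinite μ]

theorem stronglyMeasurable_fourierInv {m : Ω → Vec n → ℂ}
    (hm : StronglyMeasurable (Function.uncurry m)) :
    StronglyMeasurable (Function.uncurry fun a x => 𝓕⁻ (m a) x) := by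
  have h : StronglyMeasurable fun q : (Ω × Vec n) × Vec n => wave q.1.2 q.2 * m q.1.1 q.2 := by
    refine StronglyMeasurable.mul ?_ ?_
    · exact ((measurable_snd.comp measurable_fst).wave measurable_snd).stronglyMeasurable
    · have : Measurable fun q : (Ω × Vec n) × Vec n => (q.1.1, q.2) := by fun_prop
      exact hm.comp_measurable this
  have e : (Function.uncurry fun a x => 𝓕⁻ (m a) x) =
      fun p : Ω × Vec n => ∫ ξ, wave p.2 ξ * m p.1 ξ := by
    funext p
    exact fourierInv_eq_wave _ _
  rw [e]
  exact h.integral_prod_right'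

/-- A superposition of kernels with integrable `L¹` norms. -/
theorem L1Le.fourierInv_integral {m : Ω → Vec n → ℂ} {b : Ω → ℝ}
    (hm : StronglyMeasurable (Function.uncurry m))
    (hint : Integrable (Function.uncurry m) (μ.prod volume))
    (hb : Integrable b μ) (h : ∀ᵐ a ∂μ, L1Le (𝓕⁻ (m a)) (b a)) :
    L1Le (𝓕⁻ (fun ξ => ∫ a, m a ξ ∂μ)) (∫ a, b a ∂μ) := by
  have hK := stronglyMeasurable_fourierInv hm
  have e : 𝓕⁻ (fun ξ => ∫ a, m a ξ ∂μ) = fun x => ∫ a, 𝓕⁻ (m a) x ∂μ := by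
    funext x
    simp only [fourierInv_eq_wave]
    have hint' : Integrable (Function.uncurry fun a ξ => wave x ξ * m a ξ) (μ.prod volume) := by
      refine hint.bdd_mul (c := 1) (f := fun p : Ω × Vec n => wave x p.2) ?_
        (Eventually.of_forall fun p => (norm_wave _ _).le)
      exact (measurable_const.wave measurable_snd).aestronglyMeasurable
    rw [integral_integral_swap hint']
    refine integral_congr_ae (Eventually.of_forall fun ξ => ?_)
    simp only
    rw [integral_const_mul]
  have hKi : Integrable (Function.uncurry fun a x => 𝓕⁻ (m a) x) (μ.prod volume) := by
    rw [integrable_prod_iff hK.aestronglyMeasurable]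
    refine ⟨h.mono fun a ha => ha.1, ?_⟩
    refine Integrable.mono' hb hK.norm.integral_prod_right'.aestronglyMeasurable ?_
    refine h.mono fun a ha => ?_
    rw [Real.norm_of_nonneg (integral_nonneg fun _ => norm_nonneg _)]
    exact ha.2
  rw [e]
  refine ⟨hKi.integral_prod_right, ?_⟩
  calc ∫ x, ‖∫ a, 𝓕⁻ (m a) x ∂μ‖ ≤ ∫ x, ∫ a, ‖𝓕⁻ (m a) x‖ ∂μ := by
        refine integral_mono hKi.integral_prod_right.norm hKi.norm.integral_prod_right fun x => ?_
        exact norm_integral_le_integral_norm _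
    _ = ∫ a, (∫ x, ‖𝓕⁻ (m a) x‖) ∂μ := (integral_integral_swap hKi.norm).symm
    _ ≤ ∫ a, b a ∂μ := by
        refine integral_mono_ae hKi.norm.integral_prod_left hb (h.mono fun a ha => ha.2)

end Superposition

/-- Symbols of class `C^{n+1}` with compact support have integrable kernels. -/
theorem integrable_fourierInv_of_contDiff {m : Vec n → ℂ} (hm : ContDiff ℝ (n + 1 : ℕ) m)
    (hs : HasCompactSupport m) : Integrable (𝓕⁻ m) := by
  have hmi : Integrable m := hm.continuous.integrable_of_hasCompactSupport hs
  have hint : ∀ (k j : ℕ), (k : ℕ∞) ≤ 0 → (j : ℕ∞) ≤ ((n + 1 : ℕ) : ℕ∞) →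
      Integrable (fun v => ‖v‖ ^ k * ‖iteratedFDeriv ℝ j m v‖) := by
    intro k j _ hj
    have hc : Continuous (iteratedFDeriv ℝ j m) :=
      hm.continuous_iteratedFDeriv (by exact_mod_cast hj)
    refine Continuous.integrable_of_hasCompactSupport (by fun_prop) ?_
    exact ((hs.iteratedFDeriv j).norm).mul_left
  obtain ⟨C, hC⟩ : ∃ C, ∀ w, ‖w‖ ^ (n + 1) * ‖𝓕 m w‖ ≤ C := by
    have := Real.pow_mul_norm_iteratedFDeriv_fourier_le (K := 0) (N := ((n + 1 : ℕ) : ℕ∞))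
      (by exact_mod_cast hm) hint (k := 0) (n := n + 1) le_rfl le_rfl
    simp only [norm_iteratedFDeriv_zero] at this
    exact ⟨_, this⟩
  -- The n+1 derivatives of m give decay of order n+1 at infinity and the L¹ norm of m bounds the
  -- kernel near the origin. One power beyond the dimension suffices for integrability.
  have hb : ∀ x, ‖𝓕⁻ m x‖ ≤ ((∫ ξ, ‖m ξ‖) + C) * 2 ^ (n + 1) * (1 + ‖x‖) ^ (-((n : ℝ) + 1)) := by
    intro x
    have h1 := norm_fourierInv_le hmi x
    have h2 := hC (-x)
    rw [← Real.fourierInv_eq_fourier_neg, norm_neg] at h2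
    have e : (1 + ‖x‖) ^ (-((n : ℝ) + 1)) = ((1 + ‖x‖) ^ (n + 1))⁻¹ := by
      rw [Real.rpow_neg (by positivity)]
      congr 1
      exact_mod_cast Real.rpow_natCast (1 + ‖x‖) (n + 1)
    rw [e, ← div_eq_mul_inv, le_div_iff₀ (by positivity)]
    have h3 : (1 + ‖x‖) ^ (n + 1) ≤ 2 ^ (n + 1) * (1 + ‖x‖ ^ (n + 1)) := by
      rcases le_total ‖x‖ 1 with hx | hx
      · calc (1 + ‖x‖) ^ (n + 1) ≤ 2 ^ (n + 1) * 1 := by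
              rw [mul_one]; gcongr; linarith
          _ ≤ _ := by gcongr; linarith [pow_nonneg (norm_nonneg x) (n + 1)]
      · calc (1 + ‖x‖) ^ (n + 1) ≤ (2 * ‖x‖) ^ (n + 1) := by gcongr; linarith
          _ ≤ _ := by rw [mul_pow]; gcongr; linarith
    calc ‖𝓕⁻ m x‖ * (1 + ‖x‖) ^ (n + 1) ≤ ‖𝓕⁻ m x‖ * (2 ^ (n + 1) * (1 + ‖x‖ ^ (n + 1))) := by
          gcongr
      _ = (‖𝓕⁻ m x‖ + ‖x‖ ^ (n + 1) * ‖𝓕⁻ m x‖) * 2 ^ (n + 1) := by ring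
      _ ≤ ((∫ ξ, ‖m ξ‖) + C) * 2 ^ (n + 1) := by gcongr
  refine Integrable.mono' ((integrable_one_add_norm (r := (n : ℝ) + 1) ?_).const_mul _)
    (continuous_fourierInv_of_integrable hmi).aestronglyMeasurable (Eventually.of_forall hb)
  rw [finrank_euclideanSpace_fin]
  linarith

/-- The symbol `∏ 2πi⟪v, ξ⟫` of the iterated derivative along the vectors of a list. -/
noncomputable def dirSymbol (l : List (Vec n)) (ξ : Vec n) : ℂ :=
  (l.map fun v => 2 * Real.pi * Complex.I * (inner ℝ v ξ : ℝ)).prod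

@[simp] theorem dirSymbol_nil (ξ : Vec n) : dirSymbol [] ξ = 1 := rfl

@[simp] theorem dirSymbol_cons (v : Vec n) (l : List (Vec n)) (ξ : Vec n) :
    dirSymbol (v :: l) ξ = 2 * Real.pi * Complex.I * (inner ℝ v ξ : ℝ) * dirSymbol l ξ := by
  simp [dirSymbol]

theorem dirSymbol_append (l l' : List (Vec n)) (ξ : Vec n) :
    dirSymbol (l ++ l') ξ = dirSymbol l ξ * dirSymbol l' ξ := by
  simp [dirSymbol]

theorem contDiff_dirSymbol (l : List (Vec n)) : ContDiff ℝ ∞ (dirSymbol l) := by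
  induction l with
  | nil => exact contDiff_const
  | cons v l ih =>
    have h : ContDiff ℝ ∞ (fun ξ : Vec n => ((inner ℝ v ξ : ℝ) : ℂ)) :=
      Complex.ofRealCLM.contDiff.comp (contDiff_const.inner ℝ contDiff_id)
    have e : dirSymbol (v :: l) = fun ξ => 2 * Real.pi * Complex.I * (inner ℝ v ξ : ℝ) *
      dirSymbol l ξ := funext fun ξ => dirSymbol_cons v l ξ
    rw [e]
    exact (contDiff_const.mul h).mul ih

theorem norm_dirSymbol_le (l : List (Vec n)) (ξ : Vec n) :
    ‖dirSymbol l ξ‖ ≤ (2 * Real.pi * ‖ξ‖) ^ l.length * normProd l := by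
  induction l with
  | nil => simp
  | cons v l ih =>
    rw [dirSymbol_cons, norm_mul, List.length_cons, normProd_cons, pow_succ]
    have h1 : ‖2 * Real.pi * Complex.I * ((inner ℝ v ξ : ℝ) : ℂ)‖ ≤ 2 * Real.pi * ‖ξ‖ * ‖v‖ := by
      rw [norm_mul, norm_mul, norm_mul, Complex.norm_I, Complex.norm_real, Complex.norm_real,
        Real.norm_of_nonneg Real.pi_pos.le]
      have := abs_real_inner_le_norm v ξ
      simp only [Complex.norm_ofNat, mul_one, Real.norm_eq_abs]
      calc 2 * Real.pi * |inner ℝ v ξ| ≤ 2 * Real.pi * (‖v‖ * ‖ξ‖) := by gcongr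
        _ = _ := by ring
    calc _ ≤ (2 * Real.pi * ‖ξ‖ * ‖v‖) * ((2 * Real.pi * ‖ξ‖) ^ l.length * normProd l) :=
          mul_le_mul h1 ih (norm_nonneg _) (by positivity)
      _ = _ := by ring

theorem dirSymbol_smul (l : List (Vec n)) (c : ℝ) (ξ : Vec n) :
    dirSymbol l (c • ξ) = (c : ℂ) ^ l.length * dirSymbol l ξ := by
  induction l with
  | nil => simp
  | cons v l ih =>
    rw [dirSymbol_cons, dirSymbol_cons, ih, inner_smul_right, List.length_cons, pow_succ]
    push_cast
    ring

theorem integrable_dirSymbol_mul {m : Vec n → ℂ} (hm : AEStronglyMeasurable m)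
    (hi : ∀ k : ℕ, Integrable fun ξ => ‖ξ‖ ^ k * ‖m ξ‖) (l : List (Vec n)) :
    Integrable fun ξ => dirSymbol l ξ * m ξ := by
  refine Integrable.mono' ((hi l.length).const_mul ((2 * Real.pi) ^ l.length * normProd l))
    ((contDiff_dirSymbol l).continuous.aestronglyMeasurable.mul hm)
    (Eventually.of_forall fun ξ => ?_)
  rw [norm_mul]
  refine (mul_le_mul_of_nonneg_right (norm_dirSymbol_le l ξ) (norm_nonneg _)).trans_eq ?_
  rw [mul_pow]
  ring

theorem isJet_wave_mul (c : ℂ) (ξ : Vec n) :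
    IsJet (fun (l : List (Vec n)) x => wave x ξ * (dirSymbol l ξ * c)) := by
  intro l x
  have h1 : HasFDerivAt (fun x : Vec n => ((inner ℝ x ξ : ℝ) : ℂ))
      (Complex.ofRealCLM.comp (innerSL ℝ ξ)) x := by
    have := ((innerSL ℝ ξ).hasFDerivAt (x := x))
    refine (Complex.ofRealCLM.hasFDerivAt.comp x this).congr_of_eventuallyEq
      (Eventually.of_forall fun y => ?_)
    simp [real_inner_comm]
  have h2 := (((h1.const_mul (2 * Real.pi : ℂ)).mul_const Complex.I).cexp).mul_const
    (dirSymbol l ξ * c)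
  refine ⟨_, h2, fun v => ?_⟩
  simp only [dirSymbol_cons, wave, smul_apply, ContinuousLinearMap.coe_comp, Function.comp_apply,
    innerSL_apply_apply, Complex.ofRealCLM_apply, smul_eq_mul, real_inner_comm v ξ]
  ring

theorem isJet_fourierInv {m : Vec n → ℂ} (hm : AEStronglyMeasurable m)
    (hi : ∀ k : ℕ, Integrable fun ξ => ‖ξ‖ ^ k * ‖m ξ‖) :
    IsJet (fun (l : List (Vec n)) x => 𝓕⁻ (fun ξ => dirSymbol l ξ * m ξ) x) := by
  simp only [fourierInv_eq_wave]
  have hm0 : Integrable m := by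
    have := integrable_dirSymbol_mul hm hi []
    simpa using this
  refine isJet_integral (J := fun ξ (l : List (Vec n)) x => wave x ξ * (dirSymbol l ξ * m ξ))
    (Eventually.of_forall fun ξ => isJet_wave_mul (m ξ) ξ)
    (fun x => by simpa using (integrable_wave_mul hm0 x).aestronglyMeasurable)
    (B := fun k ξ => (2 * Real.pi) ^ k * (‖ξ‖ ^ k * ‖m ξ‖)) (fun k => (hi k).const_mul _)
    (Eventually.of_forall fun ξ l x => ?_)
  rw [norm_mul, norm_wave, one_mul, norm_mul]
  refine (mul_le_mul_of_nonneg_right (norm_dirSymbol_le l ξ) (norm_nonneg _)).trans_eq ?_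
  rw [mul_pow]
  ring

/-- Kernels of symbols with `m(-ξ) = conj (m ξ)` are real. -/
theorem fourierInv_im_eq_zero {m : Vec n → ℂ} (h : ∀ ξ, (starRingEnd ℂ) (m ξ) = m (-ξ))
    (x : Vec n) : (𝓕⁻ m x).im = 0 := by
  rw [← Complex.conj_eq_iff_im, fourierInv_eq_wave, ← integral_conj]
  simp only [map_mul, conj_wave, h]
  exact integral_neg_eq_self (fun ξ => wave x ξ * m ξ) volume

end FourierTools

end FracNS

namespace FracNS

/-! ### Stretched exponentials as superpositions of truncated powers -/

section Stretched

/-- The polynomials `Q_m` with `(-d/dτ)^m e^{-aτ^α} = τ^{-m} Q_m(aτ^α) e^{-aτ^α}`. -/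
noncomputable def stretchPoly (α : ℝ) : ℕ → Polynomial ℝ
  | 0 => 1
  | m + 1 => (Polynomial.C (m : ℝ) + Polynomial.C α * Polynomial.X) * stretchPoly α m -
      Polynomial.C α * Polynomial.X * Polynomial.derivative (stretchPoly α m)

/-- The function `(-d/dτ)^m e^{-aτ^α}`. -/
noncomputable def stretchDeriv (α a : ℝ) (m : ℕ) (τ : ℝ) : ℝ :=
  (τ ^ m)⁻¹ * (stretchPoly α m).eval (a * τ ^ α) * Real.exp (-(a * τ ^ α))

theorem hasDerivAt_stretchDeriv (α a : ℝ) (m : ℕ) {τ : ℝ} (hτ : 0 < τ) :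
    HasDerivAt (stretchDeriv α a m) (-stretchDeriv α a (m + 1) τ) τ := by
  have h1 : HasDerivAt (fun τ : ℝ => a * τ ^ α) (a * (α * τ ^ (α - 1))) τ :=
    (Real.hasDerivAt_rpow_const (Or.inl hτ.ne')).const_mul a
  have h2 := ((stretchPoly α m).hasDerivAt (a * τ ^ α)).comp τ h1
  have h3 := h1.neg.exp
  have h4 : HasDerivAt (fun τ : ℝ => (τ ^ m)⁻¹) (-(m * τ ^ (m - 1)) / (τ ^ m) ^ 2) τ :=
    (hasDerivAt_pow m τ).inv (by positivity)
  refine ((h4.mul h2).mul h3).congr_deriv ?_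
  have e : τ ^ (α - 1) = τ ^ α / τ := by rw [Real.rpow_sub_one hτ.ne']
  have e4 : -((m : ℝ) * τ ^ (m - 1)) / (τ ^ m) ^ 2 = -(m * (τ ^ (m + 1))⁻¹) := by
    rcases m with _ | m
    · simp
    · simp only [Nat.add_sub_cancel]
      field_simp
      ring
  rw [e4, e]
  simp only [stretchDeriv, stretchPoly, Polynomial.eval_sub, Polynomial.eval_mul,
    Polynomial.eval_add, Polynomial.eval_C, Polynomial.eval_X, Function.comp, Pi.neg_apply,
    Pi.mul_apply]
  field_simp
  ring

/-- This vanishing supplies a factor aτ^α in the density, which turns the non-integrable τ^{-1} at τ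
= 0 into τ^(α-1). -/
theorem stretchPoly_succ_eval_zero (α : ℝ) (m : ℕ) : (stretchPoly α (m + 1)).eval 0 = 0 := by
  induction m with
  | zero => simp [stretchPoly]
  | succ m ih =>
    rw [stretchPoly]
    simp [ih]

theorem polynomial_eval_le_exp (P : Polynomial ℝ) :
    ∃ C, 0 ≤ C ∧ ∀ z, 0 ≤ z → |P.eval z| ≤ C * Real.exp (z / 2) := by
  induction P using Polynomial.induction_on' with
  | add p q hp hq =>
    obtain ⟨C, hC, h1⟩ := hp
    obtain ⟨D, hD, h2⟩ := hq
    refine ⟨C + D, by positivity, fun z hz => ?_⟩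
    rw [Polynomial.eval_add, add_mul]
    exact (abs_add_le _ _).trans (add_le_add (h1 z hz) (h2 z hz))
  | monomial k c =>
    refine ⟨|c| * (2 ^ k * k.factorial), by positivity, fun z hz => ?_⟩
    rw [Polynomial.eval_monomial, abs_mul, abs_of_nonneg (pow_nonneg hz k), mul_assoc]
    refine mul_le_mul_of_nonneg_left ?_ (abs_nonneg c)
    have h := Real.pow_div_factorial_le_exp (z / 2) (by positivity) k
    rw [div_le_iff₀ (by positivity), div_pow, div_le_iff₀ (by positivity)] at h
    linarith

theorem stretchPoly_succ_le (α : ℝ) (m : ℕ) :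
    ∃ C, 0 ≤ C ∧ ∀ z, 0 ≤ z → |(stretchPoly α (m + 1)).eval z| ≤ C * (z * Real.exp (z / 2)) := by
  have hX : Polynomial.X ∣ stretchPoly α (m + 1) := by
    rw [Polynomial.X_dvd_iff, Polynomial.coeff_zero_eq_eval_zero, stretchPoly_succ_eval_zero]
  obtain ⟨R, hR⟩ := hX
  obtain ⟨C, hC, h⟩ := polynomial_eval_le_exp R
  refine ⟨C, hC, fun z hz => ?_⟩
  rw [hR, Polynomial.eval_mul, Polynomial.eval_X, abs_mul, abs_of_nonneg hz]
  calc z * |R.eval z| ≤ z * (C * Real.exp (z / 2)) := by gcongr; exact h z hz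
    _ = _ := by ring

/-- The density in the representation of `e^{-aσ^α}` by truncated powers of order `N`. -/
noncomputable def stretchDensity (α a : ℝ) (N : ℕ) (τ : ℝ) : ℝ :=
  τ ^ N * stretchDeriv α a (N + 1) τ / N.factorial

/-- The powers τ^N and τ^(-N-1) leave τ^{-1}; the polynomial contributes aτ^α and a factor absorbed
by half of the exponential. The constant depends on neither a nor τ. -/
theorem stretchDensity_le (α : ℝ) (N : ℕ) : ∃ C, 0 ≤ C ∧ ∀ a τ : ℝ, 0 < a → 0 < τ →
    |stretchDensity α a N τ| ≤ C * (a * (τ ^ (α - 1) * Real.exp (-(a / 2) * τ ^ α))) := by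
  obtain ⟨C, hC, h⟩ := stretchPoly_succ_le α N
  refine ⟨C, hC, fun a τ ha hτ => ?_⟩
  have hz : 0 ≤ a * τ ^ α := by positivity
  have hf : (1 : ℝ) ≤ N.factorial := by exact_mod_cast N.factorial_pos
  unfold stretchDensity stretchDeriv
  rw [abs_div, Nat.abs_cast, abs_mul, abs_mul, abs_mul, Real.abs_exp,
    abs_of_pos (by positivity : 0 < τ ^ N), abs_of_pos (by positivity : 0 < (τ ^ (N + 1))⁻¹)]
  refine (div_le_self (by positivity) hf).trans ?_
  have e : Real.exp (-(a / 2) * τ ^ α) = Real.exp (a * τ ^ α / 2) * Real.exp (-(a * τ ^ α)) := by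
    rw [← Real.exp_add]; congr 1; ring
  calc τ ^ N * ((τ ^ (N + 1))⁻¹ * |Polynomial.eval (a * τ ^ α) (stretchPoly α (N + 1))| *
        Real.exp (-(a * τ ^ α)))
      ≤ τ ^ N * ((τ ^ (N + 1))⁻¹ * (C * (a * τ ^ α * Real.exp (a * τ ^ α / 2))) *
        Real.exp (-(a * τ ^ α))) := by gcongr; exact h _ hz
    _ = _ := by
      rw [e, Real.rpow_sub_one hτ.ne']
      field_simp
      ring

theorem measurable_stretchDensity (α a : ℝ) (N : ℕ) : Measurable (stretchDensity α a N) := by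
  unfold stretchDensity stretchDeriv
  have h : Measurable fun τ : ℝ => (stretchPoly α (N + 1)).eval (a * τ ^ α) :=
    (stretchPoly α (N + 1)).continuous.measurable.comp (by fun_prop)
  fun_prop

theorem integrableOn_stretchDensity {α : ℝ} (hα : 0 < α) (N j : ℕ) {a : ℝ} (ha : 0 < a) :
    IntegrableOn (fun τ => |stretchDensity α a N τ| * √τ ^ j) (Ioi 0) := by
  obtain ⟨C, hC, h⟩ := stretchDensity_le α N
  have hi := (integrableOn_rpow_mul_exp_neg_mul_rpow (p := α) (s := α - 1 + j / 2) (b := a / 2)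
    (by have : (0 : ℝ) ≤ j := Nat.cast_nonneg j
        linarith) hα (by positivity)).const_mul (C * a)
  refine Integrable.mono' hi ?_ ?_
  · exact ((measurable_stretchDensity α a N).norm.mul
      (Real.continuous_sqrt.measurable.pow_const j)).aestronglyMeasurable
  · filter_upwards [ae_restrict_mem measurableSet_Ioi] with τ hτ
    have hτ' : (0 : ℝ) < τ := hτ
    rw [norm_mul, Real.norm_eq_abs, abs_abs, Real.norm_of_nonneg (by positivity)]
    have e : √τ ^ j = τ ^ ((j : ℝ) / 2) := by
      rw [Real.sqrt_eq_rpow, ← Real.rpow_natCast, ← Real.rpow_mul hτ'.le]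
      congr 1; ring
    rw [e, Real.rpow_add hτ']
    calc _ ≤ C * (a * (τ ^ (α - 1) * Real.exp (-(a / 2) * τ ^ α))) * τ ^ ((j : ℝ) / 2) := by
          gcongr; exact h a τ ha hτ'
      _ = _ := by ring

/-- The moment √τ^j is what j derivatives cost after dilation by √τ. The power of a is dictated by
homogeneity, since the majorant of the density depends on τ only through aτ^α, up to dτ/τ. -/
theorem integral_stretchDensity_le {α : ℝ} (hα : 0 < α) (N j : ℕ) :
    ∃ D, 0 ≤ D ∧ ∀ a, 0 < a →
      ∫ τ in Ioi (0 : ℝ), |stretchDensity α a N τ| * √τ ^ j ≤ D * a ^ (-(j / (2 * α)) : ℝ) := by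
  obtain ⟨C, hC, h⟩ := stretchDensity_le α N
  have hj : (0 : ℝ) ≤ j := Nat.cast_nonneg j
  set q : ℝ := α - 1 + j / 2 with hq
  have hq1 : -1 < q := by rw [hq]; linarith
  have hΓ : 0 < Real.Gamma ((q + 1) / α) := Real.Gamma_pos_of_pos (by
    have : 0 < q + 1 := by linarith
    positivity)
  refine ⟨C * ((1 / 2) ^ (-(q + 1) / α) * (1 / α) * Real.Gamma ((q + 1) / α)),
    by positivity, fun a ha => ?_⟩
  have hi := (integrableOn_rpow_mul_exp_neg_mul_rpow (p := α) (s := q) (b := a / 2)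
    hq1 hα (by positivity)).const_mul (C * a)
  refine (setIntegral_mono_on (integrableOn_stretchDensity hα N j ha) hi measurableSet_Ioi
    fun τ hτ => ?_).trans_eq ?_
  · have hτ' : (0 : ℝ) < τ := hτ
    have e : √τ ^ j = τ ^ ((j : ℝ) / 2) := by
      rw [Real.sqrt_eq_rpow, ← Real.rpow_natCast, ← Real.rpow_mul hτ'.le]
      congr 1; ring
    rw [e, hq, Real.rpow_add hτ']
    calc _ ≤ C * (a * (τ ^ (α - 1) * Real.exp (-(a / 2) * τ ^ α))) * τ ^ ((j : ℝ) / 2) := by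
          gcongr; exact h a τ ha hτ'
      _ = _ := by ring
  · rw [integral_const_mul, integral_rpow_mul_exp_neg_mul_rpow hα hq1 (by positivity)]
    have e1 : (a / 2) ^ (-(q + 1) / α) = (1 / 2) ^ (-(q + 1) / α) * a ^ (-(q + 1) / α) := by
      rw [← Real.mul_rpow (by norm_num) ha.le]; congr 1; ring
    have e2 : a ^ (-(j / (2 * α)) : ℝ) = a * a ^ (-(q + 1) / α) := by
      conv_rhs => rw [← Real.rpow_one a, ← Real.rpow_mul ha.le, ← Real.rpow_add ha]
      congr 1
      rw [hq]
      field_simp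
      ring
    rw [e1, e2]
    ring

/-- This is Taylor's formula of order N at infinity: for g(τ) = exp(-aτ^α), g(σ) is the integral
over τ > σ of (τ-σ)^N/N! times (-1)^(N+1) g^(N+1)(τ), and (τ-σ)^N = τ^N (1-σ/τ)^N. With σ = |ξ|² it
replaces a symbol that may be singular at the origin by compactly supported ones of finite
smoothness. The condition N ≠ 0 makes the truncated power vanish where τ ≤ σ. -/
theorem stretched_exp_eq_integral {α : ℝ} (hα : 0 < α) {a σ : ℝ} (ha : 0 < a) (hσ : 0 < σ)
    (N : ℕ) (hN : N ≠ 0) :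
    ∫ τ in Ioi (0 : ℝ), stretchDensity α a N τ * (max 0 (1 - σ / τ)) ^ N =
      Real.exp (-(a * σ ^ α)) := by
  -- an antiderivative of `(τ-σ)^N g_{N+1}(τ) / N!`
  let Φ : ℝ → ℝ := fun τ => -∑ k ∈ Finset.range (N + 1),
    (τ - σ) ^ k / k.factorial * stretchDeriv α a k τ
  let φ : ℝ → ℝ := fun τ => (τ - σ) ^ N / N.factorial * stretchDeriv α a (N + 1) τ
  have hΦ : ∀ τ, 0 < τ → HasDerivAt Φ (φ τ) τ := by
    intro τ hτ
    have h1 : ∀ k ∈ Finset.range (N + 1), HasDerivAt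
        (fun τ => (τ - σ) ^ k / k.factorial * stretchDeriv α a k τ)
        ((k * (τ - σ) ^ (k - 1)) / k.factorial * stretchDeriv α a k τ -
          (τ - σ) ^ k / k.factorial * stretchDeriv α a (k + 1) τ) τ := by
      intro k _
      have h2 : HasDerivAt (fun τ : ℝ => (τ - σ) ^ k / k.factorial)
          ((k * (τ - σ) ^ (k - 1)) / k.factorial) τ := by
        simpa using (((hasDerivAt_id τ).sub_const σ).pow k).div_const (k.factorial : ℝ)
      refine (h2.mul (hasDerivAt_stretchDeriv α a k hτ)).congr_deriv (by ring)
    refine (HasDerivAt.fun_sum h1).neg.congr_deriv ?_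
    -- The sum telescopes: differentiating the power in the term of index k+1 cancels the
    -- differentiation of g in the term of index k, and only the top term remains.
    have h3 : ∀ M : ℕ, ∑ k ∈ Finset.range (M + 1),
        ((k * (τ - σ) ^ (k - 1)) / k.factorial * stretchDeriv α a k τ -
          (τ - σ) ^ k / k.factorial * stretchDeriv α a (k + 1) τ) =
        -((τ - σ) ^ M / M.factorial * stretchDeriv α a (M + 1) τ) := by
      intro M
      induction M with
      | zero => simp
      | succ M ih =>
        rw [Finset.sum_range_succ, ih, Nat.factorial_succ]
        simp only [Nat.add_sub_cancel]
        push_cast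
        field_simp
        ring
    rw [h3, neg_neg]
  have hΦσ : Φ σ = -Real.exp (-(a * σ ^ α)) := by
    simp only [Φ, sub_self]
    rw [Finset.sum_range_succ', Finset.sum_eq_zero]
    · simp [stretchDeriv, stretchPoly]
    · intro k _
      simp
  have hφle : ∀ τ ∈ Ioi σ, |φ τ| ≤ |stretchDensity α a N τ| * √τ ^ 0 := by
    intro τ hτ
    have hτ' : σ < τ := hτ
    simp only [φ, stretchDensity, pow_zero, mul_one]
    rw [div_mul_eq_mul_div, abs_div, abs_div, abs_mul, abs_mul]
    gcongr
    · linarith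
  have hφi : IntegrableOn φ (Ioi σ) := by
    refine Integrable.mono' ((integrableOn_stretchDensity hα N 0 ha).mono_set
      (Ioi_subset_Ioi hσ.le)) ?_ ?_
    · refine ContinuousOn.aestronglyMeasurable (fun τ hτ => ?_) measurableSet_Ioi
      refine ((by fun_prop : Continuous fun τ : ℝ =>
        (τ - σ) ^ N / N.factorial).continuousAt.mul ?_).continuousWithinAt
      exact (hasDerivAt_stretchDeriv α a (N + 1) (hσ.trans hτ)).continuousAt
    · filter_upwards [ae_restrict_mem measurableSet_Ioi] with τ hτ
      exact hφle τ hτ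
  have hlim : Tendsto Φ atTop (𝓝 0) := by
    rw [← neg_zero]
    refine Tendsto.neg ?_
    rw [← Finset.sum_const_zero (s := Finset.range (N + 1))]
    refine tendsto_finsetSum _ fun k _ => ?_
    obtain ⟨C, hC, hP⟩ := polynomial_eval_le_exp (stretchPoly α k)
    have h0 : Tendsto (fun τ : ℝ => C * Real.exp (-(a / 2) * τ ^ α)) atTop (𝓝 0) := by
      rw [← mul_zero C]
      refine Tendsto.const_mul C (Real.tendsto_exp_atBot.comp ?_)
      exact (tendsto_rpow_atTop hα).const_mul_atTop_of_neg (by linarith)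
    refine squeeze_zero_norm' ?_ h0
    filter_upwards [eventually_gt_atTop σ] with τ hτ
    have hτ0 : 0 < τ := hσ.trans hτ
    have hz : 0 ≤ a * τ ^ α := by positivity
    have hf : (1 : ℝ) ≤ k.factorial := by exact_mod_cast k.factorial_pos
    simp only [stretchDeriv]
    rw [Real.norm_eq_abs, abs_mul, abs_mul, abs_mul, abs_div, Nat.abs_cast, Real.abs_exp, abs_inv,
      abs_pow, abs_pow, abs_of_pos hτ0, abs_of_pos (by linarith : 0 < τ - σ)]
    have e : Real.exp (-(a / 2) * τ ^ α) =
        Real.exp (a * τ ^ α / 2) * Real.exp (-(a * τ ^ α)) := by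
      rw [← Real.exp_add]; congr 1; ring
    have h1 : (τ - σ) ^ k / k.factorial * (τ ^ k)⁻¹ ≤ 1 := by
      rw [← div_eq_mul_inv, div_le_one (by positivity)]
      refine (div_le_self (by have : 0 < τ - σ := by linarith
                              positivity) hf).trans ?_
      exact pow_le_pow_left₀ (by linarith) (by linarith) k
    calc _ = ((τ - σ) ^ k / k.factorial * (τ ^ k)⁻¹) *
          (|(stretchPoly α k).eval (a * τ ^ α)| * Real.exp (-(a * τ ^ α))) := by ring
      _ ≤ 1 * (C * Real.exp (a * τ ^ α / 2) * Real.exp (-(a * τ ^ α))) := by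
          gcongr
          exact hP _ hz
      _ = _ := by rw [e]; ring
  have key : ∫ τ in Ioi σ, φ τ = Real.exp (-(a * σ ^ α)) := by
    rw [integral_Ioi_of_hasDerivAt_of_tendsto (hΦ σ hσ).continuousAt.continuousWithinAt
      (fun τ hτ => hΦ τ (hσ.trans hτ)) hφi hlim, hΦσ]
    ring
  rw [← key, ← integral_indicator measurableSet_Ioi, ← integral_indicator measurableSet_Ioi]
  refine integral_congr_ae (Eventually.of_forall fun τ => ?_)
  simp only [indicator, mem_Ioi]
  by_cases hτ0 : 0 < τ
  · rw [if_pos hτ0]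
    by_cases hτ : σ < τ
    · rw [if_pos hτ, max_eq_right (by rw [sub_nonneg, div_le_one hτ0]; exact hτ.le)]
      simp only [φ, stretchDensity]
      have : (τ - σ) ^ N = τ ^ N * (1 - σ / τ) ^ N := by
        rw [← mul_pow]; congr 1; field_simp
      rw [this]
      ring
    · rw [if_neg hτ, max_eq_left (by rw [sub_nonpos, one_le_div hτ0]; linarith), zero_pow hN,
        mul_zero]
  · rw [if_neg hτ0, if_neg (fun h => hτ0 (hσ.trans h))]

/-! ### Smoothness of truncated powers -/

theorem hasDerivAt_max_pow (m : ℕ) (x : ℝ) :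
    HasDerivAt (fun x : ℝ => (max 0 x) ^ (m + 2)) ((m + 2 : ℝ) * (max 0 x) ^ (m + 1)) x := by
  rcases lt_trichotomy x 0 with hx | hx | hx
  · rw [max_eq_left hx.le, zero_pow (by omega), mul_zero]
    refine (hasDerivAt_const x (0 : ℝ)).congr_of_eventuallyEq ?_
    filter_upwards [Iio_mem_nhds hx] with y hy
    rw [max_eq_left (le_of_lt hy), zero_pow (by omega)]
  · subst hx
    rw [max_self, zero_pow (by omega), mul_zero, hasDerivAt_iff_isLittleO_nhds_zero]
    simp only [zero_add, max_self, smul_zero, sub_zero, ne_eq, Nat.add_eq_zero_iff, OfNat.ofNat_ne_zero,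
      and_false, not_false_eq_true, zero_pow]
    have h1 : (fun y : ℝ => (max 0 y) ^ (m + 2)) =O[𝓝 0] fun y : ℝ => ‖y‖ ^ (m + 2) := by
      refine Asymptotics.IsBigO.of_bound 1 (Eventually.of_forall fun y => ?_)
      rw [one_mul, norm_pow, norm_pow, norm_norm]
      refine pow_le_pow_left₀ (norm_nonneg _) ?_ _
      rw [Real.norm_of_nonneg (le_max_left _ _)]
      exact max_le (norm_nonneg _) (Real.le_norm_self y)
    exact h1.trans_isLittleO (Asymptotics.isLittleO_norm_pow_id (by omega))
  · rw [max_eq_right hx.le]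
    refine ((hasDerivAt_pow (m + 2) x).congr_of_eventuallyEq ?_).congr_deriv ?_
    · filter_upwards [Ioi_mem_nhds hx] with y hy
      rw [max_eq_right (le_of_lt hy)]
    · push_cast
      rfl

theorem contDiff_max_pow (m : ℕ) : ContDiff ℝ m (fun x : ℝ => (max 0 x) ^ (m + 1)) := by
  induction m with
  | zero =>
    rw [Nat.cast_zero, contDiff_zero]
    fun_prop
  | succ m ih =>
    push_cast
    rw [contDiff_succ_iff_deriv]
    refine ⟨fun x => (hasDerivAt_max_pow m x).differentiableAt, by simp, ?_⟩
    have : deriv (fun x : ℝ => (max 0 x) ^ (m + 1 + 1)) =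
        fun x => (m + 2 : ℝ) * (max 0 x) ^ (m + 1) :=
      funext fun x => (hasDerivAt_max_pow m x).deriv
    rw [this]
    exact contDiff_const.mul ih

end Stretched

end FracNS

namespace FracNS

/-! ### The fractional heat kernel -/

section HeatKernel

variable {n : ℕ}

/-- The iterated derivative of the fractional heat kernel along the vectors of a list. -/
noncomputable def heatDeriv (α t : ℝ) (l : List (Vec n)) : Vec n → ℂ :=
  𝓕⁻ (fun ξ => dirSymbol l ξ * heatSymbol α t ξ)

theorem nontrivial_vec [NeZero n] : Nontrivial (Vec n) :=
  Module.nontrivial_of_finrank_pos (R := ℝ) (by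
    rw [finrank_euclideanSpace_fin]; exact Nat.pos_of_ne_zero (NeZero.ne n))

/-! ### Elementary properties of the heat symbol -/

theorem norm_heatSymbol (α t : ℝ) (ξ : Vec n) :
    ‖heatSymbol α t ξ‖ = Real.exp (-(t * (2 * Real.pi * ‖ξ‖) ^ (2 * α))) := by
  rw [heatSymbol, Complex.norm_real, Real.norm_of_nonneg (Real.exp_pos _).le]

theorem continuous_heatSymbol {α : ℝ} (hα : 0 < α) (t : ℝ) :
    Continuous (heatSymbol α t : Vec n → ℂ) := by
  unfold heatSymbol
  refine Complex.continuous_ofReal.comp (Real.continuous_exp.comp (Continuous.neg ?_))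
  exact continuous_const.mul ((by fun_prop : Continuous fun ξ : Vec n =>
    2 * Real.pi * ‖ξ‖).rpow_const fun _ => Or.inr (by positivity))

theorem heatSymbol_add (α s t : ℝ) (ξ : Vec n) :
    heatSymbol α (s + t) ξ = heatSymbol α s ξ * heatSymbol α t ξ := by
  unfold heatSymbol
  rw [← Complex.ofReal_mul, ← Real.exp_add]
  congr 2
  ring

theorem heatSymbol_neg (α t : ℝ) (ξ : Vec n) : heatSymbol α t (-ξ) = heatSymbol α t ξ := by
  simp [heatSymbol]

theorem conj_heatSymbol (α t : ℝ) (ξ : Vec n) :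
    (starRingEnd ℂ) (heatSymbol α t ξ) = heatSymbol α t (-ξ) := by
  rw [heatSymbol_neg, heatSymbol, Complex.conj_ofReal]

theorem heatSymbol_exponent {α : ℝ} (t : ℝ) (ξ : Vec n) :
    t * (2 * Real.pi * ‖ξ‖) ^ (2 * α) = t * (2 * Real.pi) ^ (2 * α) * (‖ξ‖ ^ 2) ^ α := by
  rw [Real.mul_rpow (by positivity) (norm_nonneg _), Real.rpow_mul (norm_nonneg ξ), Real.rpow_two]
  ring

theorem integrable_pow_mul_heatSymbol [NeZero n] {α : ℝ} (hα : 0 < α) {t : ℝ} (ht : 0 < t)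
    (k : ℕ) : Integrable fun ξ : Vec n => ‖ξ‖ ^ k * ‖heatSymbol α t ξ‖ := by
  have := nontrivial_vec (n := n)
  simp only [norm_heatSymbol]
  rw [integrable_fun_norm_addHaar (volume : Measure (Vec n))
    (f := fun r => r ^ k * Real.exp (-(t * (2 * Real.pi * r) ^ (2 * α))))]
  have h := integrableOn_rpow_mul_exp_neg_mul_rpow (p := 2 * α)
    (s := ((Module.finrank ℝ (Vec n) - 1 + k : ℕ) : ℝ)) (b := t * (2 * Real.pi) ^ (2 * α))
    (by have : (0 : ℝ) ≤ ((Module.finrank ℝ (Vec n) - 1 + k : ℕ) : ℝ) := Nat.cast_nonneg _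
        linarith) (by positivity) (by positivity)
  refine h.congr_fun (fun r hr => ?_) measurableSet_Ioi
  have hr' : (0 : ℝ) < r := hr
  simp only [smul_eq_mul]
  rw [Real.rpow_natCast, Real.mul_rpow (by positivity) hr'.le, pow_add]
  ring_nf

theorem integrable_dirSymbol_mul_heatSymbol [NeZero n] {α : ℝ} (hα : 0 < α) {t : ℝ} (ht : 0 < t)
    (l : List (Vec n)) : Integrable fun ξ => dirSymbol l ξ * heatSymbol α t ξ :=
  integrable_dirSymbol_mul (continuous_heatSymbol hα t).aestronglyMeasurable
    (integrable_pow_mul_heatSymbol hα ht) l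

/-- The truncated power `(1 - |ξ|²)₊^{n+2}` times a derivative symbol. -/
noncomputable def truncSymbol (l : List (Vec n)) (ξ : Vec n) : ℂ :=
  dirSymbol l ξ * (((max 0 (1 - ‖ξ‖ ^ 2)) ^ (n + 2) : ℝ) : ℂ)

theorem contDiff_truncSymbol (l : List (Vec n)) :
    ContDiff ℝ (n + 1 : ℕ) (truncSymbol l) := by
  have h1 : ContDiff ℝ (n + 1 : ℕ) fun ξ : Vec n => (max 0 (1 - ‖ξ‖ ^ 2)) ^ (n + 2) :=
    (contDiff_max_pow (n + 1)).comp (contDiff_const.sub (contDiff_norm_sq ℝ))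
  exact ((contDiff_dirSymbol l).of_le (by exact_mod_cast le_top)).mul
    (Complex.ofRealCLM.contDiff.comp h1)

theorem hasCompactSupport_truncSymbol (l : List (Vec n)) : HasCompactSupport (truncSymbol l) := by
  refine HasCompactSupport.of_support_subset_isCompact (isCompact_closedBall (0 : Vec n) 1) ?_
  intro ξ hξ
  by_contra hx
  refine hξ ?_
  rw [mem_closedBall_zero_iff, not_le] at hx
  have : max 0 (1 - ‖ξ‖ ^ 2) = 0 := max_eq_left (by nlinarith)
  simp [truncSymbol, this]

/-- The order N = n+2 makes the truncated power of class C^(n+1), as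
`integrable_fourierInv_of_contDiff` requires. The factor √τ^|l| compensates the homogeneity of the
derivative symbol under the dilation. Excluding ξ = 0 costs nothing, because kernels depend on
symbols only almost everywhere. -/
theorem heatSymbol_eq_integral {α : ℝ} (hα : 0 < α) {t : ℝ} (ht : 0 < t) (l : List (Vec n))
    {ξ : Vec n} (hξ : ξ ≠ 0) :
    ∫ τ in Ioi (0 : ℝ), ((stretchDensity α (t * (2 * Real.pi) ^ (2 * α)) (n + 2) τ *
      √τ ^ l.length : ℝ) : ℂ) * truncSymbol l ((√τ)⁻¹ • ξ) =
      dirSymbol l ξ * heatSymbol α t ξ := by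
  have hσ : 0 < ‖ξ‖ ^ 2 := by have := norm_pos_iff.2 hξ; positivity
  have h := stretched_exp_eq_integral hα (a := t * (2 * Real.pi) ^ (2 * α)) (by positivity) hσ
    (n + 2) (by omega)
  rw [heatSymbol, heatSymbol_exponent, ← h, ← integral_complex_ofReal, ← integral_const_mul]
  refine setIntegral_congr_fun measurableSet_Ioi fun τ hτ => ?_
  have hτ' : (0 : ℝ) < τ := hτ
  have hs : 0 < √τ := Real.sqrt_pos.2 hτ'
  rw [truncSymbol, dirSymbol_smul]
  have e1 : ‖(√τ)⁻¹ • ξ‖ ^ 2 = ‖ξ‖ ^ 2 / τ := by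
    rw [norm_smul, mul_pow, norm_inv, Real.norm_of_nonneg hs.le, inv_pow, Real.sq_sqrt hτ'.le]
    field_simp
  rw [e1]
  have e2 : ((√τ : ℝ) : ℂ) ^ l.length * (((√τ)⁻¹ : ℝ) : ℂ) ^ l.length = 1 := by
    rw [← mul_pow, ← Complex.ofReal_mul, mul_inv_cancel₀ hs.ne', Complex.ofReal_one, one_pow]
  rw [Complex.ofReal_mul, Complex.ofReal_mul, Complex.ofReal_pow (√τ)]
  linear_combination (stretchDensity α (t * (2 * Real.pi) ^ (2 * α)) (n + 2) τ : ℂ) *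
    dirSymbol l ξ * (((max 0 (1 - ‖ξ‖ ^ 2 / τ)) ^ (n + 2) : ℝ) : ℂ) * e2

/-- All dilates of `truncSymbol l` have kernels with the same L¹ norm A, so the norm of the
superposition is at most A times a moment of the density, and that moment carries the power of t. -/
theorem l1Le_heatDeriv [NeZero n] {α : ℝ} (hα : 0 < α) (l : List (Vec n)) :
    ∃ D, 0 ≤ D ∧ ∀ t, 0 < t → L1Le (heatDeriv α t l) (D * t ^ (-(l.length / (2 * α)) : ℝ)) := by
  have := nontrivial_vec (n := n)
  obtain ⟨D, hD, hDb⟩ := integral_stretchDensity_le hα (n + 2) l.length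
  set A := ∫ x, ‖𝓕⁻ (truncSymbol l) x‖ with hA
  have hA0 : 0 ≤ A := integral_nonneg fun _ => norm_nonneg _
  have hAL : L1Le (𝓕⁻ (truncSymbol l)) A :=
    ⟨integrable_fourierInv_of_contDiff (contDiff_truncSymbol l) (hasCompactSupport_truncSymbol l),
      le_rfl⟩
  have hTi : Integrable (truncSymbol l) :=
    (contDiff_truncSymbol l).continuous.integrable_of_hasCompactSupport
      (hasCompactSupport_truncSymbol l)
  refine ⟨D * A * ((2 * Real.pi) ^ (2 * α)) ^ (-(l.length / (2 * α)) : ℝ), by positivity,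
    fun t ht => ?_⟩
  set a := t * (2 * Real.pi) ^ (2 * α) with ha
  have ha0 : 0 < a := by positivity
  let m : ℝ → Vec n → ℂ := fun τ ξ =>
    ((stretchDensity α a (n + 2) τ * √τ ^ l.length : ℝ) : ℂ) * truncSymbol l ((√τ)⁻¹ • ξ)
  have hd : Measurable fun τ => stretchDensity α a (n + 2) τ * √τ ^ l.length :=
    (measurable_stretchDensity α a (n + 2)).mul (by fun_prop)
  have hm : StronglyMeasurable (Function.uncurry m) := by
    have h1 : Measurable fun p : ℝ × Vec n => (√p.1)⁻¹ • p.2 := by fun_prop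
    exact ((Complex.measurable_ofReal.comp (hd.comp measurable_fst)).mul
      ((contDiff_truncSymbol l).continuous.measurable.comp h1)).stronglyMeasurable
  have hnorm : ∀ τ : ℝ, ‖((stretchDensity α a (n + 2) τ * √τ ^ l.length : ℝ) : ℂ)‖ =
      |stretchDensity α a (n + 2) τ| * √τ ^ l.length := fun τ => by
    rw [Complex.norm_real, Real.norm_eq_abs, abs_mul, abs_of_nonneg (by positivity : 0 ≤ √τ ^ _)]
  have hint : Integrable (Function.uncurry m) ((volume.restrict (Ioi 0)).prod volume) := by
    rw [integrable_prod_iff hm.aestronglyMeasurable]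
    constructor
    · filter_upwards [ae_restrict_mem measurableSet_Ioi] with τ hτ
      exact (hTi.comp_smul (inv_ne_zero (Real.sqrt_pos.2 hτ).ne')).const_mul
        ((stretchDensity α a (n + 2) τ * √τ ^ l.length : ℝ) : ℂ)
    -- Here the symbols themselves are integrated in ξ; the dilation then contributes √τ^n, hence
    -- the moment of order |l| + n.
    · have h1 := (integrableOn_stretchDensity hα (n + 2) (l.length + n) ha0).mul_const
        (∫ ξ, ‖truncSymbol l ξ‖)
      refine h1.congr ?_
      filter_upwards [ae_restrict_mem measurableSet_Ioi] with τ hτ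
      have hs : 0 < √τ := Real.sqrt_pos.2 hτ
      simp only [Function.uncurry, m, norm_mul, hnorm]
      rw [integral_const_mul, Measure.integral_comp_smul volume (fun ξ => ‖truncSymbol l ξ‖),
        finrank_euclideanSpace_fin, abs_of_pos (by positivity : 0 < ((√τ)⁻¹ ^ n)⁻¹),
        inv_pow, inv_inv, pow_add, smul_eq_mul]
      ring
  have key := L1Le.fourierInv_integral (μ := volume.restrict (Ioi 0)) hm hint
    (b := fun τ => |stretchDensity α a (n + 2) τ| * √τ ^ l.length * A)
    ((integrableOn_stretchDensity hα (n + 2) l.length ha0).mul_const A) (by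
      filter_upwards [ae_restrict_mem measurableSet_Ioi] with τ hτ
      have hs : 0 < √τ := Real.sqrt_pos.2 hτ
      have h1 := (hAL.fourierInv_comp_smul (inv_pos.2 hs)).const_mul
        ((stretchDensity α a (n + 2) τ * √τ ^ l.length : ℝ) : ℂ)
      rw [hnorm] at h1
      have e : 𝓕⁻ (m τ) = fun x => ((stretchDensity α a (n + 2) τ * √τ ^ l.length : ℝ) : ℂ) *
          𝓕⁻ (fun ξ => truncSymbol l ((√τ)⁻¹ • ξ)) x :=
        funext fun x => fourierInv_const_mul _ _ x
      rw [e]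
      exact h1)
  have e1 : (fun ξ => ∫ τ in Ioi (0 : ℝ), m τ ξ) =ᵐ[volume]
      fun ξ => dirSymbol l ξ * heatSymbol α t ξ := by
    have h0 : ∀ᵐ ξ : Vec n, ξ ≠ 0 := by simp [ae_iff]
    filter_upwards [h0] with ξ hξ
    exact heatSymbol_eq_integral hα ht l hξ
  rw [fourierInv_congr_ae e1] at key
  refine key.mono ?_
  rw [integral_mul_const]
  calc _ ≤ D * a ^ (-(l.length / (2 * α)) : ℝ) * A := by gcongr; exact hDb a ha0
    _ = _ := by rw [ha, Real.mul_rpow ht.le (by positivity)]; ring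

theorem dirSymbol_singleton_sum (v ξ : Vec n) :
    dirSymbol [v] ξ = ∑ i, (v i : ℂ) * dirSymbol [(basisVec i : Vec n)] ξ := by
  have h : inner ℝ v ξ = ∑ i, v i * inner ℝ (basisVec i : Vec n) ξ := by
    simp only [basisVec, EuclideanSpace.inner_single_left]
    simp [PiLp.inner_apply, mul_comm]
  simp only [dirSymbol_cons, dirSymbol_nil, mul_one]
  rw [h]
  push_cast
  rw [Finset.mul_sum]
  refine Finset.sum_congr rfl fun i _ => by ring

/-- Expanding v in the standard basis makes the constant uniform in the direction; the constant of
`l1Le_heatDeriv` depends on the list. -/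
theorem l1Le_heatDeriv_singleton [NeZero n] {α : ℝ} (hα : 0 < α) :
    ∃ D, 0 ≤ D ∧ ∀ t, 0 < t → ∀ v : Vec n,
      L1Le (heatDeriv α t [v]) (D * t ^ (-(1 / (2 * α)) : ℝ) * ‖v‖) := by
  choose D hD h using fun i : Fin n => l1Le_heatDeriv hα [(basisVec i : Vec n)]
  refine ⟨∑ i, D i, Finset.sum_nonneg fun i _ => hD i, fun t ht v => ?_⟩
  have e : heatDeriv α t [v] =
      fun x => ∑ i, (v i : ℂ) * heatDeriv α t [(basisVec i : Vec n)] x := by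
    funext x
    have e1 : (fun ξ => dirSymbol [v] ξ * heatSymbol α t ξ) = fun ξ =>
        ∑ i, (v i : ℂ) * (dirSymbol [(basisVec i : Vec n)] ξ * heatSymbol α t ξ) := by
      funext ξ
      rw [dirSymbol_singleton_sum, Finset.sum_mul]
      exact Finset.sum_congr rfl fun i _ => by ring
    rw [heatDeriv, e1, fourierInv_finset_sum fun i _ =>
      (integrable_dirSymbol_mul_heatSymbol hα ht _).const_mul _]
    exact Finset.sum_congr rfl fun i _ => fourierInv_const_mul _ _ x
  rw [e]
  refine (L1Le.sum fun i _ => (h i t ht).const_mul (v i : ℂ)).mono ?_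
  rw [Finset.sum_mul, Finset.sum_mul]
  refine Finset.sum_le_sum fun i _ => ?_
  rw [Complex.norm_real]
  have h1 : ‖v i‖ ≤ ‖v‖ := PiLp.norm_apply_le v i
  have h2 : 0 ≤ D i * t ^ (-(1 / (2 * α)) : ℝ) := mul_nonneg (hD i) (by positivity)
  simp only [List.length_singleton, Nat.cast_one]
  rw [mul_comm]
  gcongr

/-- The semigroup property for derivatives of heat kernels. -/
theorem l1Le_heatDeriv_append [NeZero n] {α : ℝ} (hα : 0 < α) {s t C D : ℝ} (hs : 0 < s)
    (ht : 0 < t) {l l' : List (Vec n)} (h : L1Le (heatDeriv α s l) C)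
    (h' : L1Le (heatDeriv α t l') D) : L1Le (heatDeriv α (s + t) (l ++ l')) (C * D) := by
  have := L1Le.fourierInv_mul
    ((contDiff_dirSymbol l).continuous.mul (continuous_heatSymbol hα s))
    (integrable_dirSymbol_mul_heatSymbol hα hs l) h
    (integrable_dirSymbol_mul_heatSymbol hα ht l') h'
  have e : heatDeriv α (s + t) (l ++ l') = 𝓕⁻ (fun ξ =>
      (dirSymbol l ξ * heatSymbol α s ξ) * (dirSymbol l' ξ * heatSymbol α t ξ)) := by
    rw [heatDeriv]
    congr 1
    funext ξ
    rw [dirSymbol_append, heatSymbol_add]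
    ring
  rw [e]
  exact this

/-- The exponential series gives (k+1)^k ≤ k! e^(k+1), and (k+1)² ≤ 4^k. This converts the loss
caused by cutting the time into k+1 pieces into the analytic weight, at the price of the geometric
factor (4e)^k. -/
theorem succ_pow_mul_sq_le (k : ℕ) :
    ((k : ℝ) + 1) ^ k * ((k : ℝ) + 1) ^ 2 ≤ Real.exp 1 * (4 * Real.exp 1) ^ k * k.factorial := by
  have h1 := Real.pow_div_factorial_le_exp ((k : ℝ) + 1) (by positivity) k
  rw [div_le_iff₀ (by positivity)] at h1
  have h2 : ((k : ℝ) + 1) ^ 2 ≤ 4 ^ k := by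
    have h3 : (k : ℝ) + 1 ≤ 2 ^ k := by exact_mod_cast Nat.lt_two_pow_self
    calc ((k : ℝ) + 1) ^ 2 ≤ (2 ^ k) ^ 2 := by gcongr
      _ = 4 ^ k := by rw [← pow_mul, mul_comm, pow_mul]; norm_num
  have h4 : Real.exp ((k : ℝ) + 1) = Real.exp 1 ^ k * Real.exp 1 := by
    rw [Real.exp_add, ← Real.exp_nat_mul, mul_one]
  calc _ ≤ (Real.exp ((k : ℝ) + 1) * k.factorial) * 4 ^ k := by gcongr
    _ = _ := by rw [h4, mul_pow]; ring

/-- All derivatives of the heat kernel are controlled like those of an analytic function with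
radius proportional to `t^{1/(2α)}`. -/
theorem exists_heatDeriv_bound [NeZero n] {α : ℝ} (hα : 1 / 2 < α) :
    ∃ δ A : ℝ, 0 < δ ∧ 0 ≤ A ∧ ∀ t, 0 < t → ∀ l : List (Vec n), L1Le (heatDeriv α t l)
      (A * anaWeight (δ * t ^ (1 / (2 * α))) l.length * normProd l) := by
  have hα0 : 0 < α := by linarith
  obtain ⟨C₀, hC₀, h0⟩ := l1Le_heatDeriv hα0 ([] : List (Vec n))
  obtain ⟨C', hC', h1'⟩ := l1Le_heatDeriv_singleton (n := n) hα0
  set p := 1 / (2 * α) with hp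
  have hp0 : 0 < p := by positivity
  have hp1 : p ≤ 1 := by rw [hp, div_le_one (by positivity)]; linarith
  set C₁ := C' + 1 with hC₁
  have hC₁0 : 0 < C₁ := by positivity
  -- By the semigroup property each of the k derivatives falls on its own heat kernel of time τ, and
  -- one kernel without derivatives remains; the total time is (k+1)τ.
  have step : ∀ τ, 0 < τ → ∀ l : List (Vec n), L1Le (heatDeriv α ((l.length + 1) * τ) l)
      (C₀ * (C₁ * τ ^ (-p)) ^ l.length * normProd l) := by
    intro τ hτ l
    induction l with
    | nil => simpa using h0 τ hτ
    | cons v l ih =>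
      have h1 : L1Le (heatDeriv α τ [v]) (C₁ * τ ^ (-p) * ‖v‖) := by
        refine (h1' τ hτ v).mono ?_
        gcongr
        rw [hC₁]; linarith
      have h2 := l1Le_heatDeriv_append hα0 hτ (by positivity) h1 ih
      have e : τ + ((l.length : ℝ) + 1) * τ = (((v :: l).length : ℝ) + 1) * τ := by
        rw [List.length_cons]; push_cast; ring
      rw [e] at h2
      refine h2.mono (le_of_eq ?_)
      rw [List.length_cons, normProd_cons, pow_succ]
      ring
  -- Each derivative costs C₁ and a factor 4e from `succ_pow_mul_sq_le`. The summand 1 in C₁ keeps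
  -- it positive.
  refine ⟨(4 * Real.exp 1 * C₁)⁻¹, C₀ * Real.exp 1, by positivity, by positivity,
    fun t ht l => ?_⟩
  set k := l.length with hk
  have hk0 : (0 : ℝ) < (k : ℝ) + 1 := by positivity
  have h := step (t / (k + 1)) (by positivity) l
  rw [← hk, mul_div_cancel₀ _ hk0.ne'] at h
  refine h.mono ?_
  refine mul_le_mul_of_nonneg_right ?_ (normProd_nonneg l)
  -- Here p ≤ 1 is decisive: the loss (k+1)^(pk) is at most (k+1)^k, that is, k! up to a geometric
  -- factor.
  have e1 : (t / ((k : ℝ) + 1)) ^ (-p) ≤ ((k : ℝ) + 1) * (t ^ p)⁻¹ := by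
    rw [Real.rpow_neg (by positivity), Real.div_rpow ht.le hk0.le, inv_div, div_eq_mul_inv]
    gcongr
    calc ((k : ℝ) + 1) ^ p ≤ ((k : ℝ) + 1) ^ (1 : ℝ) :=
          Real.rpow_le_rpow_of_exponent_le (by linarith [(Nat.cast_nonneg k : (0 : ℝ) ≤ k)]) hp1
      _ = _ := Real.rpow_one _
  have htp : 0 < t ^ p := by positivity
  calc C₀ * (C₁ * (t / ((k : ℝ) + 1)) ^ (-p)) ^ k
      ≤ C₀ * (C₁ * (((k : ℝ) + 1) * (t ^ p)⁻¹)) ^ k := by gcongr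
    _ = C₀ * ((C₁ * (t ^ p)⁻¹) ^ k * (((k : ℝ) + 1) ^ 2)⁻¹) *
        (((k : ℝ) + 1) ^ k * ((k : ℝ) + 1) ^ 2) := by
        rw [mul_left_comm C₁, mul_pow ((k : ℝ) + 1)]
        field_simp
    _ ≤ C₀ * ((C₁ * (t ^ p)⁻¹) ^ k * (((k : ℝ) + 1) ^ 2)⁻¹) *
        (Real.exp 1 * (4 * Real.exp 1) ^ k * k.factorial) :=
        mul_le_mul_of_nonneg_left (succ_pow_mul_sq_le k) (by positivity)
    _ = _ := by
        unfold anaWeight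
        rw [mul_pow (4 * Real.exp 1 * C₁)⁻¹, inv_pow, mul_pow (4 * Real.exp 1) C₁,
          mul_pow C₁, inv_pow]
        field_simp

end HeatKernel

end FracNS

namespace FracNS

/-! ### The Oseen kernel -/

section Oseen

variable {n : ℕ}

/-- The symbol of `∂_k Π_{ij} S(t)`. -/
noncomputable def oseenSymbol (α t : ℝ) (i j k : Fin n) (ξ : Vec n) : ℂ :=
  2 * Real.pi * Complex.I * (ξ k : ℂ) *
    (((if i = j then (1 : ℝ) else 0) - ξ i * ξ j / ‖ξ‖ ^ 2 : ℝ) : ℂ) * heatSymbol α t ξ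

/-- The iterated derivative of the Oseen kernel along the vectors of a list. -/
noncomputable def oseenDeriv (α t : ℝ) (i j k : Fin n) (l : List (Vec n)) : Vec n → ℂ :=
  𝓕⁻ (fun ξ => dirSymbol l ξ * oseenSymbol α t i j k ξ)

theorem oseenDeriv_nil (α t : ℝ) (i j k : Fin n) :
    oseenDeriv α t i j k [] = oseenKernel α t i j k := by
  simp only [oseenDeriv, oseenKernel, dirSymbol_nil, one_mul]
  rfl

theorem measurable_oseenSymbol (α : ℝ) (i j k : Fin n) :
    Measurable (Function.uncurry fun t => oseenSymbol α t i j k : ℝ × Vec n → ℂ) := by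
  have h1 : ∀ i : Fin n, Measurable fun p : ℝ × Vec n => p.2 i := fun i => by fun_prop
  have h2 : Measurable fun p : ℝ × Vec n => heatSymbol α p.1 p.2 := by
    unfold heatSymbol
    fun_prop
  have h3 : Measurable fun p : ℝ × Vec n =>
      (if i = j then (1 : ℝ) else 0) - p.2 i * p.2 j / ‖p.2‖ ^ 2 :=
    measurable_const.sub (((h1 i).mul (h1 j)).div (by fun_prop))
  exact (((measurable_const.mul (Complex.measurable_ofReal.comp (h1 k))).mul
    (Complex.measurable_ofReal.comp h3)).mul h2)

theorem stronglyMeasurable_oseenKernel (α : ℝ) (i j k : Fin n) :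
    StronglyMeasurable (Function.uncurry fun t => oseenKernel α t i j k : ℝ × Vec n → ℂ) := by
  have := stronglyMeasurable_fourierInv (measurable_oseenSymbol α i j k).stronglyMeasurable
  exact this

theorem oseenSymbol_neg (α t : ℝ) (i j k : Fin n) (ξ : Vec n) :
    (starRingEnd ℂ) (oseenSymbol α t i j k ξ) = oseenSymbol α t i j k (-ξ) := by
  unfold oseenSymbol
  rw [map_mul, conj_heatSymbol, map_mul, Complex.conj_ofReal]
  simp [Complex.conj_ofReal, Complex.conj_ofNat]

theorem oseenKernel_im (α t : ℝ) (i j k : Fin n) (x : Vec n) :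
    (oseenKernel α t i j k x).im = 0 :=
  fourierInv_im_eq_zero (oseenSymbol_neg α t i j k) x

theorem norm_oseenSymbol_le (α t : ℝ) (i j k : Fin n) (ξ : Vec n) :
    ‖oseenSymbol α t i j k ξ‖ ≤ 4 * Real.pi * (‖ξ‖ * ‖heatSymbol α t ξ‖) := by
  unfold oseenSymbol
  rw [norm_mul, norm_mul, Complex.norm_real]
  have h1 : ‖2 * Real.pi * Complex.I * (ξ k : ℂ)‖ ≤ 2 * Real.pi * ‖ξ‖ := by
    rw [norm_mul, norm_mul, norm_mul, Complex.norm_I, Complex.norm_real, Complex.norm_real,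
      Real.norm_of_nonneg Real.pi_pos.le]
    have := PiLp.norm_apply_le ξ k
    simp only [Complex.norm_ofNat, mul_one]
    gcongr
  have h2 : ‖(if i = j then (1 : ℝ) else 0) - ξ i * ξ j / ‖ξ‖ ^ 2‖ ≤ 2 := by
    refine (norm_sub_le _ _).trans ?_
    have h3 : ‖(if i = j then (1 : ℝ) else 0)‖ ≤ 1 := by split_ifs <;> simp
    have h4 : ‖ξ i * ξ j / ‖ξ‖ ^ 2‖ ≤ 1 := by
      rw [norm_div, norm_mul, norm_pow, norm_norm]
      refine div_le_one_of_le₀ ?_ (by positivity)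
      rw [sq]
      exact mul_le_mul (PiLp.norm_apply_le ξ i) (PiLp.norm_apply_le ξ j) (norm_nonneg _)
        (norm_nonneg _)
    linarith
  calc _ ≤ 2 * Real.pi * ‖ξ‖ * 2 * ‖heatSymbol α t ξ‖ := by gcongr
    _ = _ := by ring

theorem measurable_oseenSymbol_right (α t : ℝ) (i j k : Fin n) :
    Measurable (oseenSymbol α t i j k) := by
  have h2 := measurable_oseenSymbol (n := n) α i j k
  exact h2.of_uncurry_left

theorem integrable_pow_mul_oseenSymbol [NeZero n] {α : ℝ} (hα : 0 < α) {t : ℝ} (ht : 0 < t)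
    (i j k : Fin n) (m : ℕ) : Integrable fun ξ : Vec n => ‖ξ‖ ^ m * ‖oseenSymbol α t i j k ξ‖ := by
  refine Integrable.mono' ((integrable_pow_mul_heatSymbol hα ht (m + 1)).const_mul (4 * Real.pi))
    (((by fun_prop : Measurable fun ξ : Vec n => ‖ξ‖ ^ m)).mul
      (measurable_oseenSymbol_right α t i j k).norm).aestronglyMeasurable
    (Eventually.of_forall fun ξ => ?_)
  rw [Real.norm_of_nonneg (by positivity)]
  calc _ ≤ ‖ξ‖ ^ m * (4 * Real.pi * (‖ξ‖ * ‖heatSymbol α t ξ‖)) := by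
        gcongr; exact norm_oseenSymbol_le α t i j k ξ
    _ = _ := by ring

theorem integrable_oseenSymbol [NeZero n] {α : ℝ} (hα : 0 < α) {t : ℝ} (ht : 0 < t)
    (i j k : Fin n) : Integrable (oseenSymbol α t i j k) := by
  have := integrable_dirSymbol_mul (measurable_oseenSymbol_right α t i j k).aestronglyMeasurable
    (integrable_pow_mul_oseenSymbol hα ht i j k) []
  simpa using this

theorem isJet_oseenDeriv [NeZero n] {α : ℝ} (hα : 0 < α) {t : ℝ} (ht : 0 < t)
    (i j k : Fin n) : IsJet (oseenDeriv α t i j k) :=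
  isJet_fourierInv (measurable_oseenSymbol_right α t i j k).aestronglyMeasurable
    (integrable_pow_mul_oseenSymbol hα ht i j k)

/-- Split at τ = t, replacing t + τ by t below and by τ above. The exponent 2p - 1 comes from the
Gamma integral and 3p from the decay of three derivatives of the heat kernel. -/
theorem integral_rpow_mul_add_rpow {p : ℝ} (hp : 0 < p) {t : ℝ} (ht : 0 < t) :
    IntegrableOn (fun τ : ℝ => τ ^ (2 * p - 1) * (t + τ) ^ (-(3 * p))) (Ioi 0) ∧
      ∫ τ in Ioi (0 : ℝ), τ ^ (2 * p - 1) * (t + τ) ^ (-(3 * p)) ≤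
        (1 / (2 * p) + 1 / p) * t ^ (-p) := by
  have hm : Measurable fun τ : ℝ => τ ^ (2 * p - 1) * (t + τ) ^ (-(3 * p)) := by fun_prop
  have hu : Ioi (0 : ℝ) = Ioc 0 t ∪ Ioi t := (Ioc_union_Ioi_eq_Ioi ht.le).symm
  have i1 : IntegrableOn (fun τ : ℝ => τ ^ (2 * p - 1) * t ^ (-(3 * p))) (Ioc 0 t) := by
    have := (intervalIntegral.intervalIntegrable_rpow' (a := 0) (b := t) (r := 2 * p - 1)
      (by linarith)).mul_const (t ^ (-(3 * p)))
    rwa [intervalIntegrable_iff_integrableOn_Ioc_of_le ht.le] at this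
  have i2 : IntegrableOn (fun τ : ℝ => τ ^ (-p - 1)) (Ioi t) :=
    integrableOn_Ioi_rpow_of_lt (by linarith) ht
  have b1 : ∀ τ ∈ Ioc 0 t, τ ^ (2 * p - 1) * (t + τ) ^ (-(3 * p)) ≤
      τ ^ (2 * p - 1) * t ^ (-(3 * p)) := by
    intro τ hτ
    have h0 : 0 < τ := hτ.1
    refine mul_le_mul_of_nonneg_left ?_ (by positivity)
    exact Real.rpow_le_rpow_of_nonpos ht (by linarith) (by linarith)
  have b2 : ∀ τ ∈ Ioi t, τ ^ (2 * p - 1) * (t + τ) ^ (-(3 * p)) ≤ τ ^ (-p - 1) := by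
    intro τ hτ
    have h0 : 0 < τ := ht.trans hτ
    have : τ ^ (-p - 1) = τ ^ (2 * p - 1) * τ ^ (-(3 * p)) := by
      rw [← Real.rpow_add h0]; congr 1; ring
    rw [this]
    refine mul_le_mul_of_nonneg_left ?_ (by positivity)
    exact Real.rpow_le_rpow_of_nonpos h0 (by linarith) (by linarith)
  have j1 : IntegrableOn (fun τ : ℝ => τ ^ (2 * p - 1) * (t + τ) ^ (-(3 * p))) (Ioc 0 t) := by
    refine Integrable.mono' i1 hm.aestronglyMeasurable ?_
    filter_upwards [ae_restrict_mem measurableSet_Ioc] with τ hτ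
    have h0 : 0 < τ := hτ.1
    rw [Real.norm_of_nonneg (by positivity)]
    exact b1 τ hτ
  have j2 : IntegrableOn (fun τ : ℝ => τ ^ (2 * p - 1) * (t + τ) ^ (-(3 * p))) (Ioi t) := by
    refine Integrable.mono' i2 hm.aestronglyMeasurable ?_
    filter_upwards [ae_restrict_mem measurableSet_Ioi] with τ hτ
    have h0 : 0 < τ := ht.trans hτ
    rw [Real.norm_of_nonneg (by positivity)]
    exact b2 τ hτ
  refine ⟨by rw [hu]; exact j1.union j2, ?_⟩
  rw [hu, setIntegral_union Ioc_disjoint_Ioi_same measurableSet_Ioi j1 j2, add_mul]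
  refine add_le_add ?_ ?_
  · refine (setIntegral_mono_on j1 i1 measurableSet_Ioc b1).trans_eq ?_
    rw [integral_mul_const, ← intervalIntegral.integral_of_le ht.le,
      integral_rpow (Or.inl (by linarith)), sub_add_cancel, Real.zero_rpow (by linarith), sub_zero,
      div_mul_eq_mul_div, ← Real.rpow_add ht, one_div, inv_mul_eq_div]
    congr 2
    ring
  · refine (setIntegral_mono_on j2 i2 measurableSet_Ioi b2).trans_eq ?_
    rw [integral_Ioi_rpow_of_lt (by linarith) ht]
    simp only [sub_add_cancel]
    field_simp

/-- The Oseen symbol is a superposition of symbols of derivatives of heat kernels. -/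
theorem oseenSymbol_eq {α : ℝ} (hα : 0 < α) (t : ℝ) (i j k : Fin n) {ξ : Vec n} (hξ : ξ ≠ 0) :
    oseenSymbol α t i j k ξ = (if i = j then 1 else 0) *
      (dirSymbol [basisVec k] ξ * heatSymbol α t ξ) +
      ((Real.Gamma (1 / α))⁻¹ : ℝ) * ∫ τ in Ioi (0 : ℝ), ((τ ^ (1 / α - 1) : ℝ) : ℂ) *
        (dirSymbol [basisVec i, basisVec j, basisVec k] ξ * heatSymbol α (t + τ) ξ) := by
  have hn : 0 < ‖ξ‖ := norm_pos_iff.2 hξ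
  have hX : 0 < (2 * Real.pi * ‖ξ‖) ^ (2 * α) := by positivity
  have hΓ : 0 < Real.Gamma (1 / α) := Real.Gamma_pos_of_pos (by positivity)
  have h1 : ∀ τ : ℝ, ((τ ^ (1 / α - 1) : ℝ) : ℂ) *
      (dirSymbol [basisVec i, basisVec j, basisVec k] ξ * heatSymbol α (t + τ) ξ) =
      (dirSymbol [basisVec i, basisVec j, basisVec k] ξ * heatSymbol α t ξ) *
        ((τ ^ (1 / α - 1) * Real.exp (-((2 * Real.pi * ‖ξ‖) ^ (2 * α) * τ)) : ℝ) : ℂ) := by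
    intro τ
    rw [heatSymbol_add]
    have : heatSymbol α τ ξ = ((Real.exp (-((2 * Real.pi * ‖ξ‖) ^ (2 * α) * τ)) : ℝ) : ℂ) := by
      rw [heatSymbol, mul_comm τ]
    rw [this]
    push_cast
    ring
  simp only [h1]
  rw [integral_const_mul, integral_complex_ofReal,
    Real.integral_rpow_mul_exp_neg_mul_Ioi (by positivity) hX]
  -- The Gamma integral with exponent 1/α inverts |2πξ|^(2α) to the power 1/α, that is, |2πξ|².
  -- Since the three derivatives contribute (2πi)³ = -(2π)²·2πi, adding the integral produces the
  -- minus sign of the Leray projection.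
  have h2 : (1 / (2 * Real.pi * ‖ξ‖) ^ (2 * α)) ^ (1 / α) = ((2 * Real.pi * ‖ξ‖) ^ 2)⁻¹ := by
    rw [one_div, Real.inv_rpow hX.le, ← Real.rpow_mul (by positivity)]
    congr 1
    rw [show 2 * α * (1 / α) = 2 by field_simp, Real.rpow_two]
  rw [h2]
  have hb : ∀ i : Fin n, inner ℝ (basisVec i : Vec n) ξ = ξ i := fun i => by
    simp [basisVec, EuclideanSpace.inner_single_left]
  simp only [oseenSymbol, dirSymbol_cons, dirSymbol_nil, hb]
  have hΓ' : (Real.Gamma (1 / α) : ℂ) ≠ 0 := by exact_mod_cast hΓ.ne'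
  have hn' : (‖ξ‖ : ℂ) ≠ 0 := by exact_mod_cast hn.ne'
  have hπ : (Real.pi : ℂ) ≠ 0 := by exact_mod_cast Real.pi_ne_zero
  have hI : Complex.I ^ 2 = -1 := Complex.I_sq
  push_cast
  split_ifs
  · simp only [Complex.ofReal_one]
    field_simp
    ring_nf
    rw [hI]
    ring
  · simp only [Complex.ofReal_zero]
    field_simp
    ring_nf
    rw [hI]
    ring

/-- The projection is of order zero and singular at ξ = 0, but combined with a derivative it becomes
an integral over τ of third derivatives of heat kernels at time t + τ, with weight τ^(2p-1). Their
L¹ norms (t+τ)^(-3p) decay fast enough for the integral to converge, with value of order t^(-p). -/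
theorem l1Le_oseenKernel [NeZero n] {α : ℝ} (hα : 0 < α) (i j k : Fin n) :
    ∃ D, 0 ≤ D ∧ ∀ t, 0 < t → L1Le (oseenKernel α t i j k) (D * t ^ (-(1 / (2 * α)) : ℝ)) := by
  have := nontrivial_vec (n := n)
  obtain ⟨D₁, hD₁, h1⟩ := l1Le_heatDeriv hα [(basisVec k : Vec n)]
  set l₃ : List (Vec n) := [basisVec i, basisVec j, basisVec k] with hl₃
  obtain ⟨D₃, hD₃, h3⟩ := l1Le_heatDeriv hα l₃
  set p := 1 / (2 * α) with hp
  have hp0 : 0 < p := by positivity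
  have hΓ : 0 < Real.Gamma (1 / α) := Real.Gamma_pos_of_pos (by positivity)
  have h2p : 1 / α = 2 * p := by rw [hp]; field_simp
  refine ⟨D₁ + (Real.Gamma (1 / α))⁻¹ * (D₃ * (1 / (2 * p) + 1 / p)), by positivity,
    fun t ht => ?_⟩
  let m : ℝ → Vec n → ℂ := fun τ ξ =>
    ((τ ^ (1 / α - 1) : ℝ) : ℂ) * (dirSymbol l₃ ξ * heatSymbol α (t + τ) ξ)
  have hm : StronglyMeasurable (Function.uncurry m) := by
    have e1 : Measurable fun p : ℝ × Vec n => heatSymbol α (t + p.1) p.2 := by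
      unfold heatSymbol
      fun_prop
    have e2 : Measurable fun p : ℝ × Vec n => ((p.1 ^ (1 / α - 1) : ℝ) : ℂ) := by fun_prop
    have e3 : Measurable fun p : ℝ × Vec n => dirSymbol l₃ p.2 :=
      (contDiff_dirSymbol l₃).continuous.measurable.comp measurable_snd
    exact (e2.mul (e3.mul e1)).stronglyMeasurable
  have h0 : ∀ᵐ ξ : Vec n, ξ ≠ 0 := by simp [ae_iff]
  have hnm : ∀ ξ : Vec n, ∀ τ ∈ Ioi (0 : ℝ), ‖m τ ξ‖ = ‖dirSymbol l₃ ξ‖ * ‖heatSymbol α t ξ‖ *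
      (τ ^ (1 / α - 1) * Real.exp (-((2 * Real.pi * ‖ξ‖) ^ (2 * α) * τ))) := by
    intro ξ τ hτ
    have hτ0 : (0 : ℝ) < τ := hτ
    simp only [m]
    rw [heatSymbol_add, norm_mul, norm_mul, norm_mul, norm_heatSymbol α τ, Complex.norm_real,
      Real.norm_of_nonneg (by positivity), mul_comm τ]
    ring
  have hint : Integrable (Function.uncurry m) ((volume.restrict (Ioi 0)).prod volume) := by
    rw [integrable_prod_iff' hm.aestronglyMeasurable]
    constructor
    · filter_upwards [h0] with ξ hξ
      have hX : 0 < (2 * Real.pi * ‖ξ‖) ^ (2 * α) := by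
        have := norm_pos_iff.2 hξ; positivity
      have hi := (integrableOn_rpow_mul_exp_neg_mul_rpow (p := 1) (s := 1 / α - 1)
        (b := (2 * Real.pi * ‖ξ‖) ^ (2 * α)) (by have : 0 < 1 / α := by positivity
                                                 linarith) one_pos hX).const_mul
        (‖dirSymbol l₃ ξ‖ * ‖heatSymbol α t ξ‖)
      have hmξ : StronglyMeasurable fun τ => m τ ξ :=
        hm.comp_measurable (by fun_prop : Measurable fun τ : ℝ => (τ, ξ))
      refine Integrable.mono' hi hmξ.aestronglyMeasurable ?_
      filter_upwards [ae_restrict_mem measurableSet_Ioi] with τ hτ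
      change ‖m τ ξ‖ ≤ _
      rw [hnm ξ τ hτ, Real.rpow_one]
      exact le_of_eq (by ring_nf)
    -- Integrating in τ first produces |ξ|^{-2}, which the three derivative factors compensate,
    -- leaving a single power of |ξ|.
    · have hi := (integrable_pow_mul_heatSymbol (n := n) hα ht 1).const_mul
        (2 * Real.pi * normProd l₃ * Real.Gamma (1 / α))
      refine Integrable.mono' hi
        (hm.norm.integral_prod_left' (μ := volume.restrict (Ioi 0))).aestronglyMeasurable ?_
      filter_upwards [h0] with ξ hξ
      have hn0 : 0 < ‖ξ‖ := norm_pos_iff.2 hξ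
      have hX : 0 < (2 * Real.pi * ‖ξ‖) ^ (2 * α) := by positivity
      rw [Real.norm_of_nonneg (integral_nonneg fun _ => norm_nonneg _)]
      have e : ∫ τ in Ioi (0 : ℝ), ‖Function.uncurry m (τ, ξ)‖ =
          ‖dirSymbol l₃ ξ‖ * ‖heatSymbol α t ξ‖ *
            (((2 * Real.pi * ‖ξ‖) ^ 2)⁻¹ * Real.Gamma (1 / α)) := by
        change ∫ τ in Ioi (0 : ℝ), ‖m τ ξ‖ = _
        rw [setIntegral_congr_fun measurableSet_Ioi (hnm ξ), integral_const_mul,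
          Real.integral_rpow_mul_exp_neg_mul_Ioi (by positivity) hX]
        congr 2
        rw [one_div ((2 * Real.pi * ‖ξ‖) ^ (2 * α)), Real.inv_rpow hX.le,
          ← Real.rpow_mul (by positivity)]
        congr 1
        rw [show 2 * α * (1 / α) = 2 by field_simp, Real.rpow_two]
      rw [e]
      have h4 := norm_dirSymbol_le l₃ ξ
      have h5 : l₃.length = 3 := rfl
      rw [h5] at h4
      calc _ ≤ (2 * Real.pi * ‖ξ‖) ^ 3 * normProd l₃ * ‖heatSymbol α t ξ‖ *
            (((2 * Real.pi * ‖ξ‖) ^ 2)⁻¹ * Real.Gamma (1 / α)) := by gcongr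
        _ = _ := by field_simp
  have hI := integral_rpow_mul_add_rpow hp0 ht
  have hle : ∀ τ : ℝ, (t + τ) ^ (-((l₃.length : ℝ) / (2 * α)) : ℝ) = (t + τ) ^ (-(3 * p)) := by
    intro τ
    congr 1
    rw [hl₃, hp]
    simp
    ring
  have key := L1Le.fourierInv_integral (μ := volume.restrict (Ioi 0)) hm hint
    (b := fun τ => D₃ * (τ ^ (2 * p - 1) * (t + τ) ^ (-(3 * p)))) (hI.1.const_mul D₃) (by
      filter_upwards [ae_restrict_mem measurableSet_Ioi] with τ hτ
      have hτ0 : (0 : ℝ) < τ := hτ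
      have h4 := (h3 (t + τ) (by positivity)).const_mul ((τ ^ (1 / α - 1) : ℝ) : ℂ)
      rw [hle, Complex.norm_real, Real.norm_of_nonneg (by positivity)] at h4
      have e : 𝓕⁻ (m τ) = fun x => ((τ ^ (1 / α - 1) : ℝ) : ℂ) * heatDeriv α (t + τ) l₃ x :=
        funext fun x => fourierInv_const_mul _ _ x
      rw [e]
      refine h4.mono (le_of_eq ?_)
      rw [h2p]
      ring)
  have key2 := (key.const_mul (((Real.Gamma (1 / α))⁻¹ : ℝ) : ℂ))
  have hmi : Integrable fun ξ => ∫ τ in Ioi (0 : ℝ), m τ ξ := hint.integral_prod_right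
  have key3 := ((h1 t ht).const_mul (if i = j then 1 else 0)).add key2
  have e : oseenKernel α t i j k = fun x => (if i = j then (1 : ℂ) else 0) *
      heatDeriv α t [(basisVec k : Vec n)] x + (((Real.Gamma (1 / α))⁻¹ : ℝ) : ℂ) *
        𝓕⁻ (fun ξ => ∫ τ in Ioi (0 : ℝ), m τ ξ) x := by
    funext x
    have h4 : oseenKernel α t i j k = 𝓕⁻ (oseenSymbol α t i j k) := rfl
    have h5 : oseenSymbol α t i j k =ᵐ[volume] fun ξ => (if i = j then 1 else 0) *
        (dirSymbol [basisVec k] ξ * heatSymbol α t ξ) +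
        (((Real.Gamma (1 / α))⁻¹ : ℝ) : ℂ) * ∫ τ in Ioi (0 : ℝ), m τ ξ := by
      filter_upwards [h0] with ξ hξ
      exact oseenSymbol_eq hα t i j k hξ
    rw [h4, fourierInv_congr_ae h5, fourierInv_add
      ((integrable_dirSymbol_mul_heatSymbol hα ht _).const_mul _) (hmi.const_mul _),
      fourierInv_const_mul, fourierInv_const_mul]
    rfl
  rw [e]
  refine key3.mono ?_
  rw [Complex.norm_real, Real.norm_of_nonneg (by positivity), integral_const_mul]
  have h6 : ‖(if i = j then (1 : ℂ) else 0)‖ ≤ 1 := by split_ifs <;> simp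
  have h7 : (-(([(basisVec k : Vec n)].length : ℝ) / (2 * α)) : ℝ) = -p := by rw [hp]; simp
  rw [h7]
  calc _ ≤ 1 * (D₁ * t ^ (-p)) + (Real.Gamma (1 / α))⁻¹ * (D₃ * ((1 / (2 * p) + 1 / p) *
        t ^ (-p))) := by
        gcongr
        exact hI.2
    _ = _ := by ring

/-- The Oseen kernel is analytic in a strip of width proportional to `t^{1/(2α)}`. -/
theorem exists_oseen_bound [NeZero n] {α : ℝ} (hα : 1 / 2 < α) :
    ∃ δ A : ℝ, 0 < δ ∧ 0 ≤ A ∧ ∀ t, 0 < t → ∀ i j k : Fin n,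
      KernelBound volume (δ * t ^ (1 / (2 * α))) (A * t ^ (-(1 / (2 * α)) : ℝ))
        (oseenDeriv α t i j k) := by
  have hα0 : 0 < α := by linarith
  obtain ⟨δ, A, hδ, hA, h⟩ := exists_heatDeriv_bound (n := n) hα
  choose D hD hO using fun i j k : Fin n => l1Le_oseenKernel hα0 i j k
  set p := 1 / (2 * α) with hp
  have hp0 : 0 < p := by positivity
  set D' := ∑ i, ∑ j, ∑ k, D i j k with hD'
  have hD'0 : 0 ≤ D' := Finset.sum_nonneg fun i _ => Finset.sum_nonneg fun j _ =>
    Finset.sum_nonneg fun k _ => hD i j k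
  have hDle : ∀ i j k, D i j k ≤ D' := by
    intro i j k
    calc D i j k ≤ ∑ k, D i j k :=
          Finset.single_le_sum (f := fun k => D i j k) (fun k _ => hD i j k) (Finset.mem_univ k)
      _ ≤ ∑ j, ∑ k, D i j k := Finset.single_le_sum (f := fun j => ∑ k, D i j k)
          (fun j _ => Finset.sum_nonneg fun k _ => hD i j k) (Finset.mem_univ j)
      _ ≤ D' := Finset.single_le_sum (f := fun i => ∑ j, ∑ k, D i j k)
          (fun i _ => Finset.sum_nonneg fun j _ => Finset.sum_nonneg fun k _ => hD i j k)
          (Finset.mem_univ i)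
  refine ⟨δ * (1 / 2) ^ p, A * (D' * (1 / 2) ^ (-p)), by positivity, by positivity,
    fun t ht i j k => ?_⟩
  have ht2 : 0 < t / 2 := by positivity
  -- With S(t) = S(t/2)S(t/2), all additional derivatives are put on a heat kernel and the other
  -- factor is an Oseen kernel without them. The halved time accounts for the factors (1/2)^p in the
  -- radius and (1/2)^(-p) in the amplitude.
  have key : ∀ l, L1Le (oseenDeriv α t i j k l)
      (A * anaWeight (δ * (t / 2) ^ p) l.length * normProd l * (D i j k * (t / 2) ^ (-p))) := by
    intro l
    have h1 := L1Le.fourierInv_mul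
      ((contDiff_dirSymbol l).continuous.mul (continuous_heatSymbol hα0 (t / 2)))
      (integrable_dirSymbol_mul_heatSymbol hα0 ht2 l) (h (t / 2) ht2 l)
      (integrable_oseenSymbol hα0 ht2 i j k) (hO i j k (t / 2) ht2)
    have e : oseenDeriv α t i j k l = 𝓕⁻ (fun ξ =>
        (dirSymbol l ξ * heatSymbol α (t / 2) ξ) * oseenSymbol α (t / 2) i j k ξ) := by
      rw [oseenDeriv]
      congr 1
      funext ξ
      have h2 : heatSymbol α t ξ = heatSymbol α (t / 2) ξ * heatSymbol α (t / 2) ξ := by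
        rw [← heatSymbol_add, add_halves]
      rw [oseenSymbol, oseenSymbol, h2]
      ring
    rw [e]
    exact h1
  have e1 : δ * (t / 2) ^ p = δ * (1 / 2) ^ p * t ^ p := by
    rw [mul_assoc, ← Real.mul_rpow (by norm_num) ht.le]; congr 2; ring
  have e2 : (t / 2) ^ (-p) = (1 / 2) ^ (-p) * t ^ (-p) := by
    rw [← Real.mul_rpow (by norm_num) ht.le]; congr 1; ring
  refine ⟨isJet_oseenDeriv hα0 ht i j k, fun l => (key l).1, fun l => (key l).2.trans ?_⟩
  rw [e1, e2]
  have h3 : 0 ≤ anaWeight (δ * (1 / 2) ^ p * t ^ p) l.length := (anaWeight_pos (by positivity) _).le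
  have h4 := normProd_nonneg l
  calc _ ≤ A * anaWeight (δ * (1 / 2) ^ p * t ^ p) l.length * normProd l *
        (D' * ((1 / 2) ^ (-p) * t ^ (-p))) := by gcongr; exact hDle i j k
    _ = _ := by ring

end Oseen

end FracNS

namespace FracNS

/-! ### Fourier multipliers and convolutions -/

section Multiplier

variable {n : ℕ}

/-- The Banach space of `N`-jets of smooth functions on a closed ball. -/
def JetSpace (n N : ℕ) (R : ℝ) : Type :=
  (l : Fin (N + 1)) → C(Metric.closedBall (0 : Vec n) R, (Vec n) [×(l : ℕ)]→L[ℝ] ℂ)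

noncomputable instance (n N : ℕ) (R : ℝ) : NormedAddCommGroup (JetSpace n N R) :=
  inferInstanceAs (NormedAddCommGroup ((l : Fin (N + 1)) →
    C(Metric.closedBall (0 : Vec n) R, (Vec n) [×(l : ℕ)]→L[ℝ] ℂ)))

noncomputable instance (n N : ℕ) (R : ℝ) : NormedSpace ℂ (JetSpace n N R) :=
  inferInstanceAs (NormedSpace ℂ ((l : Fin (N + 1)) →
    C(Metric.closedBall (0 : Vec n) R, (Vec n) [×(l : ℕ)]→L[ℝ] ℂ)))

instance (n N : ℕ) (R : ℝ) : CompleteSpace (JetSpace n N R) :=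
  inferInstanceAs (CompleteSpace ((l : Fin (N + 1)) →
    C(Metric.closedBall (0 : Vec n) R, (Vec n) [×(l : ℕ)]→L[ℝ] ℂ)))

/-- The `N`-jet of a Schwartz function on a closed ball. -/
noncomputable def jetMap (N : ℕ) (R : ℝ) : 𝓢(Vec n, ℂ) →ₗ[ℂ] JetSpace n N R where
  toFun φ l := ⟨fun ξ => iteratedFDeriv ℝ l φ ξ,
    ((φ.smooth l).continuous_iteratedFDeriv le_rfl).comp continuous_subtype_val⟩
  map_add' φ ψ := by
    refine funext fun l => ContinuousMap.ext fun ξ => ContinuousMultilinearMap.ext fun v => ?_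
    exact congrArg (· v) (iteratedFDeriv_add_apply (φ.smooth l).contDiffAt (ψ.smooth l).contDiffAt)
  map_smul' c φ := by
    refine funext fun l => ContinuousMap.ext fun ξ => ContinuousMultilinearMap.ext fun v => ?_
    exact congrArg (· v) (iteratedFDeriv_const_smul_apply (a := c) (φ.smooth l).contDiffAt)

theorem JetSpace.norm_apply_le {N : ℕ} {R : ℝ} (J : JetSpace n N R) (l : Fin (N + 1))
    (ξ : Metric.closedBall (0 : Vec n) R) : ‖J l ξ‖ ≤ ‖J‖ :=
  ((J l).norm_coe_le_norm ξ).trans (norm_le_pi_norm (f := J) l)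

theorem JetSpace.norm_le {N : ℕ} {R : ℝ} {J : JetSpace n N R} {B : ℝ} (hB : 0 ≤ B)
    (h : ∀ l ξ, ‖J l ξ‖ ≤ B) : ‖J‖ ≤ B :=
  (pi_norm_le_iff_of_nonneg hB).2 fun l => (ContinuousMap.norm_le _ hB).2 fun ξ => h l ξ

/-- The evaluation of a jet. -/
noncomputable def jetEval {N : ℕ} {R : ℝ} (l : Fin (N + 1)) (ξ : Metric.closedBall (0 : Vec n) R)
    (w : Fin l → Vec n) : JetSpace n N R →L[ℂ] ℂ :=
  LinearMap.mkContinuous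
    { toFun := fun J => J l ξ w
      map_add' := fun _ _ => rfl
      map_smul' := fun _ _ => rfl } (∏ i, ‖w i‖) fun J => by
    rw [mul_comm]
    exact ((J l ξ).le_opNorm w).trans
      (mul_le_mul_of_nonneg_right (J.norm_apply_le l ξ) (by positivity))

theorem norm_iteratedFDeriv_le_jetMap {N l : ℕ} (hl : l ≤ N) {R : ℝ} (φ : 𝓢(Vec n, ℂ))
    {ξ : Vec n} (hξ : ξ ∈ Metric.closedBall (0 : Vec n) R) :
    ‖iteratedFDeriv ℝ l φ ξ‖ ≤ ‖jetMap N R φ‖ :=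
  (jetMap N R φ).norm_apply_le ⟨l, by omega⟩ ⟨ξ, hξ⟩

/-- A tempered distribution has finite order on a ball. -/
theorem exists_norm_le_jetMap (T : 𝓢'(Vec n, ℂ)) {R : ℝ} (hR : 0 ≤ R) :
    ∃ (N : ℕ) (C : ℝ), 0 ≤ C ∧ ∀ φ : 𝓢(Vec n, ℂ),
      (∀ ξ, ξ ∉ Metric.closedBall (0 : Vec n) R → φ ξ = 0) → ‖T φ‖ ≤ C * ‖jetMap N R φ‖ := by
  have hq : Continuous ((normSeminorm ℂ ℂ).comp T.toLinearMap) :=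
    continuous_norm.comp T.continuous
  obtain ⟨s, C, -, hle⟩ := Seminorm.bound_of_continuous (schwartz_withSeminorms ℂ (Vec n) ℂ) _ hq
  refine ⟨s.sup Prod.snd, C * ∑ i ∈ s, R ^ i.1, by positivity, fun φ hφ => ?_⟩
  set N := s.sup Prod.snd
  -- On functions supported in the ball the polynomial weights of the Schwartz seminorms are bounded
  -- by powers of R, so the jet norm controls the finitely many seminorms that bound T.
  have h1 : ∀ i ∈ s, schwartzSeminormFamily ℂ (Vec n) ℂ i φ ≤ R ^ i.1 * ‖jetMap N R φ‖ := by
    intro i hi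
    refine SchwartzMap.seminorm_le_bound ℂ i.1 i.2 φ (by positivity) fun ξ => ?_
    by_cases hξ : ξ ∈ Metric.closedBall (0 : Vec n) R
    · have h2 := norm_iteratedFDeriv_le_jetMap (Finset.le_sup (f := Prod.snd) hi) φ hξ
      have h3 : ‖ξ‖ ≤ R := by simpa using hξ
      gcongr
    · have h2 : (φ : Vec n → ℂ) =ᶠ[𝓝 ξ] fun _ => 0 := by
        filter_upwards [Metric.isClosed_closedBall.isOpen_compl.mem_nhds hξ] with y hy
        exact hφ y hy
      have h3 : iteratedFDeriv ℝ i.2 φ ξ = iteratedFDeriv ℝ i.2 (fun _ : Vec n => (0 : ℂ)) ξ :=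
        (Filter.EventuallyEq.iteratedFDeriv ℝ h2 i.2).eq_of_nhds
      have h4 : iteratedFDeriv ℝ i.2 (fun _ : Vec n => (0 : ℂ)) ξ = 0 := by simp
      rw [h3, h4, norm_zero, mul_zero]
      positivity
  have h2 := hle φ
  have h3 : s.sup (schwartzSeminormFamily ℂ (Vec n) ℂ) φ ≤ ∑ i ∈ s, R ^ i.1 * ‖jetMap N R φ‖ := by
    refine Seminorm.finset_sup_apply_le (Finset.sum_nonneg fun i _ => by positivity)
      fun i hi => (h1 i hi).trans ?_
    exact Finset.single_le_sum (f := fun i : ℕ × ℕ => R ^ i.1 * ‖jetMap N R φ‖)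
      (fun i _ => by positivity) hi
  rw [← Finset.sum_mul] at h3
  calc ‖T φ‖ ≤ C * s.sup (schwartzSeminormFamily ℂ (Vec n) ℂ) φ := h2
    _ ≤ C * ((∑ i ∈ s, R ^ i.1) * ‖jetMap N R φ‖) := by gcongr
    _ = _ := by ring

/-- The test function `e^{2πi⟪x, ·⟫} m`. -/
noncomputable def waveTest {m : Vec n → ℂ} (hc : HasCompactSupport m) (hm : ContDiff ℝ ∞ m)
    (x : Vec n) : 𝓢(Vec n, ℂ) :=
  (hasCompactSupport_wave_mul hc x).toSchwartzMap (contDiff_wave_mul hm x)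

theorem waveTest_apply {m : Vec n → ℂ} (hc : HasCompactSupport m) (hm : ContDiff ℝ ∞ m)
    (x ξ : Vec n) : waveTest hc hm x ξ = wave x ξ * m ξ := rfl

theorem multiplierFun_eq {m : Vec n → ℂ} (hc : HasCompactSupport m) (hm : ContDiff ℝ ∞ m)
    (v : 𝓢'(Vec n, ℂ)) (x : Vec n) : multiplierFun m v x = (𝓕 v) (waveTest hc hm x) := by
  rw [multiplierFun, dif_pos ⟨hc, hm⟩]
  rfl

theorem contDiff_wave_uncurry : ContDiff ℝ ∞ fun p : Vec n × Vec n => wave p.1 p.2 := by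
  unfold wave
  have h : ContDiff ℝ ∞ (fun p : Vec n × Vec n => ((inner ℝ p.1 p.2 : ℝ) : ℂ)) :=
    Complex.ofRealCLM.contDiff.comp (contDiff_fst.inner ℝ contDiff_snd)
  exact ((contDiff_const.mul h).mul contDiff_const).cexp

/-- The derivatives in ξ are restrictions of derivatives of a function smooth in (x, ξ) jointly. A
jointly continuous function on a product with the compact ball depends continuously on x in the
uniform norm, by currying. -/
theorem continuous_jetMap_waveTest {m : Vec n → ℂ} (hc : HasCompactSupport m)
    (hm : ContDiff ℝ ∞ m) (N : ℕ) (R : ℝ) :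
    Continuous fun x => jetMap N R (waveTest hc hm x) := by
  refine continuous_pi fun l => ?_
  set F : Vec n × Vec n → ℂ := fun p => wave p.1 p.2 * m p.2 with hF
  have hFd : ContDiff ℝ ∞ F := contDiff_wave_uncurry.mul (hm.comp contDiff_snd)
  have key : ∀ x ξ : Vec n, iteratedFDeriv ℝ l (waveTest hc hm x) ξ =
      (iteratedFDeriv ℝ l F (x, ξ)).compContinuousLinearMap
        fun _ => ContinuousLinearMap.inr ℝ (Vec n) (Vec n) := by
    intro x ξ
    have e : (waveTest hc hm x : Vec n → ℂ) =
        (fun p => F (p + (x, 0))) ∘ ContinuousLinearMap.inr ℝ (Vec n) (Vec n) := by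
      funext ξ
      simp [hF, waveTest_apply]
    have hFx : ContDiff ℝ ∞ fun p => F (p + (x, 0)) := hFd.comp (contDiff_id.add contDiff_const)
    rw [e, ContinuousLinearMap.iteratedFDeriv_comp_right _ hFx ξ (i := l)
      (by exact_mod_cast le_top),
      iteratedFDeriv_comp_add_right]
    simp
  have hcont : Continuous fun p : Vec n × Metric.closedBall (0 : Vec n) R =>
      iteratedFDeriv ℝ l (waveTest hc hm p.1) p.2 := by
    simp only [key]
    have h1 : Continuous fun p : Vec n × Metric.closedBall (0 : Vec n) R =>
        iteratedFDeriv ℝ l F (p.1, p.2) :=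
      (hFd.continuous_iteratedFDeriv (m := l) (by exact_mod_cast le_top)).comp (by fun_prop)
    exact (ContinuousMultilinearMap.compContinuousLinearMapL
      (fun _ : Fin l => ContinuousLinearMap.inr ℝ (Vec n) (Vec n))).continuous.comp h1
  exact (ContinuousMap.curry ⟨_, hcont⟩).continuous

theorem contDiff_wave_right (x : Vec n) : ContDiff ℝ ∞ fun ξ => wave x ξ := by
  unfold wave
  have h : ContDiff ℝ ∞ (fun ξ : Vec n => ((inner ℝ x ξ : ℝ) : ℂ)) :=
    Complex.ofRealCLM.contDiff.comp (contDiff_const.inner ℝ contDiff_id)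
  exact ((contDiff_const.mul h).mul contDiff_const).cexp

theorem norm_iteratedFDeriv_wave_le (x ξ : Vec n) (k : ℕ) :
    ‖iteratedFDeriv ℝ k (fun ξ => wave x ξ) ξ‖ ≤ (2 * Real.pi * ‖x‖) ^ k := by
  have hJ := isJet_wave_mul 1 x
  have e : (fun ξ => wave x ξ) = fun ξ => wave ξ x * (dirSymbol [] x * 1) := by
    funext ξ; simp [wave_comm]
  refine ContinuousMultilinearMap.opNorm_le_bound (by positivity) fun v => ?_
  rw [e, hJ.iteratedFDeriv_apply, norm_mul, norm_wave, one_mul, mul_one, ← normProd_ofFn]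
  simpa using norm_dirSymbol_le (List.ofFn v) x

theorem norm_iteratedFDeriv_mul_le_of_le {f g : Vec n → ℂ} (hf : ContDiff ℝ ∞ f)
    (hg : ContDiff ℝ ∞ g) {l : ℕ} {ξ : Vec n} {A B : ℝ}
    (hA : ∀ i ≤ l, ‖iteratedFDeriv ℝ i f ξ‖ ≤ A) (hB : ∀ i ≤ l, ‖iteratedFDeriv ℝ i g ξ‖ ≤ B) :
    ‖iteratedFDeriv ℝ l (fun ξ => f ξ * g ξ) ξ‖ ≤ 2 ^ l * (A * B) := by
  refine (norm_iteratedFDeriv_mul_le hf hg ξ (n := l) (by exact_mod_cast le_top)).trans ?_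
  have hA0 : 0 ≤ A := (norm_nonneg _).trans (hA 0 (Nat.zero_le _))
  have h : ∀ i ∈ Finset.range (l + 1),
      (l.choose i : ℝ) * ‖iteratedFDeriv ℝ i f ξ‖ * ‖iteratedFDeriv ℝ (l - i) g ξ‖ ≤
        (l.choose i : ℝ) * (A * B) := by
    intro i hi
    have hi' : i ≤ l := by simpa [Nat.lt_succ_iff] using hi
    rw [mul_assoc]
    exact mul_le_mul_of_nonneg_left
      (mul_le_mul (hA i hi') (hB _ (Nat.sub_le _ _)) (norm_nonneg _) hA0) (Nat.cast_nonneg _)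
  refine (Finset.sum_le_sum h).trans_eq ?_
  rw [← Finset.sum_mul, ← Nat.cast_sum, Nat.sum_range_choose]
  push_cast
  rfl

theorem exists_norm_iteratedFDeriv_waveTest_le {m : Vec n → ℂ} (hc : HasCompactSupport m)
    (hm : ContDiff ℝ ∞ m) (N : ℕ) : ∃ B, 0 ≤ B ∧ ∀ l ≤ N, ∀ x ξ,
      ‖iteratedFDeriv ℝ l (waveTest hc hm x) ξ‖ ≤ B * (1 + 2 * Real.pi * ‖x‖) ^ N := by
  have h : ∀ j : ℕ, ∃ B, ∀ ξ, ‖iteratedFDeriv ℝ j m ξ‖ ≤ B := fun j =>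
    (hm.continuous_iteratedFDeriv (m := j)
      (by exact_mod_cast le_top)).bounded_above_of_compact_support (hc.iteratedFDeriv j)
  choose B hB using h
  have hB0 : ∀ j, 0 ≤ B j := fun j => (norm_nonneg _).trans (hB j 0)
  set S := ∑ j ∈ Finset.range (N + 1), B j with hS
  have hS0 : 0 ≤ S := Finset.sum_nonneg fun j _ => hB0 j
  refine ⟨2 ^ N * S, mul_nonneg (by positivity) hS0, fun l hl x ξ => ?_⟩
  have h1 := contDiff_wave_right x
  have hx : (1 : ℝ) ≤ 1 + 2 * Real.pi * ‖x‖ := by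
    have : 0 ≤ 2 * Real.pi * ‖x‖ := by positivity
    linarith
  have h3 : ∀ i ≤ l, ‖iteratedFDeriv ℝ i (fun ξ => wave x ξ) ξ‖ ≤ (1 + 2 * Real.pi * ‖x‖) ^ N := by
    intro i hi
    refine (norm_iteratedFDeriv_wave_le x ξ i).trans ?_
    exact (pow_le_pow_left₀ (by positivity) (by linarith) i).trans
      (pow_le_pow_right₀ hx (hi.trans hl))
  have h4 : ∀ i ≤ l, ‖iteratedFDeriv ℝ i m ξ‖ ≤ S := fun i hi =>
    (hB _ ξ).trans (Finset.single_le_sum (f := B) (fun j _ => hB0 j)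
      (Finset.mem_range.2 (by omega)))
  have h5 := norm_iteratedFDeriv_mul_le_of_le h1 hm h3 h4
  have h6 : (2 : ℝ) ^ l ≤ 2 ^ N := pow_le_pow_right₀ one_le_two hl
  have h7 : 0 ≤ (1 + 2 * Real.pi * ‖x‖) ^ N * S := by positivity
  refine (h5.trans (mul_le_mul_of_nonneg_right h6 h7)).trans_eq ?_
  ring

theorem exists_support_radius {m : Vec n → ℂ} (hc : HasCompactSupport m) :
    ∃ R, 0 ≤ R ∧ ∀ ξ, ξ ∉ Metric.closedBall (0 : Vec n) R → m ξ = 0 := by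
  obtain ⟨R, hR⟩ := hc.isCompact.isBounded.subset_closedBall (0 : Vec n)
  refine ⟨max R 0, le_max_right _ _, fun ξ hξ => image_eq_zero_of_notMem_tsupport fun h => hξ ?_⟩
  exact Metric.closedBall_subset_closedBall (le_max_left _ _) (hR h)

/-- The test functions all live in one ball, where the distribution has finite order, and their jets
depend continuously on x. -/
theorem continuous_multiplierFun {m : Vec n → ℂ} (hc : HasCompactSupport m)
    (hm : ContDiff ℝ ∞ m) (v : 𝓢'(Vec n, ℂ)) : Continuous (multiplierFun m v) := by
  obtain ⟨R, hR, hRs⟩ := exists_support_radius hc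
  obtain ⟨N, C, hC, hT⟩ := exists_norm_le_jetMap (𝓕 v) hR
  have hJ := continuous_jetMap_waveTest hc hm N R
  simp only [funext (multiplierFun_eq hc hm v)]
  rw [continuous_iff_continuousAt]
  intro x
  rw [ContinuousAt, tendsto_iff_norm_sub_tendsto_zero]
  have h0 : Tendsto (fun y => C * ‖jetMap N R (waveTest hc hm y) - jetMap N R (waveTest hc hm x)‖)
      (𝓝 x) (𝓝 0) := by
    have h1 : Continuous fun y => C * ‖jetMap N R (waveTest hc hm y) -
        jetMap N R (waveTest hc hm x)‖ := continuous_const.mul (hJ.sub continuous_const).norm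
    exact h1.tendsto' x 0 (by rw [sub_self, norm_zero (E := JetSpace n N R), mul_zero])
  refine squeeze_zero (fun _ => norm_nonneg _) (fun y => ?_) h0
  rw [← map_sub, ← map_sub]
  refine hT _ fun ξ hξ => ?_
  simp [waveTest_apply, hRs ξ hξ]

theorem integrable_pow_mul_fourierInv {q : Vec n → ℂ} (hqc : HasCompactSupport q)
    (hq : ContDiff ℝ ∞ q) (N : ℕ) :
    Integrable fun y : Vec n => (1 + ‖y‖) ^ N * ‖𝓕⁻ q y‖ := by
  set ψ : 𝓢(Vec n, ℂ) := 𝓕⁻ (hqc.toSchwartzMap hq) with hψ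
  have e : ∀ y, ψ y = 𝓕⁻ q y := fun y => by rw [hψ, SchwartzMap.fourierInv_coe]; rfl
  have h := (((ψ.integrable_pow_mul volume 0).add (ψ.integrable_pow_mul volume N)).const_mul
    (2 ^ N))
  refine Integrable.mono' h (by
    simp only [← e]
    have := ψ.continuous
    exact Continuous.aestronglyMeasurable (by fun_prop)) (Eventually.of_forall fun y => ?_)
  rw [Real.norm_of_nonneg (by positivity)]
  simp only [Pi.add_apply, pow_zero, one_mul, e]
  have h1 : (1 + ‖y‖) ^ N ≤ 2 ^ N * (1 + ‖y‖ ^ N) := by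
    have h2 : 1 + ‖y‖ ≤ 2 * max 1 ‖y‖ := by
      linarith [le_max_left 1 ‖y‖, le_max_right 1 ‖y‖]
    have h3 : (max 1 ‖y‖) ^ N ≤ 1 + ‖y‖ ^ N := by
      rcases max_choice 1 ‖y‖ with h | h <;> rw [h]
      · rw [one_pow]; linarith [pow_nonneg (norm_nonneg y) N]
      · linarith
    calc _ ≤ (2 * max 1 ‖y‖) ^ N := by gcongr
      _ = 2 ^ N * (max 1 ‖y‖) ^ N := mul_pow _ _ _
      _ ≤ _ := by gcongr
  calc _ ≤ 2 ^ N * (1 + ‖y‖ ^ N) * ‖𝓕⁻ q y‖ := by gcongr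
    _ = _ := by ring

theorem eq_integral_fourierInv_mul_wave {q : Vec n → ℂ} (hqc : HasCompactSupport q)
    (hq : ContDiff ℝ ∞ q) (ξ : Vec n) : q ξ = ∫ y, 𝓕⁻ q y * wave (-y) ξ := by
  have hi : Integrable (𝓕⁻ q) := by
    have h := integrable_pow_mul_fourierInv hqc hq 0
    simp only [pow_zero, one_mul] at h
    exact (integrable_norm_iff (continuous_fourierInv_of_integrable
      (hq.continuous.integrable_of_hasCompactSupport hqc)).aestronglyMeasurable).1 h
  have hf : Integrable (𝓕 q) := by
    refine hi.comp_neg.congr (Eventually.of_forall fun y => ?_)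
    simp [Real.fourierInv_eq_fourier_neg]
  have hinv := hq.continuous.fourier_fourierInv_eq
    (hq.continuous.integrable_of_hasCompactSupport hqc) hf
  rw [← fourier_eq_wave, hinv]

theorem one_add_norm_sub_pow_le (x y : Vec n) (N : ℕ) :
    (1 + 2 * Real.pi * ‖x - y‖) ^ N ≤
      (2 * Real.pi) ^ N * (1 + ‖x‖) ^ N * (1 + ‖y‖) ^ N := by
  rw [← mul_pow, ← mul_pow]
  have h1 := norm_sub_le x y
  have h2 := Real.two_le_pi
  have h3 := mul_nonneg (norm_nonneg x) (norm_nonneg y)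
  have h4 := norm_nonneg x
  have h5 := norm_nonneg y
  refine pow_le_pow_left₀ (by positivity) ?_ N
  calc 1 + 2 * Real.pi * ‖x - y‖ ≤ 2 * Real.pi + 2 * Real.pi * (‖x‖ + ‖y‖) := by
        gcongr
        linarith
    _ ≤ 2 * Real.pi * (1 + ‖x‖) * (1 + ‖y‖) := by nlinarith

/-- The derivatives of `e^{2πi⟪x, ·⟫} q m` are superpositions of those of `e^{2πi⟪y, ·⟫} m`. -/
theorem iteratedFDeriv_waveTest_mul {q m : Vec n → ℂ} (hqc : HasCompactSupport q)
    (hq : ContDiff ℝ ∞ q) (hc : HasCompactSupport m) (hm : ContDiff ℝ ∞ m) (x ξ : Vec n) {l : ℕ}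
    (w : Fin l → Vec n) :
    iteratedFDeriv ℝ l (waveTest (hqc.mul_right (f' := m)) (hq.mul hm) x) ξ w =
      ∫ y, 𝓕⁻ q y * iteratedFDeriv ℝ l (waveTest hc hm (x - y)) ξ w := by
  choose B hB0 hB using fun N => exists_norm_iteratedFDeriv_waveTest_le hc hm N
  have hcont : Continuous (𝓕⁻ q) :=
    continuous_fourierInv_of_integrable (hq.continuous.integrable_of_hasCompactSupport hqc)
  have hJ := isJet_integral (μ := volume)
    (J := fun y l ξ => 𝓕⁻ q y * dirDeriv (waveTest hc hm (x - y)) l ξ)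
    (Eventually.of_forall fun y l ξ => by
      obtain ⟨A, hA, h⟩ := isJet_dirDeriv (waveTest hc hm (x - y)).smooth' l ξ
      refine ⟨_, hA.const_mul _, fun v => ?_⟩
      change 𝓕⁻ q y * A v = _
      rw [h]
      rfl)
    (fun ξ => by
      have h1 : Continuous fun y => wave (x - y) ξ * m ξ :=
        ((continuous_const.sub continuous_id).wave continuous_const).mul continuous_const
      exact (hcont.mul h1).aestronglyMeasurable)
    (B := fun k y => B k * ((2 * Real.pi) ^ k * (1 + ‖x‖) ^ k) * ((1 + ‖y‖) ^ k * ‖𝓕⁻ q y‖))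
    (fun k => (integrable_pow_mul_fourierInv hqc hq k).const_mul _)
    (Eventually.of_forall fun y l ξ => by
      rw [norm_mul]
      have h1 := (FracNS.norm_dirDeriv_le (waveTest hc hm (x - y)).smooth' l ξ).trans
        (mul_le_mul_of_nonneg_right (hB l.length _ le_rfl (x - y) ξ) (normProd_nonneg l))
      have h2 := one_add_norm_sub_pow_le x y l.length
      have h3 := normProd_nonneg l
      have h4 := hB0 l.length
      calc _ ≤ ‖𝓕⁻ q y‖ * (B l.length * ((2 * Real.pi) ^ l.length * (1 + ‖x‖) ^ l.length *
            (1 + ‖y‖) ^ l.length) * normProd l) := by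
            refine mul_le_mul_of_nonneg_left (h1.trans ?_) (norm_nonneg _)
            gcongr
        _ = _ := by ring)
  have e : (waveTest (hqc.mul_right (f' := m)) (hq.mul hm) x : Vec n → ℂ) =
      fun ξ => ∫ y, 𝓕⁻ q y * dirDeriv (waveTest hc hm (x - y)) [] ξ := by
    funext ξ
    have h1 : ∀ y, 𝓕⁻ q y * dirDeriv (waveTest hc hm (x - y)) [] ξ =
        (𝓕⁻ q y * wave (-y) ξ) * (wave x ξ * m ξ) := fun y => by
      change 𝓕⁻ q y * (wave (x - y) ξ * m ξ) = _
      rw [wave_sub]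
      ring
    simp only [h1]
    rw [integral_mul_const, ← eq_integral_fourierInv_mul_wave hqc hq, waveTest_apply]
    change wave x ξ * (q ξ * m ξ) = _
    ring
  rw [e, hJ.iteratedFDeriv_apply]
  refine integral_congr_ae (Eventually.of_forall fun y => ?_)
  exact congrArg (𝓕⁻ q y * ·) (dirDeriv_ofFn (waveTest hc hm (x - y)).smooth' w ξ)

/-- A linear functional commutes with an integral with respect to which it is dominated. -/
theorem linearMap_eq_integral {V E Ω : Type*} [AddCommGroup V] [Module ℂ V]
    [NormedAddCommGroup E] [NormedSpace ℂ E] [CompleteSpace E] [MeasurableSpace Ω] {μ : Measure Ω}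
    (J : V →ₗ[ℂ] E) (T : V →ₗ[ℂ] ℂ) {C : ℝ} (W : Submodule ℂ V)
    (hT : ∀ φ ∈ W, ‖T φ‖ ≤ C * ‖J φ‖) {φ : Ω → V} (hφ : ∀ y, φ y ∈ W) {ψ : Ω → ℂ} (hJi : Integrable (fun y => ψ y • J (φ y)) μ)
    (hTi : Integrable (fun y => ψ y * T (φ y)) μ) {θ : V} (hθW : θ ∈ W)
    (hθ : ∫ y, ψ y • J (φ y) ∂μ = J θ) : T θ = ∫ y, ψ y * T (φ y) ∂μ := by
  -- Γ is the closure of the graph of T over J. The estimate for T on W survives in the closure, so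
  -- Γ is still a graph; the integral can thus be taken in a Banach space although V carries no
  -- norm.
  let Γ : Submodule ℂ (E × ℂ) := (W.map (J.prod T)).topologicalClosure
  have hΓ : ∀ p ∈ Γ, ‖p.2‖ ≤ C * ‖p.1‖ := by
    have hcl : IsClosed {p : E × ℂ | ‖p.2‖ ≤ C * ‖p.1‖} :=
      isClosed_le (by fun_prop) (by fun_prop)
    refine fun p hp => closure_minimal ?_ hcl hp
    rintro _ ⟨φ, hφ, rfl⟩
    exact hT φ hφ
  have hmem : ∀ φ ∈ W, (J φ, T φ) ∈ Γ := fun φ hφ =>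
    Submodule.le_topologicalClosure _ ⟨φ, hφ, rfl⟩
  have hi : Integrable (fun y => (ψ y • J (φ y), ψ y * T (φ y))) μ := hJi.prodMk hTi
  -- By Hahn–Banach, a point outside the closed subspace Γ is separated from it by a functional.
  -- Being bounded above on a subspace, the functional vanishes there, hence on the integral of
  -- Γ-valued functions.
  have hint : (∫ y, (ψ y • J (φ y), ψ y * T (φ y)) ∂μ) ∈ Γ := by
    by_contra hn
    obtain ⟨L, u, hL, hu⟩ := geometric_hahn_banach_closed_point
      (Γ.restrictScalars ℝ).convex (Submodule.isClosed_topologicalClosure _) hn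
    have hu0 : 0 < u := by simpa using hL 0 Γ.zero_mem
    have hL0 : ∀ p ∈ Γ, L p = 0 := by
      intro p hp
      by_contra h
      have h1 := hL (((u / L p : ℝ) : ℂ) • p) (Γ.smul_mem _ hp)
      rw [Complex.coe_smul, map_smul, smul_eq_mul, div_mul_cancel₀ _ h] at h1
      exact lt_irrefl _ h1
    have h1 : ∀ y, L (ψ y • J (φ y), ψ y * T (φ y)) = 0 := fun y =>
      hL0 _ (Γ.smul_mem (ψ y) (hmem (φ y) (hφ y)))
    rw [← L.integral_comp_comm hi] at hu
    simp only [h1, integral_zero] at hu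
    exact lt_asymm hu hu0
  -- Two elements of Γ now have the same first component, so their second components agree.
  rw [integral_pair hJi hTi, hθ] at hint
  have h3 := hΓ _ (Γ.sub_mem hint (hmem θ hθW))
  simp only [Prod.mk_sub_mk, sub_self, norm_zero, mul_zero, norm_le_zero_iff] at h3
  exact (sub_eq_zero.1 h3).symm

/-- The Schwartz functions that vanish outside a ball. -/
noncomputable def schwartzBall (n : ℕ) (R : ℝ) : Submodule ℂ 𝓢(Vec n, ℂ) where
  carrier := {φ | ∀ ξ, ξ ∉ Metric.closedBall (0 : Vec n) R → φ ξ = 0}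
  add_mem' := fun {φ ψ} hφ hψ ξ hξ => by simp [hφ ξ hξ, hψ ξ hξ]
  zero_mem' := fun ξ _ => rfl
  smul_mem' := fun c φ hφ ξ hξ => by simp [hφ ξ hξ]

/-- The multiplier with symbol `q m` is the convolution of `𝓕⁻ q` and the multiplier with
symbol `m`. -/
theorem multiplierFun_mul_eq_conv {q m : Vec n → ℂ} (hqc : HasCompactSupport q)
    (hq : ContDiff ℝ ∞ q) (hc : HasCompactSupport m) (hm : ContDiff ℝ ∞ m)
    (v : 𝓢'(Vec n, ℂ)) (x : Vec n) :
    multiplierFun (fun ξ => q ξ * m ξ) v x = ∫ y, 𝓕⁻ q y * multiplierFun m v (x - y) := by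
  obtain ⟨R, hR, hRs⟩ := exists_support_radius hc
  obtain ⟨N, C, hC, hT⟩ := exists_norm_le_jetMap (𝓕 v) hR
  have hqm : HasCompactSupport fun ξ => q ξ * m ξ := hqc.mul_right
  have hqm' : ContDiff ℝ ∞ fun ξ => q ξ * m ξ := hq.mul hm
  have hcont : Continuous (𝓕⁻ q) :=
    continuous_fourierInv_of_integrable (hq.continuous.integrable_of_hasCompactSupport hqc)
  have hV : ∀ y, waveTest hc hm y ∈ schwartzBall n R := fun y ξ hξ => by simp [waveTest_apply, hRs ξ hξ]
  have hV' : waveTest hqm hqm' x ∈ schwartzBall n R := fun ξ hξ => by simp [waveTest_apply, hRs ξ hξ]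
  obtain ⟨B, hB0, hB⟩ := exists_norm_iteratedFDeriv_waveTest_le hc hm N
  have hJc : Continuous fun y => jetMap N R (waveTest hc hm (x - y)) :=
    (continuous_jetMap_waveTest hc hm N R).comp (continuous_const.sub continuous_id)
  have hTc : Continuous fun y => (𝓕 v) (waveTest hc hm (x - y)) := by
    have h1 := (continuous_multiplierFun hc hm v).comp
      (continuous_const.sub continuous_id : Continuous fun y => x - y)
    exact h1.congr fun y => multiplierFun_eq hc hm v (x - y)
  have hnorm : ∀ y, ‖jetMap N R (waveTest hc hm (x - y))‖ ≤
      B * ((2 * Real.pi) ^ N * (1 + ‖x‖) ^ N * (1 + ‖y‖) ^ N) := fun y => by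
    have h1 : ‖jetMap N R (waveTest hc hm (x - y))‖ ≤ B * (1 + 2 * Real.pi * ‖x - y‖) ^ N := by
      refine JetSpace.norm_le (by positivity) fun l ξ => ?_
      exact hB l (by omega) (x - y) ξ
    exact h1.trans (mul_le_mul_of_nonneg_left (one_add_norm_sub_pow_le x y N) hB0)
  have hpow := integrable_pow_mul_fourierInv hqc hq N
  have := secondCountableTopologyEither_of_left (Vec n) (JetSpace n N R)
  have hJi : Integrable fun y => 𝓕⁻ q y • jetMap N R (waveTest hc hm (x - y)) := by
    refine Integrable.mono' (hpow.const_mul (B * ((2 * Real.pi) ^ N * (1 + ‖x‖) ^ N)))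
      (hcont.smul hJc).aestronglyMeasurable (Eventually.of_forall fun y => ?_)
    rw [norm_smul]
    refine (mul_le_mul_of_nonneg_left (hnorm y) (norm_nonneg _)).trans_eq ?_
    ring
  have hTi : Integrable fun y => 𝓕⁻ q y * (𝓕 v) (waveTest hc hm (x - y)) := by
    refine Integrable.mono' (hpow.const_mul (C * (B * ((2 * Real.pi) ^ N * (1 + ‖x‖) ^ N))))
      (hcont.mul hTc).aestronglyMeasurable (Eventually.of_forall fun y => ?_)
    rw [norm_mul]
    refine (mul_le_mul_of_nonneg_left ((hT _ (hV (x - y))).trans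
      (mul_le_mul_of_nonneg_left (hnorm y) hC)) (norm_nonneg _)).trans_eq ?_
    ring
  -- Evaluations are continuous on jets, so this reduces to the superposition formula for each
  -- derivative at each point.
  have hθ : ∫ y, 𝓕⁻ q y • jetMap N R (waveTest hc hm (x - y)) =
      jetMap N R (waveTest hqm hqm' x) := by
    refine funext fun l => ContinuousMap.ext fun ξ => ContinuousMultilinearMap.ext fun w => ?_
    have h3 := iteratedFDeriv_waveTest_mul hqc hq hc hm x ξ w
    refine Eq.trans ?_ h3.symm
    exact ((jetEval l ξ w).integral_comp_comm hJi).symm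
  obtain ⟨T, hTe⟩ : ∃ T : 𝓢(Vec n, ℂ) →ₗ[ℂ] ℂ, ∀ φ, (𝓕 v) φ = T φ :=
    ⟨(𝓕 v).toLinearMap, fun _ => rfl⟩
  rw [multiplierFun_eq hqm hqm']
  simp only [multiplierFun_eq hc hm, hTe] at hT hTi ⊢
  exact linearMap_eq_integral (jetMap N R) T (schwartzBall n R) hT
    (fun y => hV (x - y)) hJi hTi hV' hθ

end Multiplier

end FracNS

namespace FracNS

/-! ### The heat flow of Besov data -/

section HeatFlow

variable {n : ℕ}

/-- For data that are merely bounded the whole radius comes from the kernel; this starts the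
regularisation of the blocks P_j u₀. -/
theorem KernelBound.conv_bounded {r C : ℝ} (hr : 0 < r) {K : List (Vec n) → Vec n → ℂ}
    (hK : KernelBound volume r C K) {f : Vec n → ℂ} (hf : AEStronglyMeasurable f) {M : ℝ}
    (hM : ∀ y, ‖f y‖ ≤ M) : AnaBound r (C * M) (fun x => ∫ y, K [] (x - y) * f y) := by
  have hM0 : 0 ≤ M := (norm_nonneg _).trans (hM 0)
  have hJ := isJet_conv_of_bounded (D := fun k => C * anaWeight r k) hK.isJet hK.integrable
    hK.bound hf hM
  refine AnaBound.of_jet hr (mul_nonneg hK.nonneg hM0) hJ fun l x => ?_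
  refine (norm_integral_le_of_norm_le (((hK.integrable l).comp_sub_left x).norm.mul_const M)
    (Eventually.of_forall fun y => ?_)).trans ?_
  · rw [norm_mul]
    exact mul_le_mul_of_nonneg_left (hM _) (norm_nonneg _)
  · rw [integral_mul_const, integral_sub_left_eq_self (fun y => ‖K l y‖) volume x]
    refine (mul_le_mul_of_nonneg_right (hK.bound l) hM0).trans_eq ?_
    ring

/-- A smooth function that is `1` on the support of `annulus` and vanishes near the origin. -/
noncomputable def wideAnnulus (η : Vec n) : ℝ :=
  ballCutoff ((1 / 3 : ℝ) • η) - ballCutoff ((2 : ℝ) • η)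

theorem contDiff_ballCutoff : ContDiff ℝ ∞ (ballCutoff : Vec n → ℝ) :=
  Real.smoothTransition.contDiff.comp (contDiff_const.sub (contDiff_norm_sq ℝ))

theorem contDiff_wideAnnulus : ContDiff ℝ ∞ (wideAnnulus : Vec n → ℝ) :=
  (contDiff_ballCutoff.comp (contDiff_const_smul (1 / 3 : ℝ))).sub
    (contDiff_ballCutoff.comp (contDiff_const_smul (2 : ℝ)))

theorem ballCutoff_eq_one {η : Vec n} (h : ‖η‖ ≤ 1) : ballCutoff η = 1 := by
  have h0 := norm_nonneg η
  exact Real.smoothTransition.one_of_one_le (by nlinarith)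

theorem ballCutoff_eq_zero {η : Vec n} (h : 2 ≤ ‖η‖ ^ 2) : ballCutoff η = 0 :=
  Real.smoothTransition.zero_of_nonpos (by linarith)

theorem wideAnnulus_eq_zero_of_le {η : Vec n} (h : ‖η‖ ≤ 1 / 2) : wideAnnulus η = 0 := by
  have h0 := norm_nonneg η
  rw [wideAnnulus, ballCutoff_eq_one, ballCutoff_eq_one, sub_self] <;>
  · rw [norm_smul, Real.norm_eq_abs, abs_of_pos (by norm_num)]
    linarith

theorem wideAnnulus_eq_zero_of_ge {η : Vec n} (h : 5 ≤ ‖η‖) : wideAnnulus η = 0 := by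
  rw [wideAnnulus, ballCutoff_eq_zero, ballCutoff_eq_zero, sub_self] <;>
  · rw [norm_smul, Real.norm_eq_abs, abs_of_pos (by norm_num)]
    nlinarith

theorem wideAnnulus_mul_annulus (η : Vec n) : wideAnnulus η * annulus η = annulus η := by
  rcases le_or_gt ‖η‖ 1 with h | h
  · rw [annulus_eq_zero_of_le h, mul_zero]
  rcases le_or_gt 3 ‖η‖ with h' | h'
  · rw [annulus_eq_zero_of_ge h', mul_zero]
  rw [wideAnnulus, ballCutoff_eq_one, ballCutoff_eq_zero, sub_zero, one_mul]
  · rw [norm_smul, Real.norm_eq_abs, abs_of_pos (by norm_num)]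
    nlinarith
  · rw [norm_smul, Real.norm_eq_abs, abs_of_pos (by norm_num)]
    linarith

/-- The function `wideAnnulus η / ‖η‖ ^ 2`. -/
noncomputable def wideAnnulusDiv (η : Vec n) : ℂ := ((wideAnnulus η / ‖η‖ ^ 2 : ℝ) : ℂ)

theorem hasCompactSupport_of_wideAnnulus {f : Vec n → ℂ} (h : ∀ η, wideAnnulus η = 0 → f η = 0) :
    HasCompactSupport f := by
  refine HasCompactSupport.of_support_subset_isCompact (isCompact_closedBall (0 : Vec n) 5) ?_
  intro η hη
  by_contra hx
  rw [mem_closedBall_zero_iff, not_le] at hx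
  exact hη (h η (wideAnnulus_eq_zero_of_ge hx.le))

theorem contDiff_mul_of_vanish {m f : Vec n → ℂ} (hm : ContDiff ℝ ∞ m) {ρ : ℝ} (hρ : 0 < ρ)
    (h0 : ∀ ξ, ‖ξ‖ ≤ ρ → m ξ = 0) (hf : ∀ ξ ≠ 0, ContDiffAt ℝ ∞ f ξ) :
    ContDiff ℝ ∞ fun ξ => m ξ * f ξ := by
  rw [contDiff_iff_contDiffAt]
  intro ξ
  by_cases hξ : ξ = 0
  · have : (fun ξ => m ξ * f ξ) =ᶠ[𝓝 ξ] fun _ => 0 := by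
      filter_upwards [Metric.ball_mem_nhds ξ hρ] with y hy
      rw [hξ, mem_ball_zero_iff] at hy
      rw [h0 y hy.le, zero_mul]
    exact contDiffAt_const.congr_of_eventuallyEq this
  · exact hm.contDiffAt.mul (hf ξ hξ)

theorem contDiffAt_heatSymbol (α t : ℝ) {ξ : Vec n} (hξ : ξ ≠ 0) :
    ContDiffAt ℝ ∞ (heatSymbol α t) ξ := by
  have hn : (2 * Real.pi * ‖ξ‖) ≠ 0 := by
    have := norm_pos_iff.2 hξ
    positivity
  have h1 : ContDiffAt ℝ ∞ (fun ξ : Vec n => 2 * Real.pi * ‖ξ‖) ξ :=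
    contDiffAt_const.mul (contDiffAt_norm ℝ hξ)
  have h2 := ((contDiffAt_const (c := t)).mul (h1.rpow_const_of_ne (p := 2 * α) hn)).neg.exp
  exact Complex.ofRealCLM.contDiff.contDiffAt.comp ξ h2

theorem contDiff_wideAnnulusDiv : ContDiff ℝ ∞ (wideAnnulusDiv : Vec n → ℂ) := by
  have h := contDiff_mul_of_vanish (n := n) (m := fun η => ((wideAnnulus η : ℝ) : ℂ))
    (f := fun η => (((‖η‖ ^ 2)⁻¹ : ℝ) : ℂ))
    (Complex.ofRealCLM.contDiff.comp contDiff_wideAnnulus) (ρ := 1 / 2) (by norm_num)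
    (fun ξ hξ => by rw [wideAnnulus_eq_zero_of_le hξ, Complex.ofReal_zero]) (fun ξ hξ => by
      have h1 : ContDiffAt ℝ ∞ (fun ξ : Vec n => (‖ξ‖ ^ 2)⁻¹) ξ :=
        (contDiff_norm_sq ℝ).contDiffAt.inv (by have := norm_pos_iff.2 hξ; positivity)
      exact Complex.ofRealCLM.contDiff.contDiffAt.comp ξ h1)
  have e : (wideAnnulusDiv : Vec n → ℂ) =
      fun η => ((wideAnnulus η : ℝ) : ℂ) * (((‖η‖ ^ 2)⁻¹ : ℝ) : ℂ) := by
    funext η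
    rw [wideAnnulusDiv, div_eq_mul_inv, Complex.ofReal_mul]
  rw [e]
  exact h

/-- The scale of the block `P_j`. -/
noncomputable def blockScale (j : ℤ) : ℝ := (2 : ℝ) ^ (-j) * (2 * Real.pi)

theorem blockScale_pos (j : ℤ) : 0 < blockScale j := by
  unfold blockScale
  positivity

/-- A symbol equal to `1` on the support of `blockSymbol j`. -/
noncomputable def wideSymbol (j : ℤ) (ξ : Vec n) : ℂ := ((wideAnnulus (blockScale j • ξ) : ℝ) : ℂ)

theorem wideSymbol_mul_blockSymbol (j : ℤ) (ξ : Vec n) :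
    wideSymbol j ξ * blockSymbol j ξ = blockSymbol j ξ := by
  unfold wideSymbol blockSymbol
  rw [← Complex.ofReal_mul]
  exact congrArg _ (wideAnnulus_mul_annulus _)

theorem contDiff_wideSymbol (j : ℤ) : ContDiff ℝ ∞ (wideSymbol j : Vec n → ℂ) :=
  Complex.ofRealCLM.contDiff.comp (contDiff_wideAnnulus.comp (contDiff_const_smul _))

theorem hasCompactSupport_wideSymbol (j : ℤ) : HasCompactSupport (wideSymbol j : Vec n → ℂ) := by
  have h : HasCompactSupport fun η : Vec n => ((wideAnnulus η : ℝ) : ℂ) :=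
    hasCompactSupport_of_wideAnnulus fun η hη => by rw [hη, Complex.ofReal_zero]
  exact h.comp_smul (blockScale_pos j).ne'

theorem contDiff_wideSymbol_mul_heat (α t : ℝ) (j : ℤ) :
    ContDiff ℝ ∞ fun ξ : Vec n => wideSymbol j ξ * heatSymbol α t ξ := by
  have hc := blockScale_pos j
  refine contDiff_mul_of_vanish (contDiff_wideSymbol j) (ρ := 1 / 2 / blockScale j)
    (by positivity) (fun ξ hξ => ?_) fun ξ hξ => contDiffAt_heatSymbol α t hξ
  rw [wideSymbol, wideAnnulus_eq_zero_of_le, Complex.ofReal_zero]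
  rw [norm_smul, Real.norm_eq_abs, abs_of_pos hc, mul_comm]
  rwa [le_div_iff₀ hc] at hξ

theorem hasCompactSupport_wideSymbol_mul_heat (α t : ℝ) (j : ℤ) :
    HasCompactSupport fun ξ : Vec n => wideSymbol j ξ * heatSymbol α t ξ :=
  (hasCompactSupport_wideSymbol j).mul_right

/-- The bound does not depend on c, because dilating W leaves the L¹ norm of its kernel unchanged.
This gives uniformity over all dyadic scales. -/
theorem l1Le_of_symbol_mul {W : Vec n → ℂ} (hW : ContDiff ℝ ∞ W) (hWc : HasCompactSupport W)
    {c : ℝ} (hc : 0 < c) {g : Vec n → ℂ} {D : ℝ} (hg : Integrable g) (hg' : L1Le (𝓕⁻ g) D) :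
    L1Le (𝓕⁻ (fun ξ => W (c • ξ) * g ξ)) ((∫ y, ‖𝓕⁻ W y‖) * D) := by
  have h1 : L1Le (𝓕⁻ W) (∫ y, ‖𝓕⁻ W y‖) :=
    ⟨integrable_fourierInv_of_contDiff (hW.of_le (by exact_mod_cast le_top)) hWc, le_rfl⟩
  have h2 : Continuous fun ξ => W (c • ξ) := hW.continuous.comp (continuous_const_smul c)
  exact L1Le.fourierInv_mul h2
    (h2.integrable_of_hasCompactSupport (hWc.comp_smul hc.ne')) (h1.fourierInv_comp_smul hc) hg hg'

theorem sum_dirSymbol_basisVec (ξ : Vec n) :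
    ∑ i : Fin n, dirSymbol [basisVec i, basisVec i] ξ = -(((2 * Real.pi * ‖ξ‖) ^ 2 : ℝ) : ℂ) := by
  have hb : ∀ i : Fin n, inner ℝ (basisVec i : Vec n) ξ = ξ i := fun i => by
    simp [basisVec, EuclideanSpace.inner_single_left]
  have h1 : ∀ i : Fin n, dirSymbol [basisVec i, basisVec i] ξ =
      -(((2 * Real.pi) ^ 2 * (ξ i) ^ 2 : ℝ) : ℂ) := fun i => by
    simp only [dirSymbol_cons, dirSymbol_nil, hb]
    push_cast
    linear_combination (4 * (Real.pi : ℂ) ^ 2 * (ξ i : ℂ) ^ 2) * Complex.I_sq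
  simp only [h1]
  rw [Finset.sum_neg_distrib, ← Complex.ofReal_sum, ← Finset.mul_sum, mul_pow (2 * Real.pi),
    EuclideanSpace.norm_sq_eq]
  simp

/-- The derivatives of the kernel of the multiplier with symbol `wideSymbol j * heatSymbol α t`. -/
noncomputable def blockHeatDeriv (α t : ℝ) (j : ℤ) (l : List (Vec n)) : Vec n → ℂ :=
  𝓕⁻ (fun ξ => dirSymbol l ξ * (wideSymbol j ξ * heatSymbol α t ξ))

theorem isJet_blockHeatDeriv (α t : ℝ) (j : ℤ) :
    IsJet (blockHeatDeriv α t j : List (Vec n) → Vec n → ℂ) := by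
  have hc := (contDiff_wideSymbol_mul_heat (n := n) α t j).continuous
  refine isJet_fourierInv hc.aestronglyMeasurable fun k => ?_
  refine Continuous.integrable_of_hasCompactSupport (by fun_prop) ?_
  exact (hasCompactSupport_wideSymbol_mul_heat α t j).norm.mul_left

theorem l1Le_blockHeatDeriv_low [NeZero n] {α : ℝ} (hα : 0 < α) {t : ℝ} (ht : 0 < t)
    (l : List (Vec n)) {D : ℝ} (h : L1Le (heatDeriv α t l) D) (j : ℤ) :
    L1Le (blockHeatDeriv α t j l)
      ((∫ y, ‖𝓕⁻ (fun η : Vec n => ((wideAnnulus η : ℝ) : ℂ)) y‖) * D) := by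
  have := l1Le_of_symbol_mul (W := fun η : Vec n => ((wideAnnulus η : ℝ) : ℂ))
    (Complex.ofRealCLM.contDiff.comp contDiff_wideAnnulus)
    (hasCompactSupport_of_wideAnnulus fun η hη => by rw [hη, Complex.ofReal_zero])
    (blockScale_pos j) (integrable_dirSymbol_mul_heatSymbol hα ht l) h
  have e : blockHeatDeriv α t j l = 𝓕⁻ (fun ξ => ((wideAnnulus (blockScale j • ξ) : ℝ) : ℂ) *
      (dirSymbol l ξ * heatSymbol α t ξ)) := by
    unfold blockHeatDeriv wideSymbol
    congr 1
    funext ξ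
    ring
  rw [e]
  exact this

/-- On the annulus one may divide and multiply by the squared rescaled frequency: the quotient is
again a dilated smooth cutoff, and 2^(-2j)|2πξ|² is -2^(-2j) times the symbol of the Laplacian. High
frequencies thus gain 2^(-2j) at the cost of two more derivatives on the heat kernel. -/
theorem l1Le_blockHeatDeriv_high [NeZero n] {α : ℝ} (hα : 0 < α) {t : ℝ} (ht : 0 < t)
    (l : List (Vec n)) {D : Fin n → ℝ}
    (h : ∀ i, L1Le (heatDeriv α t ([basisVec i, basisVec i] ++ l)) (D i)) (j : ℤ) :
    L1Le (blockHeatDeriv α t j l)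
      ((∫ y, ‖𝓕⁻ (wideAnnulusDiv : Vec n → ℂ) y‖) * (((2 : ℝ) ^ (-j)) ^ 2 * ∑ i, D i)) := by
  set c : ℂ := -((((2 : ℝ) ^ (-j)) ^ 2 : ℝ) : ℂ) with hc
  have hcn : ‖c‖ = ((2 : ℝ) ^ (-j)) ^ 2 := by
    rw [hc, norm_neg, Complex.norm_real, Real.norm_of_nonneg (by positivity)]
  set g : Fin n → Vec n → ℂ := fun i ξ =>
    c * (dirSymbol ([basisVec i, basisVec i] ++ l) ξ * heatSymbol α t ξ) with hg
  have hgi : ∀ i, Integrable (g i) := fun i =>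
    (integrable_dirSymbol_mul_heatSymbol hα ht ([basisVec i, basisVec i] ++ l)).const_mul c
  have hgL : ∀ i, L1Le (𝓕⁻ (g i)) (((2 : ℝ) ^ (-j)) ^ 2 * D i) := fun i => by
    have h1 := (h i).const_mul c
    rw [hcn] at h1
    have e : 𝓕⁻ (g i) = fun x => c * heatDeriv α t ([basisVec i, basisVec i] ++ l) x :=
      funext fun x => fourierInv_const_mul _ _ x
    rwa [e]
  have hGi : Integrable fun ξ => ∑ i, g i ξ := integrable_finsetSum _ fun i _ => hgi i
  have hGL : L1Le (𝓕⁻ fun ξ => ∑ i, g i ξ) (((2 : ℝ) ^ (-j)) ^ 2 * ∑ i, D i) := by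
    have e : (𝓕⁻ fun ξ => ∑ i, g i ξ) = fun x => ∑ i, 𝓕⁻ (g i) x :=
      funext fun x => fourierInv_finset_sum (fun i _ => hgi i) x
    rw [e, Finset.mul_sum]
    exact L1Le.sum fun i _ => hgL i
  have key := l1Le_of_symbol_mul contDiff_wideAnnulusDiv
    (hasCompactSupport_of_wideAnnulus fun η hη => by simp [wideAnnulusDiv, hη])
    (blockScale_pos j) hGi hGL
  have e : blockHeatDeriv α t j l =
      𝓕⁻ (fun ξ => wideAnnulusDiv (blockScale j • ξ) * ∑ i, g i ξ) := by
    unfold blockHeatDeriv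
    congr 1
    funext ξ
    have h1 : ∑ i, g i ξ = (∑ i, dirSymbol [basisVec i, basisVec i] ξ) *
        (c * (dirSymbol l ξ * heatSymbol α t ξ)) := by
      rw [Finset.sum_mul]
      refine Finset.sum_congr rfl fun i _ => ?_
      simp only [hg, dirSymbol_append]
      ring
    have h2 : wideSymbol j ξ = wideAnnulusDiv (blockScale j • ξ) *
        ((((2 : ℝ) ^ (-j)) ^ 2 * (2 * Real.pi * ‖ξ‖) ^ 2 : ℝ) : ℂ) := by
      unfold wideSymbol wideAnnulusDiv
      rw [← Complex.ofReal_mul]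
      congr 1
      rcases eq_or_ne ξ 0 with rfl | hξ
      · rw [smul_zero, wideAnnulus_eq_zero_of_le (by simp), zero_div, zero_mul]
      · have hn := norm_pos_iff.2 hξ
        have hs := blockScale_pos j
        rw [norm_smul, Real.norm_eq_abs, abs_of_pos hs]
        have h3 : ((2 : ℝ) ^ (-j)) ^ 2 * (2 * Real.pi * ‖ξ‖) ^ 2 = (blockScale j * ‖ξ‖) ^ 2 := by
          unfold blockScale; ring
        rw [h3, div_mul_cancel₀ _ (by positivity)]
    rw [h1, sum_dirSymbol_basisVec, h2, hc]
    push_cast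
    ring
  rw [e]
  exact key

/-- The condition a > 0 gives convergence at j → -∞ and a < 2 at j → +∞. The power of r comes from
shifting the index by the dyadic exponent of r. -/
theorem exists_dyadic_sum {a : ℝ} (ha : 0 < a) (ha2 : a < 2) :
    ∃ S, 0 ≤ S ∧ ∀ r : ℝ, 0 < r →
      Summable (fun j : ℤ => (2 : ℝ) ^ ((j : ℝ) * a) * min 1 (((2 : ℝ) ^ (-j)) ^ 2 * r ^ 2)) ∧
      ∑' j : ℤ, (2 : ℝ) ^ ((j : ℝ) * a) * min 1 (((2 : ℝ) ^ (-j)) ^ 2 * r ^ 2) ≤ S * r ^ a := by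
  set G : ℤ → ℝ := fun i => (2 : ℝ) ^ ((i : ℝ) * a) * min 1 (((2 : ℝ) ^ (-i)) ^ 2) with hG
  have hG0 : ∀ i, 0 ≤ G i := fun i => by positivity
  have hGs : Summable G := by
    refine Summable.of_nat_of_neg ?_ ?_
    · refine Summable.of_nonneg_of_le (fun k => hG0 _) (fun k => ?_)
        (summable_geometric_of_lt_one (r := (2 : ℝ) ^ (a - 2)) (by positivity)
          (Real.rpow_lt_one_of_one_lt_of_neg one_lt_two (by linarith)))
      refine (mul_le_mul_of_nonneg_left (min_le_right _ _) (by positivity)).trans_eq ?_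
      rw [← Real.rpow_natCast ((2 : ℝ) ^ (a - 2)), ← Real.rpow_mul (by norm_num),
        ← Real.rpow_intCast, ← Real.rpow_natCast, ← Real.rpow_mul (by norm_num),
        ← Real.rpow_add (by norm_num)]
      congr 1
      push_cast
      ring
    · refine Summable.of_nonneg_of_le (fun k => hG0 _) (fun k => ?_)
        (summable_geometric_of_lt_one (r := (2 : ℝ) ^ (-a)) (by positivity)
          (Real.rpow_lt_one_of_one_lt_of_neg one_lt_two (by linarith)))
      refine (mul_le_mul_of_nonneg_left (min_le_left _ _) (by positivity)).trans_eq ?_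
      rw [← Real.rpow_natCast ((2 : ℝ) ^ (-a)), ← Real.rpow_mul (by norm_num), mul_one]
      congr 1
      push_cast
      ring
  refine ⟨4 * ∑' i, G i, mul_nonneg (by norm_num) (tsum_nonneg hG0), fun r hr => ?_⟩
  -- With 2^k ≤ r < 2^(k+1), replacing r by 2^k costs at most the factor 4 = 2², from the quadratic
  -- branch of the minimum.
  obtain ⟨k, hk1, hk2⟩ := exists_mem_Ico_zpow hr one_lt_two
  have hle : ∀ j : ℤ, (2 : ℝ) ^ ((j : ℝ) * a) * min 1 (((2 : ℝ) ^ (-j)) ^ 2 * r ^ 2) ≤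
      4 * r ^ a * G (j - k) := by
    intro j
    have h1 : (2 : ℝ) ^ ((j : ℝ) * a) ≤ (2 : ℝ) ^ (((j - k : ℤ) : ℝ) * a) * r ^ a := by
      have h2 : ((2 : ℝ) ^ k) ^ a ≤ r ^ a := Real.rpow_le_rpow (by positivity) hk1 ha.le
      rw [← Real.rpow_intCast, ← Real.rpow_mul (by norm_num)] at h2
      refine le_trans (le_of_eq ?_) (mul_le_mul_of_nonneg_left h2 (by positivity))
      rw [← Real.rpow_add (by norm_num)]
      congr 1
      push_cast
      ring
    have h3 : min 1 (((2 : ℝ) ^ (-j)) ^ 2 * r ^ 2) ≤ 4 * min 1 (((2 : ℝ) ^ (-(j - k))) ^ 2) := by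
      have h4 : ((2 : ℝ) ^ (-j)) ^ 2 * r ^ 2 ≤ 4 * ((2 : ℝ) ^ (-(j - k))) ^ 2 := by
        have h5 : r ^ 2 ≤ ((2 : ℝ) ^ (k + 1)) ^ 2 := by gcongr
        refine (mul_le_mul_of_nonneg_left h5 (by positivity)).trans_eq ?_
        rw [zpow_add₀ (by norm_num), neg_sub, sub_eq_add_neg, zpow_add₀ (by norm_num)]
        ring
      rcases min_choice 1 (((2 : ℝ) ^ (-(j - k))) ^ 2) with h | h <;> rw [h]
      · exact (min_le_left _ _).trans (by norm_num)
      · exact (min_le_right _ _).trans h4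
    refine (mul_le_mul h1 h3 (by positivity) (by positivity)).trans_eq ?_
    simp only [hG]
    ring
  have hs : Summable fun j : ℤ => 4 * r ^ a * G (j - k) :=
    ((Equiv.subRight k).summable_iff.2 hGs).mul_left _
  have hs' := Summable.of_nonneg_of_le (fun j => by positivity) hle hs
  refine ⟨hs', (hs'.tsum_le_tsum hle hs).trans_eq ?_⟩
  have e := (Equiv.subRight k).tsum_eq G
  simp only [Equiv.subRight_apply] at e
  rw [tsum_mul_left, e]
  ring

/-- The low- and high-frequency estimates are the two branches of the minimum. In the second, the
two extra derivatives use half of the time and the list l the other half; this is why δ is 2^(-p)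
times the radius constant of the heat kernel. -/
theorem exists_blockHeat_bound [NeZero n] {α : ℝ} (hα : 1 / 2 < α) :
    ∃ δ A : ℝ, 0 < δ ∧ 0 ≤ A ∧ ∀ t, 0 < t → ∀ j : ℤ,
      KernelBound (volume : Measure (Vec n)) (δ * t ^ (1 / (2 * α)))
        (A * min 1 (((2 : ℝ) ^ (-j)) ^ 2 * (t ^ (-(1 / (2 * α)))) ^ 2)) (blockHeatDeriv α t j) := by
  have hα0 : 0 < α := by linarith
  obtain ⟨δ₀, A₀, hδ₀, hA₀, h0⟩ := exists_heatDeriv_bound (n := n) hα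
  choose D hD hDb using fun i : Fin n => l1Le_heatDeriv hα0 [(basisVec i : Vec n), basisVec i]
  set p := 1 / (2 * α) with hp
  have hp0 : 0 < p := by positivity
  set I₁ := ∫ y, ‖𝓕⁻ (fun η : Vec n => ((wideAnnulus η : ℝ) : ℂ)) y‖ with hI₁
  set I₂ := ∫ y, ‖𝓕⁻ (wideAnnulusDiv : Vec n → ℂ) y‖ with hI₂
  have hI₁0 : 0 ≤ I₁ := integral_nonneg fun _ => norm_nonneg _
  have hI₂0 : 0 ≤ I₂ := integral_nonneg fun _ => norm_nonneg _
  set δ := δ₀ * (1 / 2) ^ p with hδ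
  have hδ0 : 0 < δ := by positivity
  set X := I₂ * (∑ i, D i) * (1 / 2) ^ (-(2 * p)) * A₀ with hX
  have hX0 : 0 ≤ X := by
    have : 0 ≤ ∑ i, D i := Finset.sum_nonneg fun i _ => hD i
    positivity
  refine ⟨δ, I₁ * A₀ + X, hδ0, by positivity, fun t ht j => ?_⟩
  have hr : 0 < δ * t ^ p := by positivity
  have hlow : ∀ l : List (Vec n), L1Le (blockHeatDeriv α t j l)
      (I₁ * A₀ * anaWeight (δ * t ^ p) l.length * normProd l) := fun l => by
    refine (l1Le_blockHeatDeriv_low hα0 ht l (h0 t ht l) j).mono ?_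
    have h1 : anaWeight (δ₀ * t ^ p) l.length ≤ anaWeight (δ * t ^ p) l.length := by
      refine anaWeight_anti hr ?_ _
      have h2 : (1 / 2 : ℝ) ^ p ≤ 1 := Real.rpow_le_one (by norm_num) (by norm_num) hp0.le
      rw [hδ]
      gcongr
      exact mul_le_of_le_one_right hδ₀.le h2
    have h3 := normProd_nonneg l
    calc _ ≤ I₁ * (A₀ * anaWeight (δ * t ^ p) l.length * normProd l) := by gcongr
      _ = _ := by ring
  have hhigh : ∀ l : List (Vec n), L1Le (blockHeatDeriv α t j l)
      (X * (((2 : ℝ) ^ (-j)) ^ 2 * (t ^ (-p)) ^ 2) * anaWeight (δ * t ^ p) l.length *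
        normProd l) := fun l => by
    have h1 := fun i => l1Le_heatDeriv_append hα0 (half_pos ht) (half_pos ht)
      (hDb i (t / 2) (half_pos ht)) (h0 (t / 2) (half_pos ht) l)
    simp only [add_halves] at h1
    have e1 : δ₀ * (t / 2) ^ p = δ * t ^ p := by
      rw [hδ, div_eq_mul_one_div, Real.mul_rpow ht.le (by norm_num)]
      ring
    have e2 : (t / 2) ^ (-(((0 + 1 + 1 : ℕ) : ℝ) / (2 * α))) =
        (1 / 2) ^ (-(2 * p)) * (t ^ (-p)) ^ 2 := by
      have e3 : ((0 + 1 + 1 : ℕ) : ℝ) / (2 * α) = 2 * p := by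
        rw [hp]
        push_cast
        ring
      rw [e3, ← Real.rpow_natCast (t ^ (-p)), ← Real.rpow_mul ht.le, div_eq_mul_one_div,
        Real.mul_rpow ht.le (by norm_num), mul_comm]
      congr 2
      push_cast
      ring
    simp only [List.length_cons, List.length_nil, e1, e2] at h1
    refine (l1Le_blockHeatDeriv_high hα0 ht l h1 j).mono (le_of_eq ?_)
    rw [← Finset.sum_mul, ← Finset.sum_mul, hX]
    ring
  refine ⟨isJet_blockHeatDeriv α t j, fun l => (hlow l).1, fun l => ?_⟩
  have h3 := normProd_nonneg l
  have h4 := (anaWeight_pos hr l.length).le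
  rcases min_choice 1 (((2 : ℝ) ^ (-j)) ^ 2 * (t ^ (-p)) ^ 2) with h | h <;> rw [h]
  · refine (hlow l).2.trans
      (mul_le_mul_of_nonneg_right (mul_le_mul_of_nonneg_right ?_ h4) h3)
    linarith
  · refine (hhigh l).2.trans
      (mul_le_mul_of_nonneg_right (mul_le_mul_of_nonneg_right ?_ h4) h3)
    exact mul_le_mul_of_nonneg_right (by linarith [mul_nonneg hI₁0 hA₀]) (by positivity)

/-! #### The heat flow -/

/-- The wide cutoff equals 1 on the support of the block symbol, so it may be inserted for free. It
vanishes near the origin, which removes the possible singularity of the heat symbol and makes the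
multiplier smooth with compact support. -/
theorem heatFlow_term_eq (α t : ℝ) (j : ℤ) (v : 𝓢'(Vec n, ℂ)) (x : Vec n) :
    multiplierFun (fun ξ => blockSymbol j ξ * heatSymbol α t ξ) v x =
      ∫ y, blockHeatDeriv α t j [] (x - y) * block j v y := by
  have h := multiplierFun_mul_eq_conv (hasCompactSupport_wideSymbol_mul_heat α t j)
    (contDiff_wideSymbol_mul_heat α t j) (hasCompactSupport_blockSymbol j)
    (contDiff_blockSymbol j) v x
  have e : (fun ξ : Vec n => wideSymbol j ξ * heatSymbol α t ξ * blockSymbol j ξ) =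
      fun ξ => blockSymbol j ξ * heatSymbol α t ξ := by
    funext ξ
    rw [mul_right_comm, wideSymbol_mul_blockSymbol]
  rw [e] at h
  rw [h, ← integral_sub_left_eq_self _ volume x]
  simp only [sub_sub_cancel, blockHeatDeriv, dirSymbol_nil, one_mul]
  rfl

theorem continuous_block (j : ℤ) (v : 𝓢'(Vec n, ℂ)) : Continuous (block j v) :=
  continuous_multiplierFun (hasCompactSupport_blockSymbol j) (contDiff_blockSymbol j) v

theorem norm_block_le {α : ℝ} {v : 𝓢'(Vec n, ℂ)} {B : ℝ} (hB : 0 ≤ B)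
    (hv : besovNorm α v ≤ ENNReal.ofReal B) (j : ℤ) (x : Vec n) :
    ‖block j v x‖ ≤ (2 : ℝ) ^ ((j : ℝ) * (2 * α - 1)) * B := by
  have h1 : ENNReal.ofReal ((2 : ℝ) ^ ((j : ℝ) * (1 - 2 * α))) * ‖block j v x‖ₑ ≤
      ENNReal.ofReal B := by
    refine le_trans ?_ ((le_iSup (fun j : ℤ => ENNReal.ofReal ((2 : ℝ) ^ ((j : ℝ) * (1 - 2 * α))) *
      supNorm (block j v)) j).trans hv)
    exact mul_le_mul_right (le_iSup (fun x => ‖block j v x‖ₑ) x) _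
  rw [← ofReal_norm, ← ENNReal.ofReal_mul (by positivity),
    ENNReal.ofReal_le_ofReal_iff hB] at h1
  have h2 : (2 : ℝ) ^ ((j : ℝ) * (2 * α - 1)) * (2 : ℝ) ^ ((j : ℝ) * (1 - 2 * α)) = 1 := by
    rw [← Real.rpow_add (by norm_num), ← mul_add]
    simp
  calc ‖block j v x‖ = (2 : ℝ) ^ ((j : ℝ) * (2 * α - 1)) *
        ((2 : ℝ) ^ ((j : ℝ) * (1 - 2 * α)) * ‖block j v x‖) := by rw [← mul_assoc, h2, one_mul]
    _ ≤ _ := by gcongr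

/-- Analytic estimates and summability of the heat flow of Besov data. -/
theorem exists_heatFlow_bound [NeZero n] {α : ℝ} (hα : 1 / 2 < α) (hα' : α < 1) :
    ∃ δ A : ℝ, 0 < δ ∧ 0 ≤ A ∧ ∀ (v : 𝓢'(Vec n, ℂ)) (B : ℝ), 0 ≤ B →
      besovNorm α v ≤ ENNReal.ofReal B → ∀ t, 0 < t →
      AnaBound (δ * t ^ (1 / (2 * α))) (A * B * t ^ (-(1 - 1 / (2 * α)))) (heatFlow α t v) ∧
      ∀ x, Summable fun j : ℤ =>
        multiplierFun (fun ξ => blockSymbol j ξ * heatSymbol α t ξ) v x := by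
  obtain ⟨δ, A, hδ, hA, hK⟩ := exists_blockHeat_bound (n := n) hα
  -- The Besov norm lets the block P_j v grow like 2^(j(2α-1)), so the exponent is a = 2α-1, which
  -- lies in (0, 2).
  obtain ⟨S, hS, hsum⟩ := exists_dyadic_sum (a := 2 * α - 1) (by linarith) (by linarith)
  refine ⟨δ, A * S, hδ, by positivity, fun v B hB hv t ht => ?_⟩
  set p := 1 / (2 * α) with hp
  have hr : 0 < δ * t ^ p := by positivity
  have hterm : ∀ j : ℤ, AnaBound (δ * t ^ p) (A * B * ((2 : ℝ) ^ ((j : ℝ) * (2 * α - 1)) *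
      min 1 (((2 : ℝ) ^ (-j)) ^ 2 * (t ^ (-p)) ^ 2)))
      (multiplierFun (fun ξ => blockSymbol j ξ * heatSymbol α t ξ) v) := fun j => by
    have h := (hK t ht j).conv_bounded hr (continuous_block j v).aestronglyMeasurable
      (norm_block_le hB hv j)
    rw [← funext (heatFlow_term_eq α t j v)] at h
    exact h.mono hr (le_of_eq (by ring))
  obtain ⟨h1, h2⟩ := hsum (t ^ (-p)) (by positivity)
  refine ⟨(AnaBound.tsum hterm (h1.mul_left _)).mono hr ?_, fun x =>
    Summable.of_norm_bounded (h1.mul_left (A * B)) fun j => (hterm j).norm_le x⟩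
  rw [tsum_mul_left]
  refine (mul_le_mul_of_nonneg_left h2 (by positivity)).trans_eq ?_
  rw [← Real.rpow_mul ht.le]
  -- Since 2αp = 1, the dyadic sum at r = t^(-p) has exactly the time weight of GX.
  have e : -p * (2 * α - 1) = -(1 - p) := by
    rw [hp]
    field_simp
  rw [e]
  ring

theorem stronglyMeasurable_heatFlow_term (α : ℝ) (j : ℤ) (v : 𝓢'(Vec n, ℂ)) :
    StronglyMeasurable fun q : ℝ × Vec n =>
      multiplierFun (fun ξ => blockSymbol j ξ * heatSymbol α q.1 ξ) v q.2 := by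
  simp only [heatFlow_term_eq]
  have h1 : StronglyMeasurable (Function.uncurry fun (t : ℝ) (ξ : Vec n) =>
      dirSymbol [] ξ * (wideSymbol j ξ * heatSymbol α t ξ)) := by
    have e1 : Measurable fun q : ℝ × Vec n => heatSymbol α q.1 q.2 := by
      unfold heatSymbol
      fun_prop
    have e2 : Measurable fun q : ℝ × Vec n => (wideSymbol j q.2 : ℂ) :=
      (contDiff_wideSymbol j).continuous.measurable.comp measurable_snd
    have e3 := (e2.mul e1).stronglyMeasurable
    refine (stronglyMeasurable_const (b := (1 : ℂ))).mul e3
  have h2 : StronglyMeasurable fun q : ℝ × Vec n => blockHeatDeriv α q.1 j [] q.2 :=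
    stronglyMeasurable_fourierInv h1
  have h3 : StronglyMeasurable fun q : (ℝ × Vec n) × Vec n =>
      blockHeatDeriv α q.1.1 j [] (q.1.2 - q.2) * block j v q.2 := by
    refine StronglyMeasurable.mul ?_
      ((continuous_block j v).stronglyMeasurable.comp_measurable measurable_snd)
    have h4 : Measurable fun q : (ℝ × Vec n) × Vec n => (q.1.1, q.1.2 - q.2) := by fun_prop
    have h5 := h2.comp_measurable h4
    simpa only [Function.comp_def] using h5
  exact h3.integral_prod_right'

theorem stronglyMeasurable_heatFlow [NeZero n] {α : ℝ} (hα : 1 / 2 < α) (hα' : α < 1)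
    {v : 𝓢'(Vec n, ℂ)} {B : ℝ} (hB : 0 ≤ B) (hv : besovNorm α v ≤ ENNReal.ofReal B) :
    StronglyMeasurable fun q : ℝ × Vec n => if 0 < q.1 then heatFlow α q.1 v q.2 else 0 := by
  obtain ⟨δ, A, -, -, h⟩ := exists_heatFlow_bound (n := n) hα hα'
  have hs : MeasurableSet {q : ℝ × Vec n | 0 < q.1} := measurableSet_lt measurable_const measurable_fst
  have hterm : ∀ j : ℤ, StronglyMeasurable fun q : ℝ × Vec n => if 0 < q.1 then
      multiplierFun (fun ξ => blockSymbol j ξ * heatSymbol α q.1 ξ) v q.2 else 0 := fun j =>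
    (stronglyMeasurable_heatFlow_term α j v).ite hs stronglyMeasurable_const
  refine stronglyMeasurable_of_tendsto (atTop : Filter (Finset ℤ))
    (fun s => Finset.stronglyMeasurable_fun_sum s fun j _ => hterm j) ?_
  rw [tendsto_pi_nhds]
  intro q
  by_cases hq : 0 < q.1
  · simp only [hq, if_true]
    exact ((h v B hB hv q.1 hq).2 q.2).hasSum
  · simp only [hq, if_false, Finset.sum_const_zero]
    exact tendsto_const_nhds

/-! ### Reality of the heat flow -/

theorem multiplierFun_im {m : Vec n → ℂ} (hc : HasCompactSupport m) (hm : ContDiff ℝ ∞ m)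
    (h : ∀ ξ, (starRingEnd ℂ) (m ξ) = m (-ξ)) {v : 𝓢'(Vec n, ℂ)} (hv : IsRealDistribution v)
    (x : Vec n) : (multiplierFun m v x).im = 0 := by
  rw [multiplierFun_eq hc hm, TemperedDistribution.fourier_apply]
  refine hv _ fun y => ?_
  -- The Fourier transform is moved to the test function, whose Hermitian symmetry makes the
  -- transform real-valued; the real distribution v then takes a real value on it.
  have h1 := fourierInv_im_eq_zero (m := waveTest hc hm x)
    (fun ξ => by rw [waveTest_apply, waveTest_apply, map_mul, conj_wave, h]) (-y)
  rw [Real.fourierInv_eq_fourier_neg, neg_neg] at h1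
  exact h1

theorem heatFlow_im {v : 𝓢'(Vec n, ℂ)} (hv : IsRealDistribution v) (α t : ℝ) (x : Vec n) :
    (heatFlow α t v x).im = 0 := by
  have h1 : ∀ j : ℤ, (multiplierFun (fun ξ => blockSymbol j ξ * heatSymbol α t ξ) v x).im = 0 :=
    fun j => by
      refine multiplierFun_im ((hasCompactSupport_blockSymbol j).mul_right)
        (contDiff_block_heat α t j) (fun ξ => ?_) hv x
      change (starRingEnd ℂ) (blockSymbol j ξ * heatSymbol α t ξ) =
        blockSymbol j (-ξ) * heatSymbol α t (-ξ)
      rw [map_mul, conj_heatSymbol]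
      congr 1
      rw [blockSymbol, Complex.conj_ofReal, blockSymbol, smul_neg]
      simp [annulus, ballCutoff]
  unfold heatFlow
  rw [← Complex.conj_eq_iff_im, Complex.conj_tsum]
  exact tsum_congr fun j => Complex.conj_eq_iff_im.2 (h1 j)

end HeatFlow

end FracNS

namespace FracNS

/-! ### The Duhamel operator -/

section Duhamel

variable {n : ℕ}

/-! ### The Beta integral and pointwise bounds for the Duhamel term -/

theorem rpow_sub_mul_rpow_le {a b s t : ℝ} (ha : 0 ≤ a) (hb : 0 ≤ b) (hs : s ∈ Ioo 0 t) :
    (t - s) ^ (-a) * s ^ (-b) ≤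
      (t / 2) ^ (-a) * s ^ (-b) + (t / 2) ^ (-b) * (t - s) ^ (-a) := by
  have h0 : 0 < s := hs.1
  have h1 : 0 < t - s := sub_pos.2 hs.2
  have h2 : 0 < t / 2 := by linarith [hs.2]
  -- One of s and t - s is at least t/2, so only one of the two factors is singular at a time.
  rcases le_total s (t / 2) with h | h
  · have h3 : (t - s) ^ (-a) ≤ (t / 2) ^ (-a) :=
      Real.rpow_le_rpow_of_nonpos h2 (by linarith) (by linarith)
    have h4 : 0 ≤ (t / 2) ^ (-b) * (t - s) ^ (-a) := by positivity
    have h5 := mul_le_mul_of_nonneg_right h3 (Real.rpow_nonneg h0.le (-b))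
    linarith
  · have h3 : s ^ (-b) ≤ (t / 2) ^ (-b) :=
      Real.rpow_le_rpow_of_nonpos h2 h (by linarith)
    have h4 : 0 ≤ (t / 2) ^ (-a) * s ^ (-b) := by positivity
    have h5 := mul_le_mul_of_nonneg_left h3 (Real.rpow_nonneg h1.le (-a))
    linarith

/-- A bound for the Beta function. -/
noncomputable def betaConst (a b : ℝ) : ℝ := 2 ^ a / (1 - b) + 2 ^ b / (1 - a)

theorem betaConst_pos {a b : ℝ} (ha1 : a < 1) (hb1 : b < 1) : 0 < betaConst a b := by
  have h1 : 0 < 1 - a := by linarith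
  have h2 : 0 < 1 - b := by linarith
  unfold betaConst
  positivity

theorem integrableOn_rpow_sub_mul_rpow {a b : ℝ} (ha : 0 ≤ a) (ha1 : a < 1) (hb : 0 ≤ b)
    (hb1 : b < 1) {t : ℝ} (ht : 0 < t) :
    IntegrableOn (fun s => (t - s) ^ (-a) * s ^ (-b)) (Ioo 0 t) ∧
      ∫ s in Ioo 0 t, (t - s) ^ (-a) * s ^ (-b) ≤ betaConst a b * t ^ (1 - a - b) := by
  have i1 : IntegrableOn (fun s : ℝ => (t / 2) ^ (-a) * s ^ (-b)) (Ioo 0 t) := by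
    have h := (intervalIntegral.intervalIntegrable_rpow' (a := 0) (b := t) (r := -b)
      (by linarith)).const_mul ((t / 2) ^ (-a))
    rwa [intervalIntegrable_iff_integrableOn_Ioo_of_le ht.le] at h
  have h2 := ((intervalIntegral.intervalIntegrable_rpow' (a := 0) (b := t) (r := -a)
      (by linarith)).comp_sub_left t).symm
  simp only [sub_zero, sub_self] at h2
  have i2 : IntegrableOn (fun s : ℝ => (t / 2) ^ (-b) * (t - s) ^ (-a)) (Ioo 0 t) := by
    have h := h2.const_mul ((t / 2) ^ (-b))
    rwa [intervalIntegrable_iff_integrableOn_Ioo_of_le ht.le] at h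
  have hm : AEStronglyMeasurable (fun s => (t - s) ^ (-a) * s ^ (-b))
      (volume.restrict (Ioo 0 t)) := by
    have : Measurable fun s : ℝ => (t - s) ^ (-a) * s ^ (-b) := by fun_prop
    exact this.aestronglyMeasurable
  have hi : IntegrableOn (fun s => (t - s) ^ (-a) * s ^ (-b)) (Ioo 0 t) := by
    refine Integrable.mono' (i1.add i2) hm ?_
    filter_upwards [ae_restrict_mem measurableSet_Ioo] with s hs
    have h0 : 0 < s := hs.1
    have h1 : 0 < t - s := sub_pos.2 hs.2
    rw [Real.norm_of_nonneg (by positivity)]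
    exact rpow_sub_mul_rpow_le ha hb hs
  refine ⟨hi, (setIntegral_mono_on hi (i1.add i2) measurableSet_Ioo
    fun s hs => rpow_sub_mul_rpow_le ha hb hs).trans_eq ?_⟩
  simp only [Pi.add_apply]
  rw [integral_add i1 i2, integral_const_mul, integral_const_mul,
    ← integral_Ioc_eq_integral_Ioo, ← intervalIntegral.integral_of_le ht.le,
    ← integral_Ioc_eq_integral_Ioo, ← intervalIntegral.integral_of_le ht.le,
    intervalIntegral.integral_comp_sub_left (fun s => s ^ (-a)), sub_self, sub_zero,
    integral_rpow (Or.inl (by linarith)), integral_rpow (Or.inl (by linarith)),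
    Real.zero_rpow (by linarith), Real.zero_rpow (by linarith), sub_zero, sub_zero]
  have e : ∀ c d : ℝ, (t / 2) ^ (-c) * t ^ (-d + 1) = 2 ^ c * t ^ (1 - c - d) := fun c d => by
    rw [Real.div_rpow ht.le (by norm_num), Real.rpow_neg (by norm_num : (0 : ℝ) ≤ 2), div_inv_eq_mul,
      mul_right_comm, ← Real.rpow_add ht, mul_comm]
    congr 2
    ring
  rw [← mul_div_assoc, ← mul_div_assoc, e, e, betaConst, add_mul, sub_right_comm 1 b a]
  rw [show -b + 1 = 1 - b by ring, show -a + 1 = 1 - a by ring]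
  ring

theorem prod_restrict_Ioo_le {t : ℝ} :
    (volume.restrict (Ioo (0 : ℝ) t)).prod (volume : Measure (Vec n)) ≤
      volume.restrict (Ioi (0 : ℝ) ×ˢ (univ : Set (Vec n))) := by
  have h := Measure.prod_restrict (μ := (volume : Measure ℝ)) (ν := (volume : Measure (Vec n)))
    (Ioo 0 t) univ
  rw [Measure.restrict_univ] at h
  rw [h]
  exact Measure.restrict_mono (prod_mono Ioo_subset_Ioi_self subset_rfl) le_rfl

/-- `L¹` bounds `A t^{-1/(2α)}` for the Oseen kernels. -/
def OseenL1 (n : ℕ) (α A : ℝ) : Prop :=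
  ∀ t, 0 < t → ∀ i j k : Fin n, L1Le (oseenKernel α t i j k) (A * t ^ (-(1 / (2 * α))))

theorem aestronglyMeasurable_oseen_mul {α : ℝ} (i j k : Fin n) {f : ℝ → Vec n → ℂ}
    (hf : AEStronglyMeasurable (fun q : ℝ × Vec n => f q.1 q.2)
      (volume.restrict (Ioi (0 : ℝ) ×ˢ (univ : Set (Vec n))))) (t : ℝ) (x : Vec n) :
    AEStronglyMeasurable (fun z : ℝ × Vec n => oseenKernel α (t - z.1) i j k (x - z.2) * f z.1 z.2)
      ((volume.restrict (Ioo (0 : ℝ) t)).prod volume) := by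
  refine AEStronglyMeasurable.mul ?_ (hf.mono_measure prod_restrict_Ioo_le)
  have h1 : StronglyMeasurable fun z : ℝ × Vec n => oseenKernel α z.1 i j k z.2 :=
    stronglyMeasurable_oseenKernel α i j k
  have h2 : Measurable fun z : ℝ × Vec n => (t - z.1, x - z.2) := by fun_prop
  have h3 := h1.comp_measurable h2
  simp only [Function.comp_def] at h3
  exact h3.aestronglyMeasurable

/-- By Tonelli, the integral in y is at most A(t-s)^(-p) M s^(-b), and the remaining integral in s
is a Beta integral. Joint integrability at a fixed x is what allows sums and the order of
integration to be exchanged later. -/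
theorem integrable_oseen_mul {α : ℝ} (hα : 1 / 2 < α) {A : ℝ} (hA : OseenL1 n α A) {b : ℝ}
    (hb : 0 ≤ b) (hb1 : b < 1) (i j k : Fin n) {f : ℝ → Vec n → ℂ}
    (hf : AEStronglyMeasurable (fun q : ℝ × Vec n => f q.1 q.2)
      (volume.restrict (Ioi (0 : ℝ) ×ˢ (univ : Set (Vec n))))) {M : ℝ} (hM : 0 ≤ M)
    (hfb : ∀ s, 0 < s → ∀ᵐ y, ‖f s y‖ ≤ M * s ^ (-b)) {t : ℝ} (ht : 0 < t) (x : Vec n) :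
    Integrable (fun z : ℝ × Vec n => oseenKernel α (t - z.1) i j k (x - z.2) * f z.1 z.2)
      ((volume.restrict (Ioo (0 : ℝ) t)).prod volume) ∧
    ∫ z, ‖oseenKernel α (t - z.1) i j k (x - z.2) * f z.1 z.2‖
      ∂((volume.restrict (Ioo (0 : ℝ) t)).prod (volume : Measure (Vec n))) ≤
      A * M * (betaConst (1 / (2 * α)) b * t ^ (1 - 1 / (2 * α) - b)) := by
  set p := 1 / (2 * α) with hp
  have hp0 : 0 ≤ p := by positivity
  have hp1 : p < 1 := by rw [hp, div_lt_one (by linarith)]; linarith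
  have hm := aestronglyMeasurable_oseen_mul (α := α) i j k hf t x
  obtain ⟨hβi, hβ⟩ := integrableOn_rpow_sub_mul_rpow hp0 hp1 hb hb1 ht
  have hpt : ∀ s ∈ Ioo 0 t, ∀ᵐ y, ‖oseenKernel α (t - s) i j k (x - y) * f s y‖ ≤
      ‖oseenKernel α (t - s) i j k (x - y)‖ * (M * s ^ (-b)) := fun s hs => by
    filter_upwards [hfb s hs.1] with y hy
    rw [norm_mul]
    exact mul_le_mul_of_nonneg_left hy (norm_nonneg _)
  have hKi : ∀ s ∈ Ioo 0 t, Integrable fun y =>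
      ‖oseenKernel α (t - s) i j k (x - y)‖ * (M * s ^ (-b)) := fun s hs =>
    ((hA (t - s) (sub_pos.2 hs.2) i j k).1.comp_sub_left x).norm.mul_const _
  have hslice : ∀ᵐ s ∂volume.restrict (Ioo 0 t), Integrable fun y =>
      oseenKernel α (t - s) i j k (x - y) * f s y := by
    filter_upwards [hm.prodMk_left, ae_restrict_mem measurableSet_Ioo] with s hsm hs
    exact Integrable.mono' (hKi s hs) hsm (hpt s hs)
  have hle : ∀ᵐ s ∂volume.restrict (Ioo 0 t),
      ∫ y, ‖oseenKernel α (t - s) i j k (x - y) * f s y‖ ≤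
        A * M * ((t - s) ^ (-p) * s ^ (-b)) := by
    filter_upwards [hslice, ae_restrict_mem measurableSet_Ioo] with s hsi hs
    refine (integral_mono_ae hsi.norm (hKi s hs) (hpt s hs)).trans ?_
    rw [integral_mul_const,
      integral_sub_left_eq_self (fun y => ‖oseenKernel α (t - s) i j k y‖) volume x]
    have h0 : 0 < s := hs.1
    refine (mul_le_mul_of_nonneg_right (hA (t - s) (sub_pos.2 hs.2) i j k).2
      (by positivity)).trans_eq ?_
    ring
  have hnm : AEStronglyMeasurable (fun s => ∫ y, ‖oseenKernel α (t - s) i j k (x - y) * f s y‖)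
      (volume.restrict (Ioo 0 t)) := hm.norm.integral_prod_right'
  have hni : Integrable (fun s => ∫ y, ‖oseenKernel α (t - s) i j k (x - y) * f s y‖)
      (volume.restrict (Ioo 0 t)) := by
    refine Integrable.mono' (hβi.const_mul (A * M)) hnm ?_
    filter_upwards [hle] with s hs
    rwa [Real.norm_of_nonneg (integral_nonneg fun _ => norm_nonneg _)]
  have hint := (integrable_prod_iff hm).2 ⟨hslice, hni⟩
  refine ⟨hint, ?_⟩
  rw [integral_prod _ hint.norm]
  refine (integral_mono_ae hni (hβi.const_mul (A * M)) hle).trans ?_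
  rw [integral_const_mul]
  have hAM : 0 ≤ A * M := by
    have := (hA 1 one_pos i j k).nonneg
    rw [Real.one_rpow, mul_one] at this
    positivity
  exact mul_le_mul_of_nonneg_left hβ hAM

/-- The Duhamel operator acting on tensor fields. -/
noncomputable def duhamelOp (α : ℝ) (F : Fin n → Fin n → ℝ → Vec n → ℂ) (t : ℝ) (x : Vec n)
    (i : Fin n) : ℂ :=
  ∫ s in (0 : ℝ)..t, ∫ y : Vec n, ∑ j, ∑ k, oseenKernel α (t - s) i j k (x - y) * F j k s y

/-- Measurability and the weighted `L^∞` bound of a tensor field. -/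
structure TensorBound (b M : ℝ) (F : Fin n → Fin n → ℝ → Vec n → ℂ) : Prop where
  meas : ∀ j k, AEStronglyMeasurable (fun q : ℝ × Vec n => F j k q.1 q.2)
    (volume.restrict (Ioi (0 : ℝ) ×ˢ (univ : Set (Vec n))))
  bound : ∀ j k s, 0 < s → ∀ᵐ y, ‖F j k s y‖ ≤ M * s ^ (-b)

theorem duhamelOp_eq_sum {α : ℝ} (hα : 1 / 2 < α) {A : ℝ} (hA : OseenL1 n α A) {b : ℝ}
    (hb : 0 ≤ b) (hb1 : b < 1) {M : ℝ} (hM : 0 ≤ M) {F : Fin n → Fin n → ℝ → Vec n → ℂ}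
    (hF : TensorBound b M F) {t : ℝ} (ht : 0 < t) (x : Vec n) (i : Fin n) :
    duhamelOp α F t x i = ∑ j, ∑ k, ∫ z, oseenKernel α (t - z.1) i j k (x - z.2) * F j k z.1 z.2
      ∂((volume.restrict (Ioo (0 : ℝ) t)).prod volume) := by
  have hi := fun j k => (integrable_oseen_mul hα hA hb hb1 i j k (hF.meas j k) hM
    (hF.bound j k) ht x).1
  have hi' := fun j => integrable_finsetSum Finset.univ fun k (_ : k ∈ Finset.univ) => hi j k
  have hi'' := integrable_finsetSum Finset.univ fun j (_ : j ∈ Finset.univ) => hi' j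
  rw [duhamelOp, intervalIntegral.integral_of_le ht.le, integral_Ioc_eq_integral_Ioo]
  have h1 := integral_prod _ hi''
  refine h1.symm.trans ?_
  rw [integral_finsetSum _ fun j _ => hi' j]
  exact Finset.sum_congr rfl fun j _ => integral_finsetSum _ fun k _ => hi j k

theorem norm_duhamelOp_le {α : ℝ} (hα : 1 / 2 < α) {A : ℝ} (hA : OseenL1 n α A) {b : ℝ}
    (hb : 0 ≤ b) (hb1 : b < 1) {M : ℝ} (hM : 0 ≤ M) {F : Fin n → Fin n → ℝ → Vec n → ℂ}
    (hF : TensorBound b M F) {t : ℝ} (ht : 0 < t) (x : Vec n) (i : Fin n) :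
    ‖duhamelOp α F t x i‖ ≤
      n ^ 2 * A * betaConst (1 / (2 * α)) b * M * t ^ (1 - 1 / (2 * α) - b) := by
  rw [duhamelOp_eq_sum hα hA hb hb1 hM hF ht]
  have h := fun j k => (norm_integral_le_integral_norm _).trans (integrable_oseen_mul hα hA hb hb1 i
    j k (hF.meas j k) hM (hF.bound j k) ht x).2
  refine (norm_sum_le_of_le _ fun j _ => norm_sum_le_of_le _ fun k _ => h j k).trans_eq ?_
  simp only [Finset.sum_const, Finset.card_univ, Fintype.card_fin, nsmul_eq_mul]
  ring

theorem duhamelOp_sub {α : ℝ} (hα : 1 / 2 < α) {A : ℝ} (hA : OseenL1 n α A) {b : ℝ}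
    (hb : 0 ≤ b) (hb1 : b < 1) {M N : ℝ} (hM : 0 ≤ M) (hN : 0 ≤ N)
    {F G : Fin n → Fin n → ℝ → Vec n → ℂ} (hF : TensorBound b M F) (hG : TensorBound b N G)
    {t : ℝ} (ht : 0 < t) (x : Vec n) (i : Fin n) :
    duhamelOp α F t x i - duhamelOp α G t x i =
      duhamelOp α (fun j k s y => F j k s y - G j k s y) t x i := by
  have hFG : TensorBound b (M + N) (fun j k s y => F j k s y - G j k s y) :=
    ⟨fun j k => (hF.meas j k).sub (hG.meas j k), fun j k s hs => by
      filter_upwards [hF.bound j k s hs, hG.bound j k s hs] with y h1 h2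
      rw [add_mul]
      exact (norm_sub_le _ _).trans (add_le_add h1 h2)⟩
  rw [duhamelOp_eq_sum hα hA hb hb1 hM hF ht, duhamelOp_eq_sum hα hA hb hb1 hN hG ht,
    duhamelOp_eq_sum hα hA hb hb1 (add_nonneg hM hN) hFG ht, ← Finset.sum_sub_distrib]
  refine Finset.sum_congr rfl fun j _ => ?_
  rw [← Finset.sum_sub_distrib]
  refine Finset.sum_congr rfl fun k _ => ?_
  rw [← integral_sub (integrable_oseen_mul hα hA hb hb1 i j k (hF.meas j k) hM
    (hF.bound j k) ht x).1 (integrable_oseen_mul hα hA hb hb1 i j k (hG.meas j k) hN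
    (hG.bound j k) ht x).1]
  simp only [mul_sub]

theorem duhamelOp_im {α : ℝ} {F : Fin n → Fin n → ℝ → Vec n → ℂ} {t : ℝ} (ht : 0 < t)
    (hF : ∀ j k s, 0 < s → ∀ y, (F j k s y).im = 0) (x : Vec n) (i : Fin n) :
    (duhamelOp α F t x i).im = 0 := by
  rw [duhamelOp, intervalIntegral.integral_of_le ht.le, ← Complex.conj_eq_iff_im, ← integral_conj]
  refine setIntegral_congr_fun measurableSet_Ioc fun s hs => ?_
  change (starRingEnd ℂ) (∫ y, _) = _
  rw [← integral_conj]
  refine integral_congr_ae (Eventually.of_forall fun y => ?_)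
  simp only [map_sum, map_mul]
  refine Finset.sum_congr rfl fun j _ => Finset.sum_congr rfl fun k _ => ?_
  rw [Complex.conj_eq_iff_im.2 (oseenKernel_im α (t - s) i j k (x - y)),
    Complex.conj_eq_iff_im.2 (hF j k s hs.1 y)]

theorem stronglyMeasurable_duhamelOp {α : ℝ} {F : Fin n → Fin n → ℝ → Vec n → ℂ}
    (hF : ∀ j k, StronglyMeasurable fun q : ℝ × Vec n => F j k q.1 q.2) (i : Fin n) :
    StronglyMeasurable fun q : ℝ × Vec n => if 0 < q.1 then duhamelOp α F q.1 q.2 i else 0 := by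
  have h1 : StronglyMeasurable fun z : ((ℝ × Vec n) × ℝ) × Vec n =>
      ∑ j, ∑ k, oseenKernel α (z.1.1.1 - z.1.2) i j k (z.1.1.2 - z.2) * F j k z.1.2 z.2 := by
    refine Finset.stronglyMeasurable_fun_sum _ fun j _ =>
      Finset.stronglyMeasurable_fun_sum _ fun k _ => StronglyMeasurable.mul ?_ ?_
    · have h1 : StronglyMeasurable fun z : ℝ × Vec n => oseenKernel α z.1 i j k z.2 :=
        stronglyMeasurable_oseenKernel α i j k
      have h2 : Measurable fun z : ((ℝ × Vec n) × ℝ) × Vec n =>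
        (z.1.1.1 - z.1.2, z.1.1.2 - z.2) := by fun_prop
      have h3 := h1.comp_measurable h2
      simpa only [Function.comp_def] using h3
    · have h2 : Measurable fun z : ((ℝ × Vec n) × ℝ) × Vec n => (z.1.2, z.2) := by fun_prop
      have h3 := (hF j k).comp_measurable h2
      simpa only [Function.comp_def] using h3
  have h2 := h1.integral_prod_right' (ν := volume)
  -- The variable interval (0, t) becomes an indicator, so that the time integral is over a fixed
  -- space and depends measurably on (t, x).
  have hs : MeasurableSet {z : (ℝ × Vec n) × ℝ | 0 < z.2 ∧ z.2 < z.1.1} :=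
    (measurableSet_lt measurable_const measurable_snd).inter
      (measurableSet_lt measurable_snd (measurable_fst.comp measurable_fst))
  have h3 := (h2.indicator hs).integral_prod_right' (ν := volume)
  have e : (fun q : ℝ × Vec n => if 0 < q.1 then duhamelOp α F q.1 q.2 i else 0) =
      fun q => ∫ s, {z : (ℝ × Vec n) × ℝ | 0 < z.2 ∧ z.2 < z.1.1}.indicator (fun z =>
        ∫ y, ∑ j, ∑ k, oseenKernel α (z.1.1 - z.2) i j k (z.1.2 - y) * F j k z.2 y) (q, s) := by
    funext q
    have e1 : ∀ s : ℝ, {z : (ℝ × Vec n) × ℝ | 0 < z.2 ∧ z.2 < z.1.1}.indicator (fun z =>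
        ∫ y, ∑ j, ∑ k, oseenKernel α (z.1.1 - z.2) i j k (z.1.2 - y) * F j k z.2 y) (q, s) =
        (Ioo 0 q.1).indicator (fun s =>
          ∫ y, ∑ j, ∑ k, oseenKernel α (q.1 - s) i j k (q.2 - y) * F j k s y) s := fun s => rfl
    simp only [e1]
    rw [integral_indicator measurableSet_Ioo]
    split_ifs with hq
    · rw [duhamelOp, intervalIntegral.integral_of_le hq.le, integral_Ioc_eq_integral_Ioo]
    · rw [Ioo_eq_empty hq, Measure.restrict_empty, integral_zero_measure]
  rw [e]
  exact h3

/-- Uniform kernel bounds for the derivatives of the Oseen kernels. -/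
def OseenKernelBound (n : ℕ) (α δ A : ℝ) : Prop :=
  ∀ t, 0 < t → ∀ i j k : Fin n, KernelBound volume (δ * t ^ (1 / (2 * α)))
    (A * t ^ (-(1 / (2 * α)))) (oseenDeriv α t i j k)

theorem OseenKernelBound.oseenL1 {α δ A : ℝ} (h : OseenKernelBound n α δ A) : OseenL1 n α A := by
  intro t ht i j k
  have h1 := h t ht i j k
  have h2 := h1.bound []
  rw [oseenDeriv_nil, List.length_nil, anaWeight_zero, mul_one, normProd_nil, mul_one] at h2
  have h3 := h1.integrable []
  rw [oseenDeriv_nil] at h3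
  exact ⟨h3, h2⟩

/-- The point is that the constant δ' in the radius is the same before and after: convolution adds
the radii at times t - s and s, and τ ↦ τ^p is subadditive. The factor 16 comes from `AnaBound.conv`
and n² from the sum over j and k. -/
theorem AnaBound.duhamelOp {α : ℝ} (hα : 1 / 2 < α) {δ A : ℝ} (hδ : 0 < δ)
    (hA : OseenKernelBound n α δ A) {b : ℝ} (hb : 0 ≤ b) (hb1 : b < 1) {M : ℝ} (hM : 0 ≤ M)
    {F : Fin n → Fin n → ℝ → Vec n → ℂ}
    (hFm : ∀ j k, AEStronglyMeasurable (fun q : ℝ × Vec n => F j k q.1 q.2)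
      (volume.restrict (Ioi (0 : ℝ) ×ˢ (univ : Set (Vec n)))))
    {δ' : ℝ} (hδ' : 0 < δ') (hδδ' : δ' ≤ δ)
    (hF : ∀ j k s, 0 < s → AnaBound (δ' * s ^ (1 / (2 * α))) (M * s ^ (-b)) (F j k s))
    {t : ℝ} (ht : 0 < t) (i : Fin n) :
    AnaBound (δ' * t ^ (1 / (2 * α)))
      (16 * n ^ 2 * A * betaConst (1 / (2 * α)) b * M * t ^ (1 - 1 / (2 * α) - b))
      (fun x => FracNS.duhamelOp α F t x i) := by
  set p := 1 / (2 * α) with hp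
  have hp0 : 0 ≤ p := by positivity
  have hp1 : p < 1 := by rw [hp, div_lt_one (by linarith)]; linarith
  have hTB : TensorBound b M F :=
    ⟨hFm, fun j k s hs => Eventually.of_forall fun y => (hF j k s hs).norm_le y⟩
  have hA0 : 0 ≤ A := by
    have := (hA 1 one_pos i i i).nonneg
    rwa [Real.one_rpow, mul_one] at this
  have hr : 0 < δ' * t ^ p := by positivity
  have hint := fun x j k => (integrable_oseen_mul hα hA.oseenL1 hb hb1 i j k (hFm j k) hM
    (hTB.bound j k) ht x).1
  obtain ⟨hβi, hβ⟩ := integrableOn_rpow_sub_mul_rpow hp0 hp1 hb hb1 ht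
  have e : (fun x => FracNS.duhamelOp α F t x i) = fun x => ∑ j, ∑ k, ∫ s in Ioo 0 t,
      ∫ y, oseenKernel α (t - s) i j k (x - y) * F j k s y := by
    funext x
    rw [duhamelOp_eq_sum hα hA.oseenL1 hb hb1 hM hTB ht]
    exact Finset.sum_congr rfl fun j _ => Finset.sum_congr rfl fun k _ =>
      integral_prod _ (hint x j k)
  have hjk : ∀ j k, AnaBound (δ' * t ^ p) (16 * A * M * (betaConst p b * t ^ (1 - p - b)))
      (fun x => ∫ s in Ioo 0 t, ∫ y, oseenKernel α (t - s) i j k (x - y) * F j k s y) := by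
    intro j k
    have h1 : ∀ᵐ s ∂volume.restrict (Ioo 0 t), AnaBound (δ' * t ^ p)
        (16 * A * M * ((t - s) ^ (-p) * s ^ (-b)))
        (fun x => ∫ y, oseenKernel α (t - s) i j k (x - y) * F j k s y) := by
      filter_upwards [ae_restrict_mem measurableSet_Ioo] with s hs
      have hs0 : 0 < s := hs.1
      have hs1 : 0 < t - s := sub_pos.2 hs.2
      have h2 := AnaBound.conv (by positivity) (by positivity) (hA (t - s) hs1 i j k)
        (hF j k s hs0)
      rw [oseenDeriv_nil] at h2
      -- Subadditivity of the power p ≤ 1, together with δ' ≤ δ; the radius obtained is independent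
      -- of s, so the integral in s can be taken.
      have h3 : δ' * t ^ p ≤ δ * (t - s) ^ p + δ' * s ^ p := by
        have h4 := Real.rpow_add_le_add_rpow hs1.le hs0.le hp0 hp1.le
        rw [sub_add_cancel] at h4
        have h5 : 0 ≤ (t - s) ^ p := by positivity
        nlinarith [mul_le_mul_of_nonneg_left h4 hδ'.le, mul_le_mul_of_nonneg_right hδδ' h5]
      have h4 := (h2.anti hr h3).mono hr (le_of_eq (by ring :
        16 * (A * (t - s) ^ (-p) * (M * s ^ (-b))) = 16 * A * M * ((t - s) ^ (-p) * s ^ (-b))))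
      have e1 : (fun x => ∫ y, oseenKernel α (t - s) i j k (x - y) * F j k s y) =
          fun x => ∫ y, oseenKernel α (t - s) i j k y * F j k s (x - y) := by
        funext x
        rw [← integral_sub_left_eq_self _ volume x]
        simp only [sub_sub_cancel]
      rw [e1]
      exact h4
    have h2 := AnaBound.integral hr h1 (hβi.const_mul _) fun x =>
      (aestronglyMeasurable_oseen_mul (α := α) i j k (hFm j k) t x).integral_prod_right'
    refine h2.mono hr ?_
    rw [integral_const_mul]
    exact mul_le_mul_of_nonneg_left hβ (by positivity)
  rw [e]
  refine (AnaBound.sum fun j _ => AnaBound.sum fun k _ => hjk j k).mono hr (le_of_eq ?_)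
  simp only [Finset.sum_const, Finset.card_univ, Fintype.card_fin, nsmul_eq_mul]
  ring

end Duhamel

end FracNS

namespace FracNS

/-! ### The fixed point -/

section FixedPoint

variable {n : ℕ}

/-- The tensor product of two fields. -/
def tensorField (U V : Fin n → ℝ → Vec n → ℂ) (j k : Fin n) (s : ℝ) (y : Vec n) : ℂ :=
  U j s y * V k s y

/-- Weighted `L^∞` bounds of a field. -/
structure SupField (α M : ℝ) (U : Fin n → ℝ → Vec n → ℂ) : Prop where
  meas : ∀ j, AEStronglyMeasurable (fun q : ℝ × Vec n => U j q.1 q.2)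
    (volume.restrict (Ioi (0 : ℝ) ×ˢ (univ : Set (Vec n))))
  bound : ∀ j s, 0 < s → ∀ᵐ y, ‖U j s y‖ ≤ M * s ^ (-(1 - 1 / (2 * α)))

/-- Weighted analytic bounds of a field. -/
structure AnaField (α δ M : ℝ) (U : Fin n → ℝ → Vec n → ℂ) : Prop where
  meas : ∀ j, StronglyMeasurable fun q : ℝ × Vec n => U j q.1 q.2
  bound : ∀ j s, 0 < s →
    AnaBound (δ * s ^ (1 / (2 * α))) (M * s ^ (-(1 - 1 / (2 * α)))) (U j s)

theorem AnaField.supField {α δ M : ℝ} {U : Fin n → ℝ → Vec n → ℂ} (hU : AnaField α δ M U) :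
    SupField α M U :=
  ⟨fun j => (hU.meas j).aestronglyMeasurable,
    fun j s hs => Eventually.of_forall fun y => (hU.bound j s hs).norm_le y⟩

theorem AnaField.mono {α δ M N : ℝ} (hδ : 0 < δ) {U : Fin n → ℝ → Vec n → ℂ}
    (hU : AnaField α δ M U) (h : M ≤ N) : AnaField α δ N U :=
  ⟨hU.meas, fun j s hs => (hU.bound j s hs).mono (by positivity) (by gcongr)⟩

theorem AnaField.sub {α δ M N : ℝ} {U V : Fin n → ℝ → Vec n → ℂ} (hU : AnaField α δ M U)
    (hV : AnaField α δ N V) : AnaField α δ (M + N) (fun j s y => U j s y - V j s y) :=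
  ⟨fun j => (hU.meas j).sub (hV.meas j), fun j s hs => by
    rw [add_mul]
    exact (hU.bound j s hs).sub (hV.bound j s hs)⟩

theorem rpow_neg_sq (α : ℝ) {s : ℝ} (hs : 0 < s) :
    s ^ (-(1 - 1 / (2 * α))) * s ^ (-(1 - 1 / (2 * α))) = s ^ (-(2 * (1 - 1 / (2 * α)))) := by
  rw [← Real.rpow_add hs]
  congr 1
  ring

theorem SupField.tensor {α M N : ℝ} {U V : Fin n → ℝ → Vec n → ℂ}
    (hU : SupField α M U) (hV : SupField α N V) :
    TensorBound (2 * (1 - 1 / (2 * α))) (M * N) (tensorField U V) := by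
  refine ⟨fun j k => (hU.meas j).mul (hV.meas k), fun j k s hs => ?_⟩
  filter_upwards [hU.bound j s hs, hV.bound k s hs] with y h1 h2
  rw [tensorField, norm_mul, ← rpow_neg_sq α hs]
  refine (mul_le_mul h1 h2 (norm_nonneg _) ((norm_nonneg _).trans h1)).trans_eq ?_
  ring

/-- The quadratic Lipschitz estimate in the weighted `L^∞` norm. -/
theorem norm_duhamelOp_sub_le {α : ℝ} (hα : 1 / 2 < α) (hα' : α < 1) {A : ℝ}
    (hA : OseenL1 n α A) {M D : ℝ} (hM : 0 ≤ M) (hD : 0 ≤ D) {U V : Fin n → ℝ → Vec n → ℂ}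
    (hU : SupField α M U) (hV : SupField α M V)
    (hUV : ∀ j s, 0 < s → ∀ᵐ y, ‖U j s y - V j s y‖ ≤ D * s ^ (-(1 - 1 / (2 * α))))
    {t : ℝ} (ht : 0 < t) (x : Vec n) (i : Fin n) :
    ‖duhamelOp α (tensorField U U) t x i - duhamelOp α (tensorField V V) t x i‖ ≤
      n ^ 2 * A * betaConst (1 / (2 * α)) (2 * (1 - 1 / (2 * α))) * (2 * M * D) *
        t ^ (-(1 - 1 / (2 * α))) := by
  have hp1 : 1 / (2 * α) < 1 := by rw [div_lt_one (by linarith)]; linarith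
  -- This is where α < 1 enters: p > 1/2 makes the squared weight s^(-2(1-p)) integrable at s = 0.
  have hp2 : 1 / 2 < 1 / (2 * α) := one_div_lt_one_div_of_lt (by linarith) (by linarith)
  have hb : 0 ≤ 2 * (1 - 1 / (2 * α)) := by linarith
  have hb1 : 2 * (1 - 1 / (2 * α)) < 1 := by linarith
  rw [duhamelOp_sub hα hA hb hb1 (mul_nonneg hM hM) (mul_nonneg hM hM) (hU.tensor hU)
    (hV.tensor hV) ht]
  have hT : TensorBound (2 * (1 - 1 / (2 * α))) (2 * M * D)
      (fun j k s y => tensorField U U j k s y - tensorField V V j k s y) := by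
    refine ⟨fun j k => ((hU.tensor hU).meas j k).sub ((hV.tensor hV).meas j k),
      fun j k s hs => ?_⟩
    filter_upwards [hU.bound k s hs, hV.bound j s hs, hUV j s hs, hUV k s hs] with y h1 h2 h3 h4
    have e : tensorField U U j k s y - tensorField V V j k s y =
        (U j s y - V j s y) * U k s y + V j s y * (U k s y - V k s y) := by
      unfold tensorField
      ring
    rw [e, ← rpow_neg_sq α hs]
    refine (norm_add_le _ _).trans ?_
    rw [norm_mul, norm_mul]
    have h5 := mul_le_mul h3 h1 (norm_nonneg _) ((norm_nonneg _).trans h3)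
    have h6 := mul_le_mul h2 h4 (norm_nonneg _) ((norm_nonneg _).trans h2)
    refine (add_le_add h5 h6).trans_eq ?_
    ring
  have h := norm_duhamelOp_le hα hA hb hb1 (by positivity : 0 ≤ 2 * M * D) hT ht x i
  rwa [show 1 - 1 / (2 * α) - 2 * (1 - 1 / (2 * α)) = -(1 - 1 / (2 * α)) by ring] at h

/-- The bilinear term of the equation. -/
noncomputable def bilinearTerm (α : ℝ) (F : Fin n → Fin n → ℝ → Vec n → ℂ) (i : Fin n) (t : ℝ)
    (x : Vec n) : ℂ :=
  if 0 < t then duhamelOp α F t x i else 0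

theorem anaField_bilinearTerm {α : ℝ} (hα : 1 / 2 < α) (hα' : α < 1) {δ₀ δ A : ℝ} (hδ₀ : 0 < δ₀)
    (hA : OseenKernelBound n α δ₀ A) (hδ : 0 < δ) (hδδ : δ ≤ δ₀) {M : ℝ} (hM : 0 ≤ M)
    {F : Fin n → Fin n → ℝ → Vec n → ℂ}
    (hFm : ∀ j k, StronglyMeasurable fun q : ℝ × Vec n => F j k q.1 q.2)
    (hF : ∀ j k s, 0 < s → AnaBound (δ * s ^ (1 / (2 * α)))
      (M * s ^ (-(2 * (1 - 1 / (2 * α))))) (F j k s)) :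
    AnaField α δ (16 * n ^ 2 * A * betaConst (1 / (2 * α)) (2 * (1 - 1 / (2 * α))) * M)
      (bilinearTerm α F) := by
  have hp1 : 1 / (2 * α) < 1 := by rw [div_lt_one (by linarith)]; linarith
  have hp2 : 1 / 2 < 1 / (2 * α) := one_div_lt_one_div_of_lt (by linarith) (by linarith)
  have hb : 0 ≤ 2 * (1 - 1 / (2 * α)) := by linarith
  have hb1 : 2 * (1 - 1 / (2 * α)) < 1 := by linarith
  refine ⟨fun i => stronglyMeasurable_duhamelOp hFm i, fun i t ht => ?_⟩
  have h := AnaBound.duhamelOp hα hδ₀ hA hb hb1 hM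
    (fun j k => (hFm j k).aestronglyMeasurable) hδ hδδ hF ht i
  rw [show 1 - 1 / (2 * α) - 2 * (1 - 1 / (2 * α)) = -(1 - 1 / (2 * α)) by ring] at h
  have e : bilinearTerm α F i t = fun x => FracNS.duhamelOp α F t x i := by
    funext x
    rw [bilinearTerm, if_pos ht]
  rwa [e]

theorem AnaField.tensor_bound {α δ M N : ℝ} (hδ : 0 < δ) {U V : Fin n → ℝ → Vec n → ℂ}
    (hU : AnaField α δ M U) (hV : AnaField α δ N V) (j k : Fin n) {s : ℝ} (hs : 0 < s) :
    AnaBound (δ * s ^ (1 / (2 * α))) (16 * (M * N) * s ^ (-(2 * (1 - 1 / (2 * α)))))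
      (tensorField U V j k s) := by
  refine ((hU.bound j s hs).mul (by positivity) (hV.bound k s hs)).mono (by positivity)
    (le_of_eq ?_)
  rw [← rpow_neg_sq α hs]
  ring

/-- The constant of the bilinear estimate. -/
noncomputable def bilinearConst (n : ℕ) (α A : ℝ) : ℝ :=
  256 * n ^ 2 * A * betaConst (1 / (2 * α)) (2 * (1 - 1 / (2 * α)))

theorem anaField_bilinear {α : ℝ} (hα : 1 / 2 < α) (hα' : α < 1) {δ₀ δ A : ℝ} (hδ₀ : 0 < δ₀)
    (hA : OseenKernelBound n α δ₀ A) (hδ : 0 < δ) (hδδ : δ ≤ δ₀) {M : ℝ} (hM : 0 ≤ M)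
    {U : Fin n → ℝ → Vec n → ℂ} (hU : AnaField α δ M U) :
    AnaField α δ (bilinearConst n α A * M ^ 2) (bilinearTerm α (tensorField U U)) := by
  -- Two factors 16 arise, one from the product of two components and one from the convolution; they
  -- make up the 256 of `bilinearConst`.
  have h := anaField_bilinearTerm hα hα' hδ₀ hA hδ hδδ (by positivity : 0 ≤ 16 * (M * M))
    (fun j k => (hU.meas j).mul (hU.meas k)) (fun j k s hs => hU.tensor_bound hδ hU j k hs)
  refine h.mono hδ (le_of_eq ?_)
  unfold bilinearConst
  ring

theorem anaField_bilinear_sub {α : ℝ} (hα : 1 / 2 < α) (hα' : α < 1) {δ₀ δ A : ℝ} (hδ₀ : 0 < δ₀)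
    (hA : OseenKernelBound n α δ₀ A) (hδ : 0 < δ) (hδδ : δ ≤ δ₀) {M D : ℝ} (hM : 0 ≤ M)
    (hD : 0 ≤ D) {U V : Fin n → ℝ → Vec n → ℂ} (hU : AnaField α δ M U) (hV : AnaField α δ M V)
    (hUV : AnaField α δ D fun j s y => U j s y - V j s y) :
    AnaField α δ (2 * bilinearConst n α A * M * D) (fun i t x =>
      bilinearTerm α (tensorField U U) i t x - bilinearTerm α (tensorField V V) i t x) := by
  have hp1 : 1 / (2 * α) < 1 := by rw [div_lt_one (by linarith)]; linarith
  have hp2 : 1 / 2 < 1 / (2 * α) := one_div_lt_one_div_of_lt (by linarith) (by linarith)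
  have hb : 0 ≤ 2 * (1 - 1 / (2 * α)) := by linarith
  have hb1 : 2 * (1 - 1 / (2 * α)) < 1 := by linarith
  have h := anaField_bilinearTerm (F := fun j k s y =>
      tensorField U U j k s y - tensorField V V j k s y) hα hα' hδ₀ hA hδ hδδ
    (by positivity : 0 ≤ 16 * (D * M) + 16 * (M * D))
    (fun j k => ((hU.meas j).mul (hU.meas k)).sub ((hV.meas j).mul (hV.meas k)))
    (fun j k s hs => by
      have h1 := (hUV.tensor_bound hδ hU j k hs).add (hV.tensor_bound hδ hUV j k hs)
      rw [← add_mul] at h1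
      have e : (fun y => tensorField U U j k s y - tensorField V V j k s y) =
          fun y => tensorField (fun j s y => U j s y - V j s y) U j k s y +
            tensorField V (fun j s y => U j s y - V j s y) j k s y := by
        funext y
        unfold tensorField
        ring
      rwa [e])
  have e : (fun i t x => bilinearTerm α (tensorField U U) i t x -
      bilinearTerm α (tensorField V V) i t x) = bilinearTerm α (fun j k s y =>
      tensorField U U j k s y - tensorField V V j k s y) := by
    funext i t x
    unfold bilinearTerm
    split_ifs with ht
    · exact duhamelOp_sub hα hA.oseenL1 hb hb1 (mul_nonneg hM hM) (mul_nonneg hM hM)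
        (hU.supField.tensor hU.supField) (hV.supField.tensor hV.supField) ht x i
    · exact sub_zero 0
  rw [e]
  refine h.mono hδ (le_of_eq ?_)
  unfold bilinearConst
  ring

/-- The Picard iterates. -/
noncomputable def picard (α : ℝ) (H : Fin n → ℝ → Vec n → ℂ) : ℕ → Fin n → ℝ → Vec n → ℂ
  | 0 => H
  | m + 1 => fun i t x =>
      H i t x - bilinearTerm α (tensorField (picard α H m) (picard α H m)) i t x

/-- With κR ≤ 1/4 the ball of radius R is preserved, since R/2 + κR² ≤ R, and successive differences
are halved, since 2κR ≤ 1/2. The first difference is the bilinear term of H, at most κR² ≤ R/2. All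
this holds in the analytic norm with the same δ. -/
theorem anaField_picard {α : ℝ} (hα : 1 / 2 < α) (hα' : α < 1) {δ₀ δ A : ℝ} (hδ₀ : 0 < δ₀)
    (hA : OseenKernelBound n α δ₀ A) (hδ : 0 < δ) (hδδ : δ ≤ δ₀) {R : ℝ} (hR : 0 ≤ R)
    (hκ : bilinearConst n α A * R ≤ 1 / 4) {H : Fin n → ℝ → Vec n → ℂ}
    (hH : AnaField α δ (R / 2) H) (m : ℕ) :
    AnaField α δ R (picard α H m) ∧ AnaField α δ (R / 2 * (1 / 2) ^ m)
      (fun i t x => picard α H (m + 1) i t x - picard α H m i t x) := by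
  have hmem : ∀ m, AnaField α δ R (picard α H m) := fun m => by
    induction m with
    | zero => exact hH.mono hδ (by linarith)
    | succ m ih =>
      refine (hH.sub (anaField_bilinear hα hα' hδ₀ hA hδ hδδ hR ih)).mono hδ ?_
      have := mul_le_mul_of_nonneg_right hκ hR
      nlinarith
  refine ⟨hmem m, ?_⟩
  have hneg : ∀ {D : ℝ} {U : Fin n → ℝ → Vec n → ℂ}, AnaField α δ D U →
      AnaField α δ D (fun i t x => - U i t x) := fun h =>
    ⟨fun j => (h.meas j).neg, fun j s hs => (h.bound j s hs).neg⟩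
  induction m with
  | zero =>
    have e : (fun i t x => picard α H (0 + 1) i t x - picard α H 0 i t x) =
        fun i t x => - bilinearTerm α (tensorField H H) i t x := by
      funext i t x
      simp only [picard]
      ring
    rw [e]
    refine (hneg (anaField_bilinear hα hα' hδ₀ hA hδ hδδ hR (hmem 0))).mono hδ ?_
    have := mul_le_mul_of_nonneg_right hκ hR
    nlinarith
  | succ m ih =>
    have e : (fun i t x => picard α H (m + 1 + 1) i t x - picard α H (m + 1) i t x) =
        fun i t x => - (bilinearTerm α (tensorField (picard α H (m + 1)) (picard α H (m + 1))) i t x -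
          bilinearTerm α (tensorField (picard α H m) (picard α H m)) i t x) := by
      funext i t x
      rw [picard]
      conv_lhs => enter [2]; rw [picard]
      ring
    rw [e]
    refine (hneg (anaField_bilinear_sub hα hα' hδ₀ hA hδ hδδ hR (by positivity) (hmem (m + 1))
      (hmem m) ih)).mono hδ ?_
    have h1 := mul_le_mul_of_nonneg_right hκ (by positivity : 0 ≤ R / 2 * (1 / 2 : ℝ) ^ m)
    rw [pow_succ]
    nlinarith

theorem picard_im {α : ℝ} {H : Fin n → ℝ → Vec n → ℂ} (hH : ∀ i t x, (H i t x).im = 0) (m : ℕ) :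
    ∀ i t x, (picard α H m i t x).im = 0 := by
  induction m with
  | zero => exact hH
  | succ m ih =>
    intro i t x
    rw [picard, Complex.sub_im, hH, zero_sub, neg_eq_zero, bilinearTerm]
    split_ifs with ht
    · refine duhamelOp_im ht (fun j k s _ y => ?_) x i
      rw [tensorField, Complex.mul_im, ih, ih, mul_zero, zero_mul, add_zero]
    · rfl

/-- Existence of a fixed point with analytic bounds. -/
theorem exists_fixedPoint {α : ℝ} (hα : 1 / 2 < α) (hα' : α < 1) {δ₀ δ A : ℝ} (hδ₀ : 0 < δ₀)
    (hA : OseenKernelBound n α δ₀ A) (hδ : 0 < δ) (hδδ : δ ≤ δ₀) {R : ℝ} (hR : 0 ≤ R)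
    (hκ : bilinearConst n α A * R ≤ 1 / 4) {H : Fin n → ℝ → Vec n → ℂ}
    (hH : AnaField α δ (R / 2) H) (hHr : ∀ i t x, (H i t x).im = 0) :
    ∃ U : Fin n → ℝ → Vec n → ℂ, AnaField α δ (2 * R) U ∧ (∀ i t x, (U i t x).im = 0) ∧
      ∀ t, 0 < t → ∀ i x, U i t x = H i t x - duhamelOp α (tensorField U U) t x i := by
  have hP := anaField_picard hα hα' hδ₀ hA hδ hδδ hR hκ hH
  set P := picard α H with hPdef
  set γ := 1 - 1 / (2 * α) with hγ
  have hgs : Summable fun m : ℕ => (1 / 2 : ℝ) ^ m :=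
    summable_geometric_of_lt_one (by norm_num) (by norm_num)
  have hg2 : ∑' m : ℕ, (1 / 2 : ℝ) ^ m = 2 := tsum_geometric_two
  have hsum : ∀ i t x, 0 < t → Summable fun m => P (m + 1) i t x - P m i t x := fun i t x ht =>
    Summable.of_norm_bounded ((hgs.mul_left (R / 2)).mul_right (t ^ (-γ))) fun m =>
      ((hP m).2.bound i t ht).norm_le x
  -- The limit is written as a telescoping series so that `AnaBound.tsum` gives its analytic bounds.
  let U : Fin n → ℝ → Vec n → ℂ := fun i t x =>
    if 0 < t then H i t x + ∑' m, (P (m + 1) i t x - P m i t x) else 0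
  have hlim : ∀ i t x, 0 < t → Tendsto (fun m => P m i t x) atTop (𝓝 (U i t x)) := by
    intro i t x ht
    have h1 := (hsum i t x ht).hasSum.tendsto_sum_nat.const_add (H i t x)
    have e : ∀ m, H i t x + ∑ l ∈ Finset.range m, (P (l + 1) i t x - P l i t x) = P m i t x := by
      intro m
      rw [Finset.sum_range_sub (fun m => P m i t x)]
      change H i t x + (P m i t x - H i t x) = _
      ring
    simp only [e] at h1
    simp only [U, if_pos ht]
    exact h1
  have hUm : ∀ i, StronglyMeasurable fun q : ℝ × Vec n => U i q.1 q.2 := by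
    intro i
    have hs : MeasurableSet {q : ℝ × Vec n | 0 < q.1} :=
      measurableSet_lt measurable_const measurable_fst
    refine stronglyMeasurable_of_tendsto (f := fun (m : ℕ) (q : ℝ × Vec n) =>
      if 0 < q.1 then P m i q.1 q.2 else 0) atTop
      (fun m => ((hP m).1.meas i).ite hs stronglyMeasurable_const) ?_
    rw [tendsto_pi_nhds]
    intro q
    by_cases hq : 0 < q.1
    · simp only [if_pos hq]
      exact hlim i q.1 q.2 hq
    · simp only [U, if_neg hq]
      exact tendsto_const_nhds
  have hUA : AnaField α δ (2 * R) U := by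
    refine ⟨hUm, fun i t ht => ?_⟩
    have hr : 0 < δ * t ^ (1 / (2 * α)) := by positivity
    have h1 := (hH.bound i t ht).add (AnaBound.tsum (fun m => (hP m).2.bound i t ht)
      ((hgs.mul_left (R / 2)).mul_right (t ^ (-γ))))
    have e : U i t = fun x => H i t x + ∑' m, (P (m + 1) i t x - P m i t x) := by
      funext x
      simp only [U, if_pos ht]
    rw [e]
    -- The series of amplitudes adds up to R/2 + R, which is below 2R.
    refine h1.mono hr ?_
    rw [tsum_mul_right, tsum_mul_left, hg2]
    have : 0 ≤ R * t ^ (-γ) := by positivity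
    linarith
  refine ⟨U, hUA, fun i t x => ?_, fun t ht i x => ?_⟩
  · by_cases ht : 0 < t
    · have h1 := (Complex.continuous_im.tendsto _).comp (hlim i t x ht)
      have h2 : (Complex.im ∘ fun m => P m i t x) = fun _ => 0 :=
        funext fun m => picard_im hHr m i t x
      rw [h2] at h1
      exact tendsto_nhds_unique h1 tendsto_const_nhds
    · simp only [U, if_neg ht, Complex.zero_im]
  · have hdist : ∀ m j s y, 0 < s → ‖P m j s y - U j s y‖ ≤ R * (1 / 2) ^ m * s ^ (-γ) := by
      intro m j s y hs
      have h1 := dist_le_of_le_geometric_of_tendsto (1 / 2 : ℝ) (R / 2 * s ^ (-γ)) (by norm_num)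
        (fun m => by
          rw [dist_comm, dist_eq_norm]
          refine (((hP m).2.bound j s hs).norm_le y).trans_eq ?_
          ring) (hlim j s y hs) m
      rw [dist_eq_norm] at h1
      refine h1.trans_eq ?_
      ring
    -- To pass to the limit in the equation, geometric convergence in the weighted sup norm
    -- suffices.
    have hduh : Tendsto (fun m => duhamelOp α (tensorField (P m) (P m)) t x i) atTop
        (𝓝 (duhamelOp α (tensorField U U) t x i)) := by
      rw [tendsto_iff_norm_sub_tendsto_zero]
      refine squeeze_zero (fun _ => norm_nonneg _) (fun m => norm_duhamelOp_sub_le hα hα'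
        hA.oseenL1 (by positivity : 0 ≤ 2 * R) (by positivity : 0 ≤ R * (1 / 2 : ℝ) ^ m)
        ((hP m).1.mono hδ (by linarith)).supField hUA.supField
        (fun j s hs => Eventually.of_forall fun y => hdist m j s y hs) ht x i) ?_
      have h1 := ((((tendsto_pow_atTop_nhds_zero_of_lt_one (by norm_num : (0 : ℝ) ≤ 1 / 2)
        (by norm_num)).const_mul R).const_mul (2 * (2 * R))).const_mul (n ^ 2 * A *
          betaConst (1 / (2 * α)) (2 * (1 - 1 / (2 * α))))).mul_const (t ^ (-γ))
      simp only [mul_zero, zero_mul] at h1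
      exact h1
    have h1 := (hlim i t x ht).comp (tendsto_add_atTop_nat 1)
    have h2 : ((fun m => P m i t x) ∘ fun m => m + 1) = fun m =>
        H i t x - duhamelOp α (tensorField (P m) (P m)) t x i := by
      funext m
      simp only [Function.comp_apply, hPdef, picard, bilinearTerm, if_pos ht]
    rw [h2] at h1
    exact tendsto_nhds_unique h1 (hduh.const_sub _)

/-- Uniqueness in the weighted `L^∞` norm. -/
theorem fixedPoint_unique {α : ℝ} (hα : 1 / 2 < α) (hα' : α < 1) {A : ℝ}
    (hA : OseenL1 n α A) {r : ℝ} (hr : 0 ≤ r)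
    (hκ : n ^ 2 * A * betaConst (1 / (2 * α)) (2 * (1 - 1 / (2 * α))) * (2 * r) ≤ 1 / 2)
    {H U V : Fin n → ℝ → Vec n → ℂ} (hU : SupField α r U) (hV : SupField α r V)
    (eU : ∀ t, 0 < t → ∀ i x, U i t x = H i t x - duhamelOp α (tensorField U U) t x i)
    (eV : ∀ t, 0 < t → ∀ i x, V i t x = H i t x - duhamelOp α (tensorField V V) t x i)
    {t : ℝ} (ht : 0 < t) (i : Fin n) (x : Vec n) : U i t x = V i t x := by
  set γ := 1 - 1 / (2 * α) with hγ
  -- The integral equation holds at every point, so an almost everywhere bound on the difference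
  -- returns as a bound everywhere, with half the constant. Iteration forces the difference to
  -- vanish.
  have step : ∀ D : ℝ, 0 ≤ D → (∀ j s, 0 < s → ∀ᵐ y, ‖U j s y - V j s y‖ ≤ D * s ^ (-γ)) →
      ∀ j s y, 0 < s → ‖U j s y - V j s y‖ ≤ D * (1 / 2) * s ^ (-γ) := by
    intro D hD h j s y hs
    have h1 := norm_duhamelOp_sub_le hα hα' hA hr hD hU hV h hs y j
    rw [eU s hs j y, eV s hs j y, sub_sub_sub_cancel_left, norm_sub_rev]
    refine h1.trans ?_
    have h2 := mul_le_mul_of_nonneg_right hκ hD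
    have h3 : 0 ≤ s ^ (-γ) := by positivity
    refine mul_le_mul_of_nonneg_right ?_ h3
    linarith
  have hall : ∀ m : ℕ, ∀ j s, 0 < s → ∀ᵐ y, ‖U j s y - V j s y‖ ≤
      2 * r * (1 / 2) ^ m * s ^ (-γ) := by
    intro m
    induction m with
    | zero =>
      intro j s hs
      filter_upwards [hU.bound j s hs, hV.bound j s hs] with y h1 h2
      refine (norm_sub_le _ _).trans ((add_le_add h1 h2).trans_eq ?_)
      ring
    | succ m ih =>
      intro j s hs
      refine Eventually.of_forall fun y => (step _ (by positivity) ih j s y hs).trans_eq ?_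
      ring
  have h0 : Tendsto (fun m : ℕ => 2 * r * (1 / 2 : ℝ) ^ m * (1 / 2) * t ^ (-γ)) atTop (𝓝 0) := by
    have h1 := (((tendsto_pow_atTop_nhds_zero_of_lt_one (by norm_num : (0 : ℝ) ≤ 1 / 2)
      (by norm_num)).const_mul (2 * r)).mul_const (1 / 2)).mul_const (t ^ (-γ))
    simpa using h1
  have h1 := ge_of_tendsto' h0 fun m => step _ (by positivity) (hall m) i t x ht
  exact sub_eq_zero.1 (norm_le_zero_iff.1 h1)

end FixedPoint

end FracNS

namespace FracNS

/-! ### Real vector fields -/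

section VectorFields

variable {n : ℕ}

/-- The components of a real vector field, as complex functions. -/
def componentField (u : ℝ → Vec n → Vec n) (i : Fin n) (s : ℝ) (y : Vec n) : ℂ := ((u s y i : ℝ) : ℂ)

theorem duhamel_eq_duhamelOp (α : ℝ) (u : ℝ → Vec n → Vec n) (t : ℝ) (x : Vec n) (i : Fin n) :
    duhamel α u t x i =
      duhamelOp α (tensorField (componentField u) (componentField u)) t x i := by
  simp only [duhamel, duhamelOp, tensorField, componentField, Complex.ofReal_mul]

theorem supField_componentField {α r : ℝ} (hr : 0 ≤ r) {u : ℝ → Vec n → Vec n}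
    (hm : AEStronglyMeasurable (fun p : ℝ × Vec n => u p.1 p.2)
      (volume.restrict (Ioi (0 : ℝ) ×ˢ (univ : Set (Vec n)))))
    (hu : gxNorm α u ≤ ENNReal.ofReal r) : SupField α r (componentField u) := by
  refine ⟨fun j => ?_, fun j s hs => ?_⟩
  · have h : Continuous fun v : Vec n => ((v j : ℝ) : ℂ) := by fun_prop
    exact h.comp_aestronglyMeasurable hm
  · have h1 : ENNReal.ofReal (s ^ (1 - 1 / (2 * α))) * eLpNorm (u s) ⊤ volume ≤
        ENNReal.ofReal r :=
      (le_iSup₂ (f := fun (t : ℝ) (_ : 0 < t) =>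
        ENNReal.ofReal (t ^ (1 - 1 / (2 * α))) * eLpNorm (u t) ⊤ volume) s hs).trans hu
    rw [eLpNorm_exponent_top] at h1
    filter_upwards [ae_le_eLpNormEssSup (f := u s) (μ := volume)] with y hy
    have h2 := (mul_le_mul_right hy (ENNReal.ofReal (s ^ (1 - 1 / (2 * α))))).trans h1
    rw [← ofReal_norm, ← ENNReal.ofReal_mul (by positivity),
      ENNReal.ofReal_le_ofReal_iff hr] at h2
    have h3 : ‖componentField u j s y‖ ≤ ‖u s y‖ := by
      rw [componentField, Complex.norm_real]
      exact PiLp.norm_apply_le _ j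
    refine h3.trans ?_
    have h4 : s ^ (-(1 - 1 / (2 * α))) * s ^ (1 - 1 / (2 * α)) = 1 := by
      rw [← Real.rpow_add hs, neg_add_cancel, Real.rpow_zero]
    calc ‖u s y‖ = s ^ (-(1 - 1 / (2 * α))) * (s ^ (1 - 1 / (2 * α)) * ‖u s y‖) := by
          rw [← mul_assoc, h4, one_mul]
      _ ≤ s ^ (-(1 - 1 / (2 * α))) * r := by gcongr
      _ = _ := mul_comm _ _

/-- The real vector field with given components. -/
noncomputable def vectorField (U : Fin n → ℝ → Vec n → ℂ) (t : ℝ) (x : Vec n) : Vec n :=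
  WithLp.toLp 2 fun i => (U i t x).re

theorem componentField_vectorField {U : Fin n → ℝ → Vec n → ℂ} (hU : ∀ i t x, (U i t x).im = 0) :
    componentField (vectorField U) = U := by
  funext i t x
  exact Complex.ext rfl (hU i t x).symm

theorem anaBound_vectorField {r M : ℝ} (hr : 0 < r) {U : Fin n → ℝ → Vec n → ℂ} {t : ℝ}
    (hU : ∀ i, AnaBound r M (U i t)) : AnaBound r (n * M) (vectorField U t) := by
  let L : Fin n → ℂ →L[ℝ] Vec n := fun i => Complex.reCLM.smulRight (basisVec i)
  have hL : ∀ i, ‖L i‖ ≤ 1 := fun i => by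
    refine ContinuousLinearMap.opNorm_le_bound _ zero_le_one fun z => ?_
    simp only [L, ContinuousLinearMap.smulRight_apply, Complex.reCLM_apply, norm_smul, basisVec,
      PiLp.norm_single, norm_one, mul_one, one_mul, Real.norm_eq_abs]
    exact Complex.abs_re_le_norm z
  have e : vectorField U t = fun x => ∑ i, L i (U i t x) := by
    funext x
    ext j
    simp [L, vectorField, basisVec, Finset.sum_apply, Pi.single_apply]
  rw [e]
  refine (AnaBound.sum fun i _ => ((hU i).clm_comp (L i)).mono hr
    (mul_le_of_le_one_left (hU i).nonneg (hL i))).mono hr (le_of_eq ?_)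
  simp

theorem stronglyMeasurable_vectorField {U : Fin n → ℝ → Vec n → ℂ}
    (hU : ∀ i, StronglyMeasurable fun q : ℝ × Vec n => U i q.1 q.2) :
    StronglyMeasurable fun q : ℝ × Vec n => vectorField U q.1 q.2 := by
  have h1 : Measurable fun q : ℝ × Vec n => fun i => (U i q.1 q.2).re :=
    measurable_pi_lambda _ fun i => Complex.measurable_re.comp (hU i).measurable
  exact ((PiLp.continuous_toLp 2 _).measurable.comp h1).stronglyMeasurable

theorem gxNorm_le {α δ r : ℝ} {u : ℝ → Vec n → Vec n}
    (hu : ∀ t, 0 < t → AnaBound (δ * t ^ (1 / (2 * α))) (r * t ^ (-(1 - 1 / (2 * α)))) (u t)) :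
    gxNorm α u ≤ ENNReal.ofReal r := by
  refine iSup₂_le fun t ht => ?_
  have h1 : eLpNorm (u t) ⊤ volume ≤ ENNReal.ofReal (r * t ^ (-(1 - 1 / (2 * α)))) := by
    rw [eLpNorm_exponent_top]
    refine eLpNormEssSup_le_of_ae_bound (Eventually.of_forall fun x => (hu t ht).norm_le x)
  refine (mul_le_mul_right h1 _).trans ?_
  rw [← ENNReal.ofReal_mul (by positivity), mul_left_comm, ← Real.rpow_add ht, add_neg_cancel,
    Real.rpow_zero, mul_one]

theorem factorial_le_pow_pred {k : ℕ} (hk : 1 ≤ k) : k.factorial ≤ k ^ (k - 1) := by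
  induction k, hk using Nat.le_induction with
  | base => simp
  | succ m hm ih =>
    rw [Nat.factorial_succ, Nat.add_sub_cancel]
    calc (m + 1) * m.factorial ≤ (m + 1) * (m + 1) ^ (m - 1) := by
          gcongr
          exact ih.trans (Nat.pow_le_pow_left (Nat.le_succ m) _)
      _ = (m + 1) ^ m := by
          rw [← pow_succ', Nat.sub_add_cancel hm]

/-- The powers of t cancel by scaling, leaving r k!/δ^k. The assumption r ≤ δ absorbs one factor 1/δ
and k! ≤ k^(k-1) does the rest, so that C = 1/δ works with the exponent k - 1 and no further
constant. -/
theorem gxNormDeriv_le {α δ r : ℝ} (hδ : 0 < δ) (hrδ : r ≤ δ)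
    {u : ℝ → Vec n → Vec n}
    (hu : ∀ t, 0 < t → AnaBound (δ * t ^ (1 / (2 * α))) (r * t ^ (-(1 - 1 / (2 * α)))) (u t))
    {k : ℕ} (hk : 1 ≤ k) :
    gxNormDeriv α k u ≤ ENNReal.ofReal ((1 / δ) ^ (k - 1) * (k : ℝ) ^ (k - 1)) := by
  refine iSup_le fun d => iSup₂_le fun t ht => ?_
  have hs : 0 < δ * t ^ (1 / (2 * α)) := by positivity
  set c := t ^ (-(1 - 1 / (2 * α))) with hc
  have hc0 : 0 < c := by positivity
  have hpt : ∀ x, ‖iteratedFDeriv ℝ k (u t) x (fun l => basisVec (d l))‖ ≤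
      δ * c * (k.factorial / (δ * t ^ (1 / (2 * α))) ^ k) := fun x => by
    refine ((iteratedFDeriv ℝ k (u t) x).le_opNorm _).trans ?_
    have h1 : ∏ l, ‖(basisVec (d l) : Vec n)‖ = 1 :=
      Finset.prod_eq_one fun l _ => by simp [basisVec]
    rw [h1, mul_one]
    refine ((hu t ht).bound k x).trans ?_
    exact mul_le_mul (by gcongr) (anaWeight_le hs k) (anaWeight_pos hs k).le (by positivity)
  have h1 : eLpNorm (fun x => iteratedFDeriv ℝ k (u t) x (fun l => basisVec (d l))) ⊤ volume ≤
      ENNReal.ofReal (δ * c * (k.factorial / (δ * t ^ (1 / (2 * α))) ^ k)) := by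
    rw [eLpNorm_exponent_top]
    exact eLpNormEssSup_le_of_ae_bound (Eventually.of_forall hpt)
  refine (mul_le_mul_right h1 _).trans ?_
  rw [← ENNReal.ofReal_mul (by positivity)]
  refine ENNReal.ofReal_le_ofReal ?_
  have h2 : t ^ (1 - 1 / (2 * α) + k / (2 * α)) * c = (t ^ (1 / (2 * α))) ^ k := by
    rw [hc, ← Real.rpow_add ht, ← Real.rpow_natCast, ← Real.rpow_mul ht.le]
    congr 1
    ring
  have h3 : 0 < t ^ (1 / (2 * α)) := by positivity
  have h4 : δ * (1 / δ) ^ k = (1 / δ) ^ (k - 1) := by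
    obtain ⟨m, rfl⟩ : ∃ m, k = m + 1 := ⟨k - 1, by omega⟩
    rw [Nat.add_sub_cancel, pow_succ]
    field_simp
  calc _ = δ * (t ^ (1 - 1 / (2 * α) + k / (2 * α)) * c) *
        (k.factorial / (δ * t ^ (1 / (2 * α))) ^ k) := by ring
    _ = δ * (1 / δ) ^ k * k.factorial := by
        have h5 : δ ^ k * (1 / δ) ^ k = 1 := by
          rw [← mul_pow, mul_one_div_cancel hδ.ne', one_pow]
        rw [h2, mul_pow]
        field_simp
        linear_combination -h5
    _ ≤ _ := by
        rw [h4]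
        have : (k.factorial : ℝ) ≤ (k : ℝ) ^ (k - 1) := by
          exact_mod_cast factorial_le_pow_pred hk
        gcongr

end VectorFields

end FracNS

/-! ### Choice of the constants and conclusion -/

theorem mainTheorem5 (n : ℕ) (hn : 1 ≤ n) (α : ℝ) (hα : 1 / 2 < α) (hα' : α < 1) :
    ∃ ε r C : ℝ, 0 < ε ∧ 0 < r ∧ 0 < C ∧
      ∀ u₀ : Fin n → 𝓢'(FracNS.Vec n, ℂ), FracNS.IsInitialVelocity u₀ →
        FracNS.bNorm α u₀ ≤ ENNReal.ofReal ε →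
        ∃ u : ℝ → FracNS.Vec n → FracNS.Vec n,
          FracNS.IsMildSolution α u₀ u ∧ FracNS.gxNorm α u ≤ ENNReal.ofReal r ∧
          (∀ w : ℝ → FracNS.Vec n → FracNS.Vec n, FracNS.IsMildSolution α u₀ w →
            FracNS.gxNorm α w ≤ ENNReal.ofReal r → ∀ t : ℝ, 0 < t → w t = u t) ∧
          (∀ t : ℝ, 0 < t → AnalyticOnNhd ℝ (u t) Set.univ) ∧
          (∀ k : ℕ, 1 ≤ k →
            FracNS.gxNormDeriv α k u ≤ ENNReal.ofReal (C ^ (k - 1) * (k : ℝ) ^ (k - 1))) := by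
  have : NeZero n := ⟨by omega⟩
  obtain ⟨δ₀, A, hδ₀, hA0, hA⟩ := FracNS.exists_oseen_bound (n := n) hα
  obtain ⟨δ₁, A₁, hδ₁, hA₁0, hheat⟩ := FracNS.exists_heatFlow_bound (n := n) hα hα'
  have hA' : FracNS.OseenKernelBound n α δ₀ A := hA
  have hn0 : (0 : ℝ) < n := by exact_mod_cast hn
  have hn1 : (1 : ℝ) ≤ n := by exact_mod_cast hn
  have hp2 : 1 / 2 < 1 / (2 * α) := one_div_lt_one_div_of_lt (by linarith) (by linarith)
  have hp1 : 1 / (2 * α) < 1 := by rw [div_lt_one (by linarith)]; linarith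
  have hβ := FracNS.betaConst_pos hp1 (show 2 * (1 - 1 / (2 * α)) < 1 by linarith)
  set β := FracNS.betaConst (1 / (2 * α)) (2 * (1 - 1 / (2 * α))) with hβdef
  set κ := FracNS.bilinearConst n α A with hκ
  have hκ0 : 0 ≤ κ := by
    rw [hκ, FracNS.bilinearConst]
    positivity
  set δ := min δ₀ δ₁ with hδdef
  have hδ : 0 < δ := lt_min hδ₀ hδ₁
  -- The first entry gives the contraction and the uniqueness in the ball of radius n·2R. The second
  -- gives n·2R ≤ δ, as the derivative bounds require. The factor n is the price of passing from
  -- components to the Euclidean norm, and κ + 1 avoids dividing by zero.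
  set R := min (1 / (8 * n * (κ + 1))) (δ / (2 * n)) with hRdef
  have hR : 0 < R := by positivity
  have hR1 : 8 * n * (κ + 1) * R ≤ 1 := by
    have h := min_le_left (1 / (8 * n * (κ + 1))) (δ / (2 * n))
    rw [← hRdef, le_div_iff₀ (by positivity)] at h
    linarith
  have hR2 : n * (2 * R) ≤ δ := by
    have h := min_le_right (1 / (8 * n * (κ + 1))) (δ / (2 * n))
    rw [← hRdef, le_div_iff₀ (by positivity)] at h
    linarith
  have hnκ : n * κ * R ≤ 1 / 8 := by
    have : 0 ≤ n * R := by positivity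
    nlinarith
  have hκR : κ * R ≤ 1 / 4 := by
    have h1 : κ * R ≤ n * (κ * R) := le_mul_of_one_le_left (by positivity) hn1
    linarith
  -- Chosen so that the heat flow of the data has amplitude at most R/2, as the iteration requires.
  set ε := R / (2 * (A₁ + 1)) with hεdef
  have hε : 0 < ε := by positivity
  have hAε : A₁ * ε ≤ R / 2 := by
    have h1 : (A₁ + 1) * ε = R / 2 := by rw [hεdef]; field_simp
    linarith
  refine ⟨ε, n * (2 * R), 1 / δ, hε, by positivity, by positivity, fun u₀ hu₀ hb => ?_⟩
  have hbi : ∀ i, FracNS.besovNorm α (u₀ i) ≤ ENNReal.ofReal ε := fun i =>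
    (le_iSup (fun i => FracNS.besovNorm α (u₀ i)) i).trans hb
  -- The heat flow is only controlled for t > 0; extending it by zero makes it measurable on the
  -- whole space-time.
  let H : Fin n → ℝ → FracNS.Vec n → ℂ := fun i t x =>
    if 0 < t then FracNS.heatFlow α t (u₀ i) x else 0
  have hHeq : ∀ i t x, 0 < t → H i t x = FracNS.heatFlow α t (u₀ i) x := fun i t x ht => by
    simp only [H, if_pos ht]
  have hH : FracNS.AnaField α δ (R / 2) H := by
    refine ⟨fun i => FracNS.stronglyMeasurable_heatFlow hα hα' hε.le (hbi i), fun i t ht => ?_⟩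
    have h1 := (hheat (u₀ i) ε hε.le (hbi i) t ht).1
    rw [funext fun x => hHeq i t x ht]
    have h2 : 0 < δ * t ^ (1 / (2 * α)) := by positivity
    have h3 : δ ≤ δ₁ := min_le_right _ _
    exact (h1.anti h2 (by gcongr)).mono h2 (by gcongr)
  have hHr : ∀ i t x, (H i t x).im = 0 := fun i t x => by
    simp only [H]
    split_ifs
    · exact FracNS.heatFlow_im (hu₀.real i) α t x
    · rfl
  obtain ⟨U, hU, hUr, hUeq⟩ := FracNS.exists_fixedPoint hα hα' hδ₀ hA' hδ (min_le_left _ _)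
    hR.le hκR hH hHr
  have hcomp := FracNS.componentField_vectorField hUr
  set u := FracNS.vectorField U with hu
  have hana : ∀ t, 0 < t → FracNS.AnaBound (δ * t ^ (1 / (2 * α)))
      (n * (2 * R) * t ^ (-(1 - 1 / (2 * α)))) (u t) := fun t ht => by
    rw [mul_assoc]
    exact FracNS.anaBound_vectorField (by positivity) fun i => hU.bound i t ht
  have hgx := FracNS.gxNorm_le hana
  have hsol : FracNS.IsMildSolution α u₀ u := by
    refine ⟨(FracNS.stronglyMeasurable_vectorField hU.meas).aestronglyMeasurable,
      hgx.trans_lt ENNReal.ofReal_lt_top, fun t ht x i => ?_⟩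
    rw [FracNS.duhamel_eq_duhamelOp, hcomp, ← hHeq i t x ht, ← hUeq t ht i x]
    exact congrFun (congrFun (congrFun hcomp i) t) x
  refine ⟨u, hsol, hgx, fun w hw hwr t ht => ?_, fun t ht => ?_, fun k hk => ?_⟩
  -- The sup-norm estimate lacks the factor 256 contained in κ, so the smallness of nκR is more than
  -- enough for uniqueness.
  · have hsmall : n ^ 2 * A * β * (2 * (n * (2 * R))) ≤ 1 / 2 := by
      have h1 : κ = 256 * (n ^ 2 * A * β) := by rw [hκ, FracNS.bilinearConst]; ring
      rw [h1] at hnκ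
      have h2 : n ^ 2 * A * β * (2 * (n * (2 * R))) = 4 * (n * (n ^ 2 * A * β) * R) := by ring
      have h3 : 0 ≤ n * (n ^ 2 * A * β) * R := by positivity
      linarith
    have heq : ∀ {v : ℝ → FracNS.Vec n → FracNS.Vec n}, FracNS.IsMildSolution α u₀ v →
        ∀ t, 0 < t → ∀ i x, FracNS.componentField v i t x = H i t x - FracNS.duhamelOp α
          (FracNS.tensorField (FracNS.componentField v) (FracNS.componentField v)) t x i :=
      fun {v} hv t ht i x => by
        rw [hHeq i t x ht, ← FracNS.duhamel_eq_duhamelOp]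
        exact hv.eqn t ht x i
    funext x
    ext i
    have h1 := FracNS.fixedPoint_unique hα hα' hA'.oseenL1 (by positivity) hsmall
      (FracNS.supField_componentField (by positivity) hw.measurable hwr)
      (FracNS.supField_componentField (by positivity) hsol.measurable hgx)
      (heq hw) (heq hsol) ht i x
    exact Complex.ofReal_injective h1
  · exact (hana t ht).analyticOnNhd (by positivity)
  · exact FracNS.gxNormDeriv_le hδ hR2 hana hk
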